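/- Composition is written in diagrammatic order. A *Cartesian category* is a category with chosen finite products (a chosen terminal object $1$ and chosen binary products); $\mathbf{cartCat}$ is the category of (small) Cartesian categories and functors preserving the chosen finite products exactly. If $(A,+_A,0_A)$ is a commutative monoid in a Cartesian category and $f,g:X\to A$, write $f+g=\langle f,g\rangle +_A$ and $0={!}\,0_A$. Products $L\times M$ of commutative monoids carry the componentwise structure. **The comonad.** For a Cartesian category $\mathbb X$, let $\mathsf{Fa\grave a}(\mathbb X)$ be the following Cartesian category. Objects are pairs $(A,X)$ of a commutative monoid $A=(A,+,0)$ in $\mathbb X$ and an object $X$ of $\mathbb X$. A morphism $(A,X)\to(B,Y)$ is a sequence $f=(f_*,f_1,f_2,\dots)$ with $f_*:X\to Y$ and $f_n:A^n\times X\to B$ for $n\ge 1$, each $f_n$ being symmetric and additive (preserving $+$ and $0$) in each of its first $n$ variables. Composition is given by $(fg)_*=f_*g_*$ and the Faà di Bruno formula $$(fg)_n(a_1,\dots,a_n;x)=\sum_{\pi}g_{|\pi|}\big((f_{|P|}((a_i)_{i\in P};x))_{P\in\pi};f_*(x)\big),$$ the sum being over all partitions $\pi$ of $\{1,\dots,n\}$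 (formulas in generalized elements), identities are $(1,\pi_0,0,0,\dots)$. Products are $(A,X)\times(B,Y)=(A\times B,X\times Y)$ with projections $(\pi_i,\pi_0\pi_i,0,0,\dots)$, and the terminal object is $(1,1)$. Applying a functor to all the data componentwise makes $\mathsf{Fa\grave a}$ an endofunctor of $\mathbf{cartCat}$. Let $\varepsilon:\mathsf{Fa\grave a}(\mathbb X)\to\mathbb X$ be $(A,X)\mapsto X$, $f\mapsto f_*$, and let $\delta:\mathsf{Fa\grave a}(\mathbb X)\to\mathsf{Fa\grave a}^2(\mathbb X)$ be given on objects by $$\delta(A,X)=\big(((A,A),(+,\pi_0+,0,\dots),(0,\pi_0 0,0,\dots)),(A,X)\big)$$ and on morphisms by $\delta(f)_*=f$, $(\delta(f)_n)_*=f_n$ and, for $n,m\ge 1$, $$(\delta(f)_n)_m\big((u_{1j},\dots,u_{nj},w_j)_{1\le j\le m};a_1,\dots,a_n,x\big)=\sum_{\sigma}f_{n+m-|\sigma|}\big((b^\sigma_i)_{1\le i\le n},(w_j)_{j\notin\operatorname{im}\sigma};x\big),$$ the sum being over all partial injections $\sigma:\{1,\dots,n\}\rightharpoonup\{1,\dots,m\}$,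 with $|\sigma|$ the size of the domain of $\sigma$, and $b_i^\sigma=u_{i\sigma(i)}$ if $\sigma(i)$ is defined, $b_i^\sigma=a_i$ otherwise. **Generalized Cartesian differential categories.** Such a category is a Cartesian category with a commutative monoid $L(X)=(L_0(X),+_X,0_X)$ for each object $X$, satisfying $$L(L_0(X))=L(X),\qquad L(1)=1,\qquad L(X\times Y)=L(X)\times L(Y),$$ and a map $D[f]:L_0(X)\times X\to L_0(Y)$ for each map $f:X\to Y$, such that (for all maps for which the expressions make sense) 1. [CD.1] $D[+_X]=\pi_0+_X$ and $D[0_X]=\pi_00_X$; 2. [CD.2] $\langle a+b,c\rangle D[f]=\langle a,c\rangle D[f]+\langle b,c\rangle D[f]$ and $\langle 0,a\rangle D[f]=0$; 3. [CD.3] $D[\pi_0]=\pi_0\pi_0$ and $D[\pi_1]=\pi_0\pi_1$; 4. [CD.4] $D[\langle f,g\rangle]=\langle D[f],D[g]\rangle$; 5. [CD.5] $D[fg]=\langle D[f],\pi_1f\rangle D[g]$; 6. [CD.6] $\langle\langle a,0\rangle,\langle c,d\rangle\rangle D[D[f]]=\langle a,d\rangle D[f]$; 7. [CD.7] $\langle\langle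 0,b\rangle,\langle c,d\rangle\rangle D[D[f]]=\langle\langle 0,c\rangle,\langle b,d\rangle\rangle D[D[f]]$. A morphism of generalized Cartesian differential categories is a functor $F$ preserving the chosen finite products, $L$ and $D$ exactly. **Theorem.** $\delta$ is well defined and natural in $\mathbf{cartCat}$, and $(\mathsf{Fa\grave a},\varepsilon,\delta)$ is a comonad on $\mathbf{cartCat}$. Its coalgebras are exactly the generalized Cartesian differential categories: there is an isomorphism, over $\mathbf{cartCat}$, between the category of coalgebras of this comonad and the category of generalized Cartesian differential categories, under which a coalgebra $\mathcal D:\mathbb X\to\mathsf{Fa\grave a}(\mathbb X)$ corresponds to the structure on $\mathbb X$ with $\mathcal D(X)=(L(X),X)$ and $D[f]=\mathcal D(f)_1$. In particular, the forgetful functor from generalized Cartesian differential categories to $\mathbf{cartCat}$ is comonadic. -/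

import Mathlib

open CategoryTheory MonoidalCategory CartesianMonoidalCategory

universe v u

namespace GenDiff

attribute [local instance] BraidedCategory.ofCartesianMonoidalCategory Hom.addCommMonoid

/-! ### Commutative monoids in a cartesian category -/

/-- A (bundled) commutative monoid in a category with chosen finite products. -/
structure CMon (C : Type u) [Category.{v} C] [CartesianMonoidalCategory C] where
  X : C
  [mon : AddMonObj X]
  [comm : IsCommAddMonObj X]

attribute [instance] CMon.mon CMon.comm

section Tuples

variable {C : Type u} [Category.{v} C] [CartesianMonoidalCategory C]

/-- The addition map of a commutative monoid. -/
abbrev CMon.add (A : CMon C) : A.X ⊗ A.X ⟶ A.X := AddMonObj.add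

/-- The zero map of a commutative monoid. -/
abbrev CMon.zero (A : CMon C) : 𝟙_ C ⟶ A.X := AddMonObj.zero

/-- The product of two commutative monoids. -/
abbrev CMon.prod (A B : CMon C) : CMon C where
  X := A.X ⊗ B.X

/-- The terminal object as a commutative monoid. -/
abbrev CMon.triv (C : Type u) [Category.{v} C] [CartesianMonoidalCategory C] : CMon C where
  X := 𝟙_ C

section
variable {A B : C} [AddMonObj A] [IsCommAddMonObj A] [AddMonObj B] [IsCommAddMonObj B]

lemma add_eq {Z : C} (f g : Z ⟶ A) : f + g = lift f g ≫ AddMonObj.add := rfl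

lemma zero_eq {Z : C} : (0 : Z ⟶ A) = toUnit Z ≫ AddMonObj.zero := rfl

lemma comp_add {Z W : C} (h : W ⟶ Z) (f g : Z ⟶ A) : h ≫ (f + g) = h ≫ f + h ≫ g := by
  simp only [add_eq, ← Category.assoc, comp_lift]

lemma comp_zero {Z W : C} (h : W ⟶ Z) : h ≫ (0 : Z ⟶ A) = 0 := by
  simp only [zero_eq, ← Category.assoc, comp_toUnit]

/-- Precomposition as a homomorphism. -/
def preHom {Z W : C} (h : W ⟶ Z) (A : C) [AddMonObj A] [IsCommAddMonObj A] :
    (Z ⟶ A) →+ (W ⟶ A) where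
  toFun f := h ≫ f
  map_zero' := comp_zero h
  map_add' := comp_add h

lemma comp_sum {Z W : C} (h : W ⟶ Z) {ι : Type*} (s : Finset ι) (f : ι → (Z ⟶ A)) :
    h ≫ ∑ i ∈ s, f i = ∑ i ∈ s, h ≫ f i :=
  map_sum (preHom h A) f s

lemma add_comp {Z : C} (f g : Z ⟶ A) (u : A ⟶ B) [IsAddMonHom u] :
    (f + g) ≫ u = f ≫ u + g ≫ u := by
  simp [add_eq]

lemma zero_comp {Z : C} (u : A ⟶ B) [IsAddMonHom u] : (0 : Z ⟶ A) ≫ u = 0 := by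
  simp [zero_eq]

lemma lift_add {Z : C} (f f' : Z ⟶ A) (g g' : Z ⟶ B) :
    lift (f + f') (g + g') = lift f g + lift f' g' := by
  ext
  · simp [add_comp]
  · simp [add_comp]

lemma lift_zero {Z : C} : lift (0 : Z ⟶ A) (0 : Z ⟶ B) = 0 := by
  ext
  · simp [zero_comp]
  · simp [zero_comp]

end

/-- `A ⊗ (A ⊗ ⋯ ⊗ (A ⊗ X))`, with `n` factors `A`. -/
@[reducible] def pow (A X : C) : ℕ → C
  | 0 => X
  | n + 1 => A ⊗ pow A X n

/-- The map into `A ⊗ (A ⊗ ⋯ ⊗ X)` with the given components. -/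
def tuple {A X Z : C} : ∀ {n : ℕ}, (Fin n → (Z ⟶ A)) → (Z ⟶ X) → (Z ⟶ pow A X n)
  | 0, _, x => x
  | _ + 1, a, x => lift (a 0) (tuple (fun i => a i.succ) x)

/-- The projection of `A ⊗ (A ⊗ ⋯ ⊗ X)` to the `i`-th factor `A`. -/
def proj (A X : C) : ∀ {n : ℕ}, Fin n → (pow A X n ⟶ A)
  | n + 1, i => Fin.cases (motive := fun _ => pow A X (n + 1) ⟶ A) (fst A (pow A X n))
      (fun j => snd A (pow A X n) ≫ proj A X j) i

/-- The projection of `A ⊗ (A ⊗ ⋯ ⊗ X)` to the last factor `X`. -/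
def base (A X : C) : ∀ n : ℕ, (pow A X n ⟶ X)
  | 0 => 𝟙 X
  | n + 1 => snd A (pow A X n) ≫ base A X n

@[simp]
lemma tuple_proj {A X Z : C} {n : ℕ} (a : Fin n → (Z ⟶ A)) (x : Z ⟶ X) (i : Fin n) :
    tuple a x ≫ proj A X i = a i := by
  induction n with
  | zero => exact i.elim0
  | succ n ih =>
    refine Fin.cases ?_ (fun j => ?_) i
    · simp [tuple, proj]
    · simp [tuple, proj, ih]

@[simp]
lemma tuple_base {A X Z : C} {n : ℕ} (a : Fin n → (Z ⟶ A)) (x : Z ⟶ X) :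
    tuple a x ≫ base A X n = x := by
  induction n with
  | zero => simp [tuple, base]
  | succ n ih => simp [tuple, base, ih]

@[simp]
lemma tuple_proj_assoc {A X Z W : C} {n : ℕ} (a : Fin n → (Z ⟶ A)) (x : Z ⟶ X) (i : Fin n)
    (h : A ⟶ W) : tuple a x ≫ proj A X i ≫ h = a i ≫ h := by
  rw [← Category.assoc, tuple_proj]

@[simp]
lemma tuple_base_assoc {A X Z W : C} {n : ℕ} (a : Fin n → (Z ⟶ A)) (x : Z ⟶ X) (h : X ⟶ W) :
    tuple a x ≫ base A X n ≫ h = x ≫ h := by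
  rw [← Category.assoc, tuple_base]

lemma comp_tuple {A X Z W : C} {n : ℕ} (h : W ⟶ Z) (a : Fin n → (Z ⟶ A)) (x : Z ⟶ X) :
    h ≫ tuple a x = tuple (fun i => h ≫ a i) (h ≫ x) := by
  induction n with
  | zero => rfl
  | succ n ih => simp [tuple, ih]

@[simp]
lemma tuple_proj_base (A X : C) (n : ℕ) :
    tuple (fun i => proj A X i) (base A X n) = 𝟙 (pow A X n) := by
  induction n with
  | zero => rfl
  | succ n ih =>
    have : tuple (fun i : Fin n => proj A X i.succ) (base A X (n + 1)) = snd A (pow A X n) := by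
      have := comp_tuple (snd A (pow A X n)) (fun i : Fin n => proj A X i) (base A X n)
      rw [ih, Category.comp_id] at this
      exact this.symm
    simp only [tuple, this]
    exact lift_fst_snd

end Tuples

/-! ### The category `Faa C` -/

/-- An object of `Faa C`: a commutative monoid and an object of `C`. -/
structure Faa (C : Type u) [Category.{v} C] [CartesianMonoidalCategory C] where
  V : CMon C
  P : C

variable {C : Type u} [Category.{v} C] [CartesianMonoidalCategory C]

/-- A morphism of `Faa C`: a map `pt` on points together with, for each `n ≥ 1`, a map `app n`
from `n` vectors and a point, additive and symmetric in the vectors. -/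
@[ext]
structure FaaHom (A B : Faa C) where
  pt : A.P ⟶ B.P
  app (n : ℕ+) : pow A.V.X A.P n ⟶ B.V.X
  map_add (n : ℕ+) {Z : C} (a : Fin n → (Z ⟶ A.V.X)) (x : Z ⟶ A.P) (i : Fin n)
    (s t : Z ⟶ A.V.X) :
    tuple (Function.update a i (s + t)) x ≫ app n =
      tuple (Function.update a i s) x ≫ app n + tuple (Function.update a i t) x ≫ app n
  map_zero (n : ℕ+) {Z : C} (a : Fin n → (Z ⟶ A.V.X)) (x : Z ⟶ A.P) (i : Fin n) :
    tuple (Function.update a i 0) x ≫ app n = 0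
  map_perm (n : ℕ+) {Z : C} (a : Fin n → (Z ⟶ A.V.X)) (x : Z ⟶ A.P) (e : Equiv.Perm (Fin n)) :
    tuple (a ∘ e) x ≫ app n = tuple a x ≫ app n

/-- The number of elements of a nonempty finite type. -/
noncomputable def card (ι : Type*) [Finite ι] [Nonempty ι] : ℕ+ := ⟨Nat.card ι, Nat.card_pos⟩

/-- An enumeration of a nonempty finite type. -/
noncomputable def enum (ι : Type*) [Finite ι] [Nonempty ι] : ι ≃ Fin (card ι) := Finite.equivFin ι

namespace FaaHom

variable {A B : Faa C}

/-- The value of `f.app n` at vectors indexed by a set with `n` elements; by symmetry the order in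
which the vectors are listed does not matter. -/
noncomputable def eval (f : FaaHom A B) {ι : Type*} [Finite ι] [Nonempty ι] {Z : C}
    (a : ι → (Z ⟶ A.V.X)) (x : Z ⟶ A.P) : Z ⟶ B.V.X :=
  tuple (n := card ι) (a ∘ (enum ι).symm) x ≫ f.app (card ι)

lemma eval_eq (f : FaaHom A B) {ι : Type*} [Finite ι] [Nonempty ι] {Z : C}
    (a : ι → (Z ⟶ A.V.X)) (x : Z ⟶ A.P) {n : ℕ+} (e : ι ≃ Fin n) :
    f.eval a x = tuple (a ∘ e.symm) x ≫ f.app n := by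
  have hn : card ι = n := PNat.coe_injective (by simpa [card] using Nat.card_congr e)
  subst hn
  rw [← f.map_perm (card ι) _ x ((enum ι).symm.trans e)]
  unfold eval
  congr 2
  funext i
  simp

lemma eval_fin (f : FaaHom A B) {n : ℕ+} {Z : C}
    (a : Fin n → (Z ⟶ A.V.X)) (x : Z ⟶ A.P) :
    haveI : Nonempty (Fin n) := ⟨⟨0, n.pos⟩⟩
    f.eval a x = tuple a x ≫ f.app n := by
  have : Nonempty (Fin n) := ⟨⟨0, n.pos⟩⟩
  exact f.eval_eq a x (Equiv.refl _)

lemma eval_equiv (f : FaaHom A B) {ι κ : Type*} [Finite ι] [Nonempty ι] [Finite κ] [Nonempty κ]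
    {Z : C} (a : ι → (Z ⟶ A.V.X)) (x : Z ⟶ A.P) (e : κ ≃ ι) :
    f.eval (a ∘ e) x = f.eval a x := by
  rw [f.eval_eq (a ∘ e) x (n := card ι) (e.trans (enum ι))]
  unfold eval
  congr 2
  funext i
  simp

lemma comp_eval (f : FaaHom A B) {ι : Type*} [Finite ι] [Nonempty ι] {Z W : C} (h : W ⟶ Z)
    (a : ι → (Z ⟶ A.V.X)) (x : Z ⟶ A.P) :
    h ≫ f.eval a x = f.eval (fun i => h ≫ a i) (h ≫ x) := by
  unfold eval
  rw [← Category.assoc, comp_tuple]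
  rfl

section

variable {ι : Type*} [Finite ι] [Nonempty ι] [DecidableEq ι]

lemma eval_add (f : FaaHom A B) {Z : C}
    (a : ι → (Z ⟶ A.V.X)) (x : Z ⟶ A.P) (i : ι) (s t : Z ⟶ A.V.X) :
    f.eval (Function.update a i (s + t)) x =
      f.eval (Function.update a i s) x + f.eval (Function.update a i t) x := by
  have := f.map_add (card ι) (a ∘ (enum ι).symm) x (enum ι i) s t
  simp only [eval, Function.update_comp_equiv, Equiv.symm_symm]
  simpa using this

lemma eval_zero (f : FaaHom A B) {Z : C}
    (a : ι → (Z ⟶ A.V.X)) (x : Z ⟶ A.P) (i : ι) :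
    f.eval (Function.update a i 0) x = 0 := by
  have := f.map_zero (card ι) (a ∘ (enum ι).symm) x (enum ι i)
  simp only [eval, Function.update_comp_equiv, Equiv.symm_symm]
  simpa using this

lemma eval_zero' (f : FaaHom A B) {Z : C}
    (a : ι → (Z ⟶ A.V.X)) (x : Z ⟶ A.P) (i : ι) (h : a i = 0) :
    f.eval a x = 0 := by
  rw [← f.eval_zero a x i, ← h, Function.update_eq_self]

end

/-- `f.eval` is multi-additive in the vectors. -/
noncomputable def evalMulti (f : FaaHom A B) (ι : Type*) [Finite ι] [Nonempty ι] {Z : C}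
    (x : Z ⟶ A.P) : MultilinearMap ℕ (fun _ : ι => (Z ⟶ A.V.X)) (Z ⟶ B.V.X) where
  toFun a := f.eval a x
  map_update_add' a i s t := f.eval_add a x i s t
  map_update_smul' a i k s := by
    induction k with
    | zero =>
      simp only [zero_smul]
      exact f.eval_zero a x i
    | succ k ih =>
      simp only [succ_nsmul] at ih ⊢
      rw [← ih]
      exact f.eval_add a x i _ _

lemma eval_sum (f : FaaHom A B) {ι : Type*} [Fintype ι] [Nonempty ι] {Z : C} {κ : ι → Type*}
    [DecidableEq ι] [∀ i, Fintype (κ i)] (a : ∀ i, κ i → (Z ⟶ A.V.X)) (x : Z ⟶ A.P) :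
    f.eval (fun i => ∑ k, a i k) x = ∑ r : ∀ i, κ i, f.eval (fun i => a i (r i)) x :=
  (f.evalMulti ι x).map_sum a


/-! #### Composition -/

instance (n : ℕ+) : Nonempty (Fin n) := ⟨⟨0, n.pos⟩⟩

instance {ι : Type*} [Finite ι] : Finite (Setoid ι) :=
  Finite.of_injective (fun r : Setoid ι => r.r) fun r s h => by
    cases r; cases s; cases h; rfl

noncomputable instance {ι : Type*} [Finite ι] : Fintype (Setoid ι) := Fintype.ofFinite _

/-- The block of the partition `r` with name `q`. -/
abbrev Block {ι : Type*} (r : Setoid ι) (q : Quotient r) : Type _ := {i : ι // Quotient.mk r i = q}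

instance {ι : Type*} (r : Setoid ι) (q : Quotient r) : Nonempty (Block r q) :=
  let ⟨i, hi⟩ := q.exists_rep
  ⟨⟨i, hi⟩⟩

instance {ι : Type*} [Nonempty ι] (r : Setoid ι) : Nonempty (Quotient r) :=
  ⟨Quotient.mk r (Classical.arbitrary ι)⟩

variable {D' : Faa C}

/-- The summand of the Faà di Bruno formula belonging to the partition `r`. -/
noncomputable def term (f : FaaHom A B) (g : FaaHom B D') {ι : Type*} [Finite ι] [Nonempty ι]
    {Z : C} (a : ι → (Z ⟶ A.V.X)) (x : Z ⟶ A.P) (r : Setoid ι) : Z ⟶ D'.V.X :=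
  g.eval (fun q : Quotient r => f.eval (fun i : Block r q => a i) x) (x ≫ f.pt)

/-- The Faà di Bruno formula: the sum over all partitions of the index set. -/
noncomputable def compVal (f : FaaHom A B) (g : FaaHom B D') {ι : Type*} [Finite ι] [Nonempty ι]
    {Z : C} (a : ι → (Z ⟶ A.V.X)) (x : Z ⟶ A.P) : Z ⟶ D'.V.X :=
  ∑ r : Setoid ι, f.term g a x r

lemma comp_compVal (f : FaaHom A B) (g : FaaHom B D') {ι : Type*} [Finite ι] [Nonempty ι]
    {Z W : C} (h : W ⟶ Z) (a : ι → (Z ⟶ A.V.X)) (x : Z ⟶ A.P) :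
    h ≫ f.compVal g a x = f.compVal g (fun i => h ≫ a i) (h ≫ x) := by
  unfold compVal term
  rw [comp_sum]
  refine Finset.sum_congr rfl fun r _ => ?_
  rw [comp_eval, Category.assoc]
  congr 1
  funext q
  rw [comp_eval]

lemma term_congr (f : FaaHom A B) (g : FaaHom B D') {ι κ : Type*} [Finite ι] [Nonempty ι]
    [Finite κ] [Nonempty κ] {Z : C} (a : ι → (Z ⟶ A.V.X)) (x : Z ⟶ A.P) (e : κ ≃ ι)
    (r : Setoid κ) (s : Setoid ι) (h : ∀ i j, r i j ↔ s (e i) (e j)) :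
    f.term g (a ∘ e) x r = f.term g a x s := by
  unfold term
  rw [← g.eval_equiv _ _ (Quotient.congr (ra := r) (rb := s) e h)]
  congr 1
  funext q
  induction q using Quotient.inductionOn with
  | h k =>
    exact (f.eval_equiv (ι := Block s ⟦e k⟧) (κ := Block r ⟦k⟧) (fun i => a i) x
      (e.subtypeEquiv fun i => Quotient.eq.trans ((h _ _).trans Quotient.eq.symm)))

lemma compVal_equiv (f : FaaHom A B) (g : FaaHom B D') {ι κ : Type*} [Finite ι] [Nonempty ι]
    [Finite κ] [Nonempty κ] {Z : C} (a : ι → (Z ⟶ A.V.X)) (x : Z ⟶ A.P) (e : κ ≃ ι) :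
    f.compVal g (a ∘ e) x = f.compVal g a x := by
  refine Fintype.sum_equiv
    { toFun := fun r => r.comap e.symm
      invFun := fun s => s.comap e
      left_inv := fun r => by ext; simp [Setoid.comap_rel]
      right_inv := fun s => by ext; simp [Setoid.comap_rel] } _ _ fun r => ?_
  exact f.term_congr g a x e r _ fun i j => by
    change _ ↔ r (e.symm (e i)) (e.symm (e j))
    simp

lemma term_update (f : FaaHom A B) (g : FaaHom B D') {ι : Type*} [Finite ι] [Nonempty ι]
    {Z : C} (a : ι → (Z ⟶ A.V.X)) (x : Z ⟶ A.P) (i : ι) (s : Z ⟶ A.V.X) (r : Setoid ι)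
    [DecidableEq ι] [DecidableEq (Quotient r)] :
    f.term g (Function.update a i s) x r =
      g.eval (Function.update (fun q : Quotient r => f.eval (fun i : Block r q => a i) x)
        (Quotient.mk r i) (f.eval (Function.update
          (fun j : Block r (Quotient.mk r i) => a j) ⟨i, rfl⟩ s) x)) (x ≫ f.pt) := by
  unfold term
  congr 1
  funext q
  by_cases hq : q = Quotient.mk r i
  · subst hq
    rw [Function.update_self]
    congr 1
    funext j
    by_cases hj : (j : ι) = i
    · obtain ⟨j, hj'⟩ := j
      obtain rfl : j = i := hj
      simp
    · rw [Function.update_of_ne hj, Function.update_of_ne fun h => hj (congrArg Subtype.val h)]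
  · rw [Function.update_of_ne hq]
    congr 1
    funext j
    rw [Function.update_of_ne]
    rintro h
    exact hq (j.2.symm.trans (congrArg _ h))

lemma tuple_compVal (f : FaaHom A B) (g : FaaHom B D') {n : ℕ+} {Z : C}
    (a : Fin n → (Z ⟶ A.V.X)) (x : Z ⟶ A.P) :
    tuple a x ≫ f.compVal g (fun i : Fin n => proj A.V.X A.P i) (base A.V.X A.P n) =
      f.compVal g a x := by
  rw [comp_compVal]
  simp only [tuple_proj, tuple_base]

/-- Composition in `Faa C`, by the Faà di Bruno formula. -/
noncomputable def comp (f : FaaHom A B) (g : FaaHom B D') : FaaHom A D' where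
  pt := f.pt ≫ g.pt
  app n := f.compVal g (fun i : Fin n => proj A.V.X A.P i) (base A.V.X A.P n)
  map_add n Z a x i s t := by
    classical
    rw [tuple_compVal, tuple_compVal, tuple_compVal]
    simp only [compVal, ← Finset.sum_add_distrib]
    refine Finset.sum_congr rfl fun r _ => ?_
    simp only [term_update, eval_add]
  map_zero n Z a x i := by
    classical
    rw [tuple_compVal]
    refine Finset.sum_eq_zero fun r _ => ?_
    simp only [term_update, eval_zero]
  map_perm n Z a x e := by
    rw [tuple_compVal, tuple_compVal, compVal_equiv]

@[simp] lemma comp_pt (f : FaaHom A B) (g : FaaHom B D') : (f.comp g).pt = f.pt ≫ g.pt := rfl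

lemma eval_comp (f : FaaHom A B) (g : FaaHom B D') {ι : Type*} [Finite ι] [Nonempty ι]
    {Z : C} (a : ι → (Z ⟶ A.V.X)) (x : Z ⟶ A.P) :
    (f.comp g).eval a x = f.compVal g a x := by
  refine (tuple_compVal f g _ x).trans ?_
  exact compVal_equiv f g a x (enum ι).symm

lemma ext_eval {f g : FaaHom A B} (hp : f.pt = g.pt)
    (h : ∀ (n : ℕ+) (Z : C) (a : Fin n → (Z ⟶ A.V.X)) (x : Z ⟶ A.P), f.eval a x = g.eval a x) :
    f = g := by
  ext n
  · exact hp
  · have := h n _ (fun i : Fin n => proj A.V.X A.P i) (base A.V.X A.P n)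
    rwa [eval_fin, eval_fin, tuple_proj_base, Category.id_comp, Category.id_comp] at this


/-! Associativity of composition. -/

/-- Equivalence relations finer than `t` are families of equivalence relations on its blocks. -/
lemma refine_bijective {ι : Type*} (t : Setoid ι) :
    Function.Bijective (fun (r : {r : Setoid ι // r ≤ t}) (q : Quotient t) =>
      (Setoid.comap (Subtype.val : Block t q → ι) r.1)) := by
  constructor
  · rintro ⟨r, hr⟩ ⟨r', hr'⟩ h
    apply Subtype.ext
    ext i j
    have key : ∀ k : ι, ∀ hi : Quotient.mk t i = Quotient.mk t k, r i k ↔ r' i k := fun k hi => by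
      have := congrFun h (Quotient.mk t k)
      exact Setoid.ext_iff.1 this ⟨i, hi⟩ ⟨k, rfl⟩
    exact ⟨fun hij => (key j (Quotient.sound (hr hij))).1 hij,
      fun hij => (key j (Quotient.sound (hr' hij))).2 hij⟩
  · intro s
    have conv : ∀ {q q' : Quotient t} (h : q = q') {i j : ι} (hi : Quotient.mk t i = q)
        (hj : Quotient.mk t j = q),
        s q ⟨i, hi⟩ ⟨j, hj⟩ ↔ s q' ⟨i, hi.trans h⟩ ⟨j, hj.trans h⟩ := by
      rintro q _ rfl i j hi hj
      rfl
    refine ⟨⟨⟨fun i j => ∃ (q : Quotient t) (hi : Quotient.mk t i = q) (hj : Quotient.mk t j = q),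
      s q ⟨i, hi⟩ ⟨j, hj⟩, ⟨fun i => ⟨_, rfl, rfl, (s _).refl _⟩, ?_, ?_⟩⟩, ?_⟩, ?_⟩
    · rintro i j ⟨q, hi, hj, h⟩
      exact ⟨q, hj, hi, (s q).symm h⟩
    · rintro i j k ⟨q, hi, hj, h⟩ ⟨q', hj', hk, h'⟩
      obtain rfl : q = q' := hj.symm.trans hj'
      exact ⟨q, hi, hk, (s q).trans h h'⟩
    · rintro i j ⟨q, hi, hj, h⟩
      exact Quotient.exact (hi.trans hj.symm)
    · funext q
      ext ⟨i, hi⟩ ⟨j, hj⟩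
      constructor
      · rintro ⟨q', hi', hj', h⟩
        exact (conv (hi'.symm.trans hi) _ _).1 h
      · intro h
        exact ⟨q, hi, hj, h⟩

/-- Equivalence relations coarser than `r` are equivalence relations on its blocks. -/
lemma coarse_bijective {ι : Type*} (r : Setoid ι) :
    Function.Bijective (fun (s : Setoid (Quotient r)) =>
      (⟨s.comap (Quotient.mk r), fun i j h => by
        change s (Quotient.mk r i) (Quotient.mk r j)
        rw [Quotient.sound h]⟩ : {t : Setoid ι // r ≤ t})) := by
  constructor
  · intro s s' h
    ext p q
    induction p using Quotient.inductionOn with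
    | h i =>
      induction q using Quotient.inductionOn with
      | h j => exact Setoid.ext_iff.1 (congrArg Subtype.val h) i j
  · rintro ⟨t, ht⟩
    have key : ∀ i j k l : ι, r i k → r j l → t i j = t k l := fun i j k l h h' =>
      propext ⟨fun hij => t.trans (t.symm (ht h)) (t.trans hij (ht h')),
        fun hkl => t.trans (ht h) (t.trans hkl (t.symm (ht h')))⟩
    refine ⟨⟨fun p q => Quotient.liftOn₂ p q (fun i j => t i j) key, ⟨?_, ?_, ?_⟩⟩, ?_⟩
    · intro p
      induction p using Quotient.inductionOn with
      | h i => exact t.refl i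
    · intro p q
      induction p using Quotient.inductionOn with
      | h i =>
        induction q using Quotient.inductionOn with
        | h j => exact t.symm
    · intro p q l
      induction p using Quotient.inductionOn with
      | h i =>
        induction q using Quotient.inductionOn with
        | h j =>
          induction l using Quotient.inductionOn with
          | h k => exact t.trans
    · rfl

lemma term_term (f : FaaHom A B) {B' : Faa C} (g : FaaHom B B') (h : FaaHom B' D') {ι : Type*}
    [Finite ι] [Nonempty ι] {Z : C} (a : ι → (Z ⟶ A.V.X)) (x : Z ⟶ A.P) (r : Setoid ι)
    (s : Setoid (Quotient r)) :
    g.term h (fun q : Quotient r => f.eval (fun i : Block r q => a i) x) (x ≫ f.pt) s =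
      h.eval (fun q : Quotient (s.comap (Quotient.mk r)) =>
        f.term g (fun i : Block _ q => a i) x (r.comap Subtype.val)) (x ≫ f.pt ≫ g.pt) := by
  set t : Setoid ι := s.comap (Quotient.mk r) with ht
  have hφ : Function.Bijective (Quotient.map' (s₁ := t) (s₂ := s) (Quotient.mk r) fun _ _ h => h) := by
    constructor
    · intro p q
      induction p using Quotient.inductionOn with
      | h i =>
        induction q using Quotient.inductionOn with
        | h j =>
          intro h
          exact Quotient.sound (s := t) (Quotient.exact h :)
    · intro p
      induction p using Quotient.inductionOn with
      | h p =>
        induction p using Quotient.inductionOn with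
        | h i => exact ⟨Quotient.mk t i, rfl⟩
  unfold term
  rw [← h.eval_equiv _ _ (Equiv.ofBijective _ hφ), Category.assoc]
  congr 1
  funext q
  induction q using Quotient.inductionOn with
  | h k =>
    have hψ : Function.Bijective (Quotient.lift
        (s := Setoid.comap (Subtype.val : Block t (Quotient.mk t k) → ι) r)
        (fun i => (⟨Quotient.mk r i.1, Quotient.sound (s := s) (Quotient.exact (s := t) i.2)⟩ :
          Block s (Quotient.mk s (Quotient.mk r k))))
        (fun i j h => Subtype.ext (Quotient.sound (s := r) h))) := by
      constructor
      · intro p q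
        induction p using Quotient.inductionOn with
        | h i =>
          induction q using Quotient.inductionOn with
          | h j =>
            intro h
            exact Quotient.sound (Quotient.exact (s := r) (congrArg Subtype.val h) :)
      · rintro ⟨p, hp⟩
        induction p using Quotient.inductionOn with
        | h i =>
          exact ⟨Quotient.mk _ ⟨i, Quotient.sound (s := t) (Quotient.exact (s := s) hp)⟩, rfl⟩
    refine (g.eval_equiv (ι := Block s (Quotient.mk s (Quotient.mk r k))) _ _
      (Equiv.ofBijective _ hψ)).symm.trans ?_
    congr 1
    funext p
    induction p using Quotient.inductionOn with
    | h i =>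
      exact (f.eval_equiv (ι := Block r (Quotient.mk r i.1))
        (κ := Block (Setoid.comap (Subtype.val : Block t (Quotient.mk t k) → ι) r)
          (Quotient.mk _ i)) (fun j => a j) x
        { toFun := fun j => ⟨j.1.1, Quotient.sound (s := r) (Quotient.exact j.2 :)⟩
          invFun := fun j => ⟨⟨j.1, by
            have h1 : r j.1 i.1 := Quotient.exact (s := r) j.2
            have h2 : t j.1 i.1 := by
              change s (Quotient.mk r j.1) (Quotient.mk r i.1)
              rw [Quotient.sound h1]
            exact (Quotient.sound h2).trans i.2⟩,
            Quotient.sound (Quotient.exact (s := r) j.2 :)⟩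
          left_inv := fun _ => rfl
          right_inv := fun _ => rfl }).symm

lemma comp_assoc (f : FaaHom A B) {B' : Faa C} (g : FaaHom B B') (h : FaaHom B' D') :
    (f.comp g).comp h = f.comp (g.comp h) := by
  classical
  refine ext_eval (Category.assoc _ _ _) fun n Z a x => ?_
  let T : Setoid (Fin n) → Setoid (Fin n) → (Z ⟶ D'.V.X) := fun t r =>
    h.eval (fun q : Quotient t =>
      f.term g (fun i : Block _ q => a i) x (r.comap Subtype.val)) (x ≫ f.pt ≫ g.pt)
  have hl : ((f.comp g).comp h).eval a x =
      ∑ t : Setoid (Fin n), ∑ r : {r : Setoid (Fin n) // r ≤ t}, T t r := by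
    rw [eval_comp]
    refine Finset.sum_congr rfl fun t _ => ?_
    rw [(refine_bijective t).sum_comp fun s : ∀ q : Quotient t, Setoid (Block t q) =>
      h.eval (fun q => f.term g (fun i : Block t q => a i) x (s q)) (x ≫ f.pt ≫ g.pt)]
    unfold term
    simp only [eval_comp, comp_pt]
    exact h.eval_sum _ _
  have hr : (f.comp (g.comp h)).eval a x =
      ∑ r : Setoid (Fin n), ∑ t : {t : Setoid (Fin n) // r ≤ t}, T t r := by
    rw [eval_comp]
    refine Finset.sum_congr rfl fun r _ => ?_
    rw [← (coarse_bijective r).sum_comp]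
    unfold term
    rw [eval_comp]
    exact Finset.sum_congr rfl fun s _ => term_term f g h a x r s
  rw [hl, hr]
  simp only [← Fintype.sum_sigma']
  exact Fintype.sum_equiv
    { toFun := fun p => ⟨p.2.1, p.1, p.2.2⟩
      invFun := fun p => ⟨p.2.1, p.1, p.2.2⟩
      left_inv := fun _ => rfl
      right_inv := fun _ => rfl } _ _ fun _ => rfl


/-! #### Linear morphisms, identities -/

/-- The morphism `(p, π₀ u, 0, 0, …)` given by a map `p` and a homomorphism `u` of monoids. -/
def lin (p : A.P ⟶ B.P) (u : A.V.X ⟶ B.V.X) [IsAddMonHom u] : FaaHom A B where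
  pt := p
  app n := if (n : ℕ) = 1 then proj A.V.X A.P ⟨0, n.pos⟩ ≫ u else 0
  map_add n Z a x i s t := by
    split_ifs with h
    · obtain rfl : i = ⟨0, n.pos⟩ := Fin.ext (by have := i.2; simp only; omega)
      simp [add_comp]
    · simp [comp_zero]
  map_zero n Z a x i := by
    split_ifs with h
    · obtain rfl : i = ⟨0, n.pos⟩ := Fin.ext (by have := i.2; simp only; omega)
      simp [zero_comp]
    · simp [comp_zero]
  map_perm n Z a x e := by
    split_ifs with h
    · have he : e ⟨0, n.pos⟩ = ⟨0, n.pos⟩ := Fin.ext (by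
        have := (e ⟨0, n.pos⟩).2; simp only; omega)
      rw [tuple_proj_assoc, tuple_proj_assoc, Function.comp_apply, he]
    · simp [comp_zero]

section

variable (p : A.P ⟶ B.P) (u : A.V.X ⟶ B.V.X) [IsAddMonHom u]
  {ι : Type*} [Finite ι] [Nonempty ι] {Z : C} (a : ι → (Z ⟶ A.V.X)) (x : Z ⟶ A.P)

lemma lin_eval_subsingleton [Subsingleton ι] (i : ι) : (lin p u).eval a x = a i ≫ u := by
  have h : ((card ι : ℕ+) : ℕ) = 1 := Nat.card_of_subsingleton i
  unfold eval lin
  simp only [h, if_true]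
  rw [tuple_proj_assoc]
  exact congrArg (fun j => a j ≫ u) (Subsingleton.elim _ _)

lemma lin_eval_nontrivial [Nontrivial ι] : (lin p u).eval a x = 0 := by
  have h : ¬ ((card ι : ℕ+) : ℕ) = 1 := (Finite.one_lt_card (α := ι)).ne'
  unfold eval lin
  simp only [h, if_false]
  exact comp_zero _

end

lemma comp_lin_eval (f : FaaHom A B) (p : B.P ⟶ D'.P) (u : B.V.X ⟶ D'.V.X) [IsAddMonHom u]
    {ι : Type*} [Finite ι] [Nonempty ι] {Z : C} (a : ι → (Z ⟶ A.V.X)) (x : Z ⟶ A.P) :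
    (f.comp (lin p u)).eval a x = f.eval a x ≫ u := by
  rw [eval_comp]
  unfold compVal
  rw [Fintype.sum_eq_single (⊤ : Setoid ι)]
  · unfold term
    have : Subsingleton (Quotient (⊤ : Setoid ι)) := Quotient.subsingleton_iff.2 rfl
    rw [lin_eval_subsingleton _ _ _ _ (Quotient.mk _ (Classical.arbitrary ι))]
    congr 1
    exact (f.eval_equiv _ x (Equiv.subtypeUnivEquiv fun i => Subsingleton.elim _ _).symm).symm
  · intro r hr
    have : Nontrivial (Quotient r) :=
      not_subsingleton_iff_nontrivial.1 fun h => hr (Quotient.subsingleton_iff.1 h)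
    exact lin_eval_nontrivial _ _ _ _

lemma lin_comp_eval (p : A.P ⟶ B.P) (u : A.V.X ⟶ B.V.X) [IsAddMonHom u] (g : FaaHom B D')
    {ι : Type*} [Finite ι] [Nonempty ι] {Z : C} (a : ι → (Z ⟶ A.V.X)) (x : Z ⟶ A.P) :
    ((lin p u).comp g).eval a x = g.eval (fun i => a i ≫ u) (x ≫ p) := by
  rw [eval_comp]
  unfold compVal
  rw [Fintype.sum_eq_single (⊥ : Setoid ι)]
  · unfold term
    have hb : Function.Bijective (Quotient.mk (⊥ : Setoid ι)) :=
      ⟨fun i j h => Quotient.exact (s := ⊥) h, Quotient.mk_surjective⟩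
    rw [← g.eval_equiv _ _ (Equiv.ofBijective _ hb)]
    congr 1
    funext i
    have : Subsingleton (Block (⊥ : Setoid ι) (Quotient.mk _ i)) :=
      ⟨fun j k => Subtype.ext (hb.1 (j.2.trans k.2.symm))⟩
    exact lin_eval_subsingleton p u _ x (⟨i, rfl⟩ : Block (⊥ : Setoid ι) (Quotient.mk _ i))
  · classical
    intro r hr
    have : ∃ i j, r i j ∧ i ≠ j := by
      by_contra! h
      exact hr (le_bot_iff.1 fun i j hij => h i j hij)
    obtain ⟨i, j, hij, hne⟩ := this
    refine g.eval_zero' _ _ (Quotient.mk r j) ?_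
    have : Nontrivial (Block r (Quotient.mk r j)) :=
      ⟨⟨⟨i, Quotient.sound hij⟩, ⟨j, rfl⟩, fun h => hne (congrArg Subtype.val h)⟩⟩
    exact lin_eval_nontrivial p u _ x

end FaaHom

open FaaHom

noncomputable instance : Category.{v} (Faa C) where
  Hom A B := FaaHom A B
  id A := lin (𝟙 A.P) (𝟙 A.V.X)
  comp f g := f.comp g
  id_comp f := ext_eval (Category.id_comp _) fun n Z a x => by
    rw [lin_comp_eval]; simp
  comp_id f := ext_eval (Category.comp_id _) fun n Z a x => by
    rw [comp_lin_eval, Category.comp_id]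
  assoc f g h := comp_assoc f g h

lemma faa_comp {A B D : Faa C} (f : A ⟶ B) (g : B ⟶ D) : f ≫ g = FaaHom.comp f g := rfl

lemma faa_id (A : Faa C) : 𝟙 A = (lin (𝟙 A.P) (𝟙 A.V.X) : FaaHom A A) := rfl

@[ext]
lemma faa_ext {A B : Faa C} {f g : A ⟶ B} (hp : f.pt = g.pt) (ha : ∀ n, f.app n = g.app n) :
    f = g := FaaHom.ext hp (funext ha)

/-! #### Products in `Faa C` -/

namespace Faa

/-- The product of two objects of `Faa C`. -/
abbrev prod (A B : Faa C) : Faa C := ⟨A.V.prod B.V, A.P ⊗ B.P⟩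

variable (C) in
/-- The terminal object of `Faa C`. -/
abbrev triv : Faa C := ⟨CMon.triv C, 𝟙_ C⟩

/-- The first projection `(π₀, π₀ π₀, 0, 0, …)`. -/
def fst' (A B : Faa C) : A.prod B ⟶ A :=
  lin (A := A.prod B) (B := A) (fst A.P B.P) (fst A.V.X B.V.X)

/-- The second projection `(π₁, π₀ π₁, 0, 0, …)`. -/
def snd' (A B : Faa C) : A.prod B ⟶ B :=
  lin (A := A.prod B) (B := B) (snd A.P B.P) (snd A.V.X B.V.X)

/-- The pairing of two morphisms. -/
def lift' {Z A B : Faa C} (f : Z ⟶ A) (g : Z ⟶ B) : Z ⟶ A.prod B where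
  pt := lift f.pt g.pt
  app n := lift (f.app n) (g.app n)
  map_add n W a x i s t := by
    have := lift_add (A := A.V.X) (B := B.V.X)
      (tuple (Function.update a i s) x ≫ f.app n) (tuple (Function.update a i t) x ≫ f.app n)
      (tuple (Function.update a i s) x ≫ g.app n) (tuple (Function.update a i t) x ≫ g.app n)
    rw [← f.map_add, ← g.map_add] at this
    simpa only [comp_lift] using this
  map_zero n W a x i := by
    rw [comp_lift, f.map_zero, g.map_zero]
    exact lift_zero
  map_perm n W a x e := by
    rw [comp_lift, comp_lift, f.map_perm, g.map_perm]

/-- The morphism to the terminal object. -/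
def toTriv (A : Faa C) : A ⟶ triv C where
  pt := toUnit A.P
  app n := toUnit _
  map_add _ _ _ _ _ _ _ := toUnit_unique _ _
  map_zero _ _ _ _ _ := toUnit_unique _ _
  map_perm _ _ _ _ _ := toUnit_unique _ _

lemma comp_lin_app {A B D : Faa C} (f : FaaHom A B) (p : B.P ⟶ D.P) (u : B.V.X ⟶ D.V.X)
    [IsAddMonHom u] (n : ℕ+) : (f.comp (lin p u)).app n = f.app n ≫ u := by
  have := comp_lin_eval f p u (fun i : Fin n => proj A.V.X A.P i) (base A.V.X A.P n)
  rwa [eval_fin, eval_fin, tuple_proj_base, Category.id_comp, Category.id_comp] at this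

lemma lift_fst' {Z A B : Faa C} (f : Z ⟶ A) (g : Z ⟶ B) : lift' f g ≫ fst' A B = f := by
  refine faa_ext ?_ fun n => ?_
  · exact lift_fst _ _
  · exact (comp_lin_app (lift' f g) (fst A.P B.P) (fst A.V.X B.V.X) n).trans (lift_fst _ _)

lemma lift_snd' {Z A B : Faa C} (f : Z ⟶ A) (g : Z ⟶ B) : lift' f g ≫ snd' A B = g := by
  refine faa_ext ?_ fun n => ?_
  · exact lift_snd _ _
  · exact (comp_lin_app (lift' f g) (snd A.P B.P) (snd A.V.X B.V.X) n).trans (lift_snd _ _)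

lemma hom_ext' {Z A B : Faa C} {f g : Z ⟶ A.prod B} (h₁ : f ≫ fst' A B = g ≫ fst' A B)
    (h₂ : f ≫ snd' A B = g ≫ snd' A B) : f = g := by
  refine faa_ext ?_ fun n => ?_
  · exact hom_ext f.pt g.pt (congrArg (fun k : FaaHom Z A => k.pt) h₁)
      (congrArg (fun k : FaaHom Z B => k.pt) h₂)
  · refine hom_ext (f.app n) (g.app n) ?_ ?_
    · have := congrArg (fun k : FaaHom Z A => k.app n) h₁
      simp only [faa_comp] at this
      exact (comp_lin_app f (fst A.P B.P) (fst A.V.X B.V.X) n).symm.trans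
        (this.trans (comp_lin_app g (fst A.P B.P) (fst A.V.X B.V.X) n))
    · have := congrArg (fun k : FaaHom Z B => k.app n) h₂
      simp only [faa_comp] at this
      exact (comp_lin_app f (snd A.P B.P) (snd A.V.X B.V.X) n).symm.trans
        (this.trans (comp_lin_app g (snd A.P B.P) (snd A.V.X B.V.X) n))

end Faa

open Limits in
noncomputable instance : CartesianMonoidalCategory (Faa C) :=
  .ofChosenFiniteProducts
    { cone := asEmptyCone (Faa.triv C)
      isLimit := IsTerminal.ofUniqueHom Faa.toTriv fun A f => by
        refine faa_ext ?_ fun n => ?_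
        · exact toUnit_unique _ _
        · exact toUnit_unique _ _ }
    fun A B =>
    { cone := BinaryFan.mk (Faa.fst' A B) (Faa.snd' A B)
      isLimit := BinaryFan.IsLimit.mk _ (fun f g => Faa.lift' f g) (fun f g => Faa.lift_fst' f g)
        (fun f g => Faa.lift_snd' f g) fun f g m h₁ h₂ =>
          Faa.hom_ext' (h₁.trans (Faa.lift_fst' f g).symm) (h₂.trans (Faa.lift_snd' f g).symm) }


/-! ### The category of cartesian categories -/

/-- A functor preserving the chosen finite products exactly. -/
structure StrictFunctor (C : Type u) [Category.{v} C] [CartesianMonoidalCategory C]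
    (D : Type u) [Category.{v} D] [CartesianMonoidalCategory D] extends C ⥤ D where
  obj_unit : obj (𝟙_ C) = 𝟙_ D
  obj_prod (X Y : C) : obj (X ⊗ Y) = obj X ⊗ obj Y
  map_fst (X Y : C) : map (fst X Y) = eqToHom (obj_prod X Y) ≫ fst (obj X) (obj Y)
  map_snd (X Y : C) : map (snd X Y) = eqToHom (obj_prod X Y) ≫ snd (obj X) (obj Y)

namespace StrictFunctor

variable {D : Type u} [Category.{v} D] [CartesianMonoidalCategory D]
  {E : Type u} [Category.{v} E] [CartesianMonoidalCategory E]

lemma ext' {F G : StrictFunctor C D} (h : F.toFunctor = G.toFunctor) : F = G := by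
  cases F; cases G; cases h; rfl

/-- The identity functor. -/
def id (C : Type u) [Category.{v} C] [CartesianMonoidalCategory C] : StrictFunctor C C where
  toFunctor := 𝟭 C
  obj_unit := rfl
  obj_prod _ _ := rfl
  map_fst _ _ := (Category.id_comp _).symm
  map_snd _ _ := (Category.id_comp _).symm

/-- The composite of two functors. -/
def comp (F : StrictFunctor C D) (G : StrictFunctor D E) : StrictFunctor C E where
  toFunctor := F.toFunctor ⋙ G.toFunctor
  obj_unit := (congrArg G.obj F.obj_unit).trans G.obj_unit
  obj_prod X Y := (congrArg G.obj (F.obj_prod X Y)).trans (G.obj_prod _ _)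
  map_fst X Y := by
    simp [F.map_fst, G.map_fst, eqToHom_map]
  map_snd X Y := by
    simp [F.map_snd, G.map_snd, eqToHom_map]

end StrictFunctor

/-- A cartesian category: a category with chosen finite products. -/
structure CartCat : Type (max u v + 1) where
  carrier : Type (max u v)
  [cat : Category.{v} carrier]
  [cart : CartesianMonoidalCategory carrier]

attribute [instance] CartCat.cat CartCat.cart

/-- Cartesian categories and functors preserving the chosen finite products exactly. -/
instance : Category.{max u v} CartCat.{v, u} where
  Hom C D := StrictFunctor C.carrier D.carrier
  id C := StrictFunctor.id C.carrier
  comp F G := F.comp G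

namespace StrictFunctor

variable {D : Type u} [Category.{v} D] [CartesianMonoidalCategory D]
  {E : Type u} [Category.{v} E] [CartesianMonoidalCategory E] (F : StrictFunctor C D)

lemma map_lift {Z X Y : C} (f : Z ⟶ X) (g : Z ⟶ Y) :
    F.map (lift f g) ≫ eqToHom (F.obj_prod X Y) = lift (F.map f) (F.map g) := by
  ext
  · rw [Category.assoc, ← F.map_fst, ← F.map_comp, lift_fst, lift_fst]
  · rw [Category.assoc, ← F.map_snd, ← F.map_comp, lift_snd, lift_snd]


lemma elem {Z : D} {X Y W : C} (f : Z ⟶ F.obj X) (g : X ⟶ Y) (h : X ⟶ W) :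
    lift (f ≫ F.map g) (f ≫ F.map h) ≫ eqToHom (F.obj_prod Y W).symm = f ≫ F.map (lift g h) := by
  rw [← comp_lift, ← F.map_lift]
  simp

lemma elem_map {Z : D} {X Y W V : C} (f : Z ⟶ F.obj X) (g : X ⟶ Y) (h : X ⟶ W)
    (k : Y ⊗ W ⟶ V) :
    lift (f ≫ F.map g) (f ≫ F.map h) ≫ eqToHom (F.obj_prod Y W).symm ≫ F.map k =
      f ≫ F.map (lift g h ≫ k) := by
  rw [F.map_comp, ← Category.assoc, F.elem, Category.assoc]

lemma whisker_right_eq {X Y : D} (k : X ⟶ Y) (W : D) : k ▷ W = lift (fst X W ≫ k) (snd X W) := by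
  ext <;> simp

lemma whisker_left_eq {X Y : D} (k : X ⟶ Y) (W : D) : W ◁ k = lift (fst W X) (snd W X ≫ k) := by
  ext <;> simp

lemma assoc_snd (X Y W : D) : (α_ X Y W).hom ≫ snd _ _ =
    lift (fst (X ⊗ Y) W ≫ snd X Y) (snd (X ⊗ Y) W) := by
  apply CartesianMonoidalCategory.hom_ext <;> simp

lemma whisker_unit_left {X : D} (z : 𝟙_ D ⟶ X) (Y : D) :
    z ▷ Y = lift (toUnit _ ≫ z) (snd (𝟙_ D) Y) := by
  rw [← toUnit_unique (fst (𝟙_ D) Y) (toUnit _)]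
  ext <;> simp

lemma whisker_unit_right {X : D} (z : 𝟙_ D ⟶ X) (Y : D) :
    Y ◁ z = lift (fst Y (𝟙_ D)) (toUnit _ ≫ z) := by
  rw [← toUnit_unique (snd Y (𝟙_ D)) (toUnit _)]
  ext <;> simp

/-- The monoid structure on the image of a commutative monoid. -/
instance mapAddMon (A : CMon C) : AddMonObj (F.obj A.X) :=
    { zero := eqToHom F.obj_unit.symm ≫ F.map A.zero
      add := eqToHom (F.obj_prod _ _).symm ≫ F.map A.add
      zero_add := by
        have h := F.elem_map (𝟙 (F.obj A.X)) (toUnit A.X ≫ A.zero) (𝟙 A.X) A.add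
        have h1 : lift (toUnit A.X ≫ A.zero) (𝟙 A.X) ≫ A.add = 𝟙 A.X :=
          AddMonObj.lift_comp_zero_left _ _
        have h2 : F.map (toUnit A.X ≫ A.zero) =
            toUnit _ ≫ eqToHom F.obj_unit.symm ≫ F.map A.zero := by
          rw [F.map_comp, ← Category.assoc]
          congr 1
          rw [← cancel_mono (eqToHom F.obj_unit)]
          exact toUnit_unique _ _
        rw [h1, F.map_id, Category.id_comp, Category.id_comp, h2] at h
        have h3 := congrArg (fun k => snd (𝟙_ D) (F.obj A.X) ≫ k) h
        simp only [← Category.assoc, comp_lift, Category.comp_id, comp_toUnit] at h3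
        rw [leftUnitor_hom, ← h3, whisker_unit_left]
        simp only [Category.assoc]
      add_zero := by
        have h := F.elem_map (𝟙 (F.obj A.X)) (𝟙 A.X) (toUnit A.X ≫ A.zero) A.add
        have h1 : lift (𝟙 A.X) (toUnit A.X ≫ A.zero) ≫ A.add = 𝟙 A.X :=
          AddMonObj.lift_comp_zero_right _ _
        have h2 : F.map (toUnit A.X ≫ A.zero) =
            toUnit _ ≫ eqToHom F.obj_unit.symm ≫ F.map A.zero := by
          rw [F.map_comp, ← Category.assoc]
          congr 1
          rw [← cancel_mono (eqToHom F.obj_unit)]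
          exact toUnit_unique _ _
        rw [h1, F.map_id, Category.id_comp, Category.id_comp, h2] at h
        have h3 := congrArg (fun k => fst (F.obj A.X) (𝟙_ D) ≫ k) h
        simp only [← Category.assoc, comp_lift, Category.comp_id, comp_toUnit] at h3
        rw [rightUnitor_hom, ← h3, whisker_unit_right]
        simp only [Category.assoc]
      add_assoc := by
        have hf : ∀ (Z : D) (a b c : Z ⟶ F.obj A.X), ∃ (f : Z ⟶ F.obj ((A.X ⊗ A.X) ⊗ A.X)),
            f ≫ F.map (fst _ _ ≫ fst _ _) = a ∧ f ≫ F.map (fst _ _ ≫ snd _ _) = b ∧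
              f ≫ F.map (snd _ _) = c := by
          intro Z a b c
          refine ⟨lift (lift a b ≫ eqToHom (F.obj_prod _ _).symm) c ≫
            eqToHom (F.obj_prod _ _).symm, ?_, ?_, ?_⟩
          · simp [F.map_fst]
          · simp [F.map_fst, F.map_snd]
          · simp [F.map_snd]
        obtain ⟨f, h1, h2, h3⟩ := hf ((F.obj A.X ⊗ F.obj A.X) ⊗ F.obj A.X) (fst _ _ ≫ fst _ _)
          (fst _ _ ≫ snd _ _) (snd _ _)
        have e1 := F.elem_map f (fst _ _ ≫ fst _ _) (fst _ _ ≫ snd _ _) A.add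
        have e2 := F.elem_map f (fst _ _ ≫ snd _ _) (snd _ _) A.add
        have e3 := F.elem_map f (lift (fst _ _ ≫ fst _ _) (fst _ _ ≫ snd _ _) ≫ A.add)
          (snd _ _) A.add
        have e4 := F.elem_map f (fst _ _ ≫ fst _ _) (lift (fst _ _ ≫ snd _ _) (snd _ _) ≫ A.add)
          A.add
        rw [h1, h2] at e1
        rw [h2, h3] at e2
        rw [← e1, h3] at e3
        rw [h1, ← e2] at e4
        rw [AddMonObj.lift_lift_assoc, ← e4] at e3
        have w3 : ∀ X Y W : D, lift (fst (X ⊗ Y) W ≫ fst X Y) (fst (X ⊗ Y) W ≫ snd X Y) =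
            fst (X ⊗ Y) W := by
          intro X Y W
          rw [← comp_lift, lift_fst_snd, Category.comp_id]
        rw [w3] at e3
        rw [whisker_right_eq, whisker_left_eq, ← Category.assoc (α_ _ _ _).hom, comp_lift,
          associator_hom_fst, ← Category.assoc _ (snd _ _), assoc_snd]
        exact e3 }

instance mapCommAddMon (A : CMon C) : IsCommAddMonObj (F.obj A.X) where
  add_comm := by
    have hf : ∃ (f : F.obj A.X ⊗ F.obj A.X ⟶ F.obj (A.X ⊗ A.X)),
          f ≫ F.map (fst _ _) = fst _ _ ∧ f ≫ F.map (snd _ _) = snd _ _ :=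
      ⟨eqToHom (F.obj_prod _ _).symm, by simp [F.map_fst], by simp [F.map_snd]⟩
    obtain ⟨f, h1, h2⟩ := hf
    have e1 := F.elem_map f (fst _ _) (snd _ _) A.add
    have e2 := F.elem_map f (snd _ _) (fst _ _) A.add
    have e3 : lift (snd A.X A.X) (fst A.X A.X) ≫ A.add =
        lift (fst A.X A.X) (snd A.X A.X) ≫ A.add := by
      rw [lift_fst_snd, Category.id_comp]
      exact IsCommAddMonObj.add_comm A.X
    rw [h1, h2] at e1
    rw [h1, h2, e3, ← e1, lift_fst_snd, Category.id_comp] at e2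
    exact e2

/-- The image of a commutative monoid. -/
abbrev mapCMon (A : CMon C) : CMon D where
  X := F.obj A.X

lemma mapCMon_add (A : CMon C) :
    (F.mapCMon A).add = eqToHom (F.obj_prod _ _).symm ≫ F.map A.add := rfl
lemma mapCMon_zero (A : CMon C) :
    (F.mapCMon A).zero = eqToHom F.obj_unit.symm ≫ F.map A.zero := rfl


lemma add_elem (A : CMon C) {Z : D} {Y : C} (r : Z ⟶ F.obj Y) (s t : Y ⟶ A.X) :
    r ≫ F.map (s + t) =
      ((r ≫ F.map s : Z ⟶ (F.mapCMon A).X) + (r ≫ F.map t : Z ⟶ (F.mapCMon A).X)) := by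
  rw [add_eq, add_eq]
  exact (F.elem_map r s t A.add).symm

lemma zero_elem (A : CMon C) {Z : D} {Y : C} (r : Z ⟶ F.obj Y) :
    r ≫ F.map (0 : Y ⟶ A.X) = (0 : Z ⟶ (F.mapCMon A).X) := by
  rw [zero_eq, zero_eq, F.map_comp, ← Category.assoc]
  change _ = toUnit Z ≫ eqToHom F.obj_unit.symm ≫ F.map A.zero
  rw [← Category.assoc]
  congr 1
  rw [← cancel_mono (eqToHom F.obj_unit)]
  exact toUnit_unique _ _

lemma obj_pow (A X : C) (n : ℕ) : F.obj (pow A X n) = pow (F.obj A) (F.obj X) n := by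
  induction n with
  | zero => rfl
  | succ n ih => exact (F.obj_prod _ _).trans (congrArg (fun Y => F.obj A ⊗ Y) ih)

lemma lift_eqToHom {Z X Y Y' : D} (f : Z ⟶ X) (g : Z ⟶ Y) (h : Y = Y') (h' : X ⊗ Y = X ⊗ Y') :
    lift f g ≫ eqToHom h' = lift f (g ≫ eqToHom h) := by
  subst h
  simp

lemma map_tuple {A X Y : C} {n : ℕ} (a : Fin n → (Y ⟶ A)) (x : Y ⟶ X) :
    F.map (tuple a x) ≫ eqToHom (F.obj_pow A X n) = tuple (fun i => F.map (a i)) (F.map x) := by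
  induction n with
  | zero => simp [tuple]
  | succ n ih =>
    have h := F.map_lift (a 0) (tuple (fun i => a i.succ) x)
    have h' := congrArg (fun k => k ≫ eqToHom (congrArg (fun Y => F.obj A ⊗ Y)
      (F.obj_pow A X n))) h
    simp only [Category.assoc, eqToHom_trans, lift_eqToHom _ _ (F.obj_pow A X n), ih] at h'
    exact h'

lemma tuple_elem {A X Y : C} {Z : D} {n : ℕ} (r : Z ⟶ F.obj Y) (a : Fin n → (Y ⟶ A))
    (x : Y ⟶ X) :
    tuple (fun i => r ≫ F.map (a i)) (r ≫ F.map x) ≫ eqToHom (F.obj_pow A X n).symm =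
      r ≫ F.map (tuple a x) := by
  rw [← comp_tuple, ← F.map_tuple]
  simp

lemma map_proj (A X : C) {n : ℕ} (i : Fin n) :
    F.map (proj A X i) = eqToHom (F.obj_pow A X n) ≫ proj (F.obj A) (F.obj X) i := by
  have h := congrArg (fun k => k ≫ proj (F.obj A) (F.obj X) i)
    (F.map_tuple (fun i : Fin n => proj A X i) (base A X n))
  simpa using h.symm

lemma map_base (A X : C) (n : ℕ) :
    F.map (base A X n) = eqToHom (F.obj_pow A X n) ≫ base (F.obj A) (F.obj X) n := by
  have h := congrArg (fun k => k ≫ base (F.obj A) (F.obj X) n)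
    (F.map_tuple (fun i : Fin n => proj A X i) (base A X n))
  simpa using h.symm

/-- Every tuple of generalized elements is the image of a tuple in `C`. -/
lemma exists_elem {A X : C} {Z : D} {n : ℕ} (a : Fin n → (Z ⟶ F.obj A)) (x : Z ⟶ F.obj X) :
    ∃ r : Z ⟶ F.obj (pow A X n), (∀ i, r ≫ F.map (proj A X i) = a i) ∧
      r ≫ F.map (base A X n) = x :=
  ⟨tuple a x ≫ eqToHom (F.obj_pow A X n).symm, fun i => by simp [map_proj], by simp [map_base]⟩

/-- The action of `Faa` on the objects of `Faa C`. -/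
abbrev faaObj (A : Faa C) : Faa D := ⟨F.mapCMon A.V, F.obj A.P⟩

/-- The action of `Faa` on the morphisms of `Faa C`: apply `F` to all components. -/
def faaMap {A B : Faa C} (f : FaaHom A B) : FaaHom (F.faaObj A) (F.faaObj B) where
  pt := F.map f.pt
  app n := eqToHom (F.obj_pow A.V.X A.P n).symm ≫ F.map (f.app n)
  map_add n Z a x i s t := by
    obtain ⟨r, hr, hx⟩ := F.exists_elem (Fin.cons s (Fin.cons t a) : Fin (n + 2) → _) x
    have hs : r ≫ F.map (proj A.V.X A.P (0 : Fin (n + 2))) = s := hr 0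
    have ht : r ≫ F.map (proj A.V.X A.P (1 : Fin (n + 2))) = t := hr 1
    have ha : ∀ j : Fin n, r ≫ F.map (proj A.V.X A.P j.succ.succ) = a j := fun j => hr j.succ.succ
    have key : ∀ (u : pow A.V.X A.P (n + 2) ⟶ A.V.X), 
        tuple (Function.update a i (r ≫ F.map u)) x ≫ eqToHom (F.obj_pow A.V.X A.P n).symm =
        r ≫ F.map (tuple (Function.update (fun j : Fin n => proj A.V.X A.P j.succ.succ) i u)
          (base A.V.X A.P (n + 2))) := by
      intro u
      rw [← F.tuple_elem, hx]
      congr 2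
      funext j
      by_cases hj : j = i
      · subst hj; simp
      · simp [Function.update_of_ne hj, ha]
    have hst := F.add_elem A.V r (proj A.V.X A.P (0 : Fin (n + 2))) (proj A.V.X A.P (1 : Fin (n + 2)))
    rw [hs, ht] at hst
    have k0 := key (proj A.V.X A.P (0 : Fin (n + 2)))
    have k1 := key (proj A.V.X A.P (1 : Fin (n + 2)))
    have k2 := key (proj A.V.X A.P (0 : Fin (n + 2)) + proj A.V.X A.P (1 : Fin (n + 2)))
    rw [hs] at k0
    rw [ht] at k1
    rw [hst] at k2
    rw [← Category.assoc, ← Category.assoc, ← Category.assoc]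
    rw [k0, k1, k2]
    rw [Category.assoc, Category.assoc, Category.assoc, ← F.map_comp, ← F.map_comp, ← F.map_comp,
      f.map_add]
    exact F.add_elem B.V r _ _
  map_zero n Z a x i := by
    obtain ⟨r, hr, hx⟩ := F.exists_elem a x
    have h0 := F.zero_elem A.V r
    have key : tuple (Function.update a i (r ≫ F.map (0 : _ ⟶ A.V.X))) x ≫
          eqToHom (F.obj_pow A.V.X A.P n).symm =
        r ≫ F.map (tuple (Function.update (fun j : Fin n => proj A.V.X A.P j) i 0)
          (base A.V.X A.P n)) := by
      rw [← F.tuple_elem, hx]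
      congr 2
      funext j
      by_cases hj : j = i
      · subst hj; simp
      · simp [Function.update_of_ne hj, hr]
    rw [h0] at key
    rw [← Category.assoc]
    rw [key]
    rw [Category.assoc, ← F.map_comp, f.map_zero]
    exact F.zero_elem B.V r
  map_perm n Z a x e := by
    obtain ⟨r, hr, hx⟩ := F.exists_elem a x
    have k1 := F.tuple_elem r (fun i : Fin n => proj A.V.X A.P i) (base A.V.X A.P n)
    have k2 := F.tuple_elem r (fun i : Fin n => proj A.V.X A.P (e i)) (base A.V.X A.P n)
    simp only [hr, hx] at k1 k2
    rw [← Category.assoc, ← Category.assoc]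
    change (tuple (fun i => a (e i)) x ≫ _) ≫ _ = _
    rw [k1, k2]
    rw [Category.assoc, Category.assoc, ← F.map_comp, ← F.map_comp]
    exact congrArg (fun k => r ≫ F.map k)
      (f.map_perm n (fun i : Fin n => proj A.V.X A.P i) (base A.V.X A.P n) e)

lemma faaMap_eval {A B : Faa C} (f : FaaHom A B) {ι : Type*} [Finite ι] [Nonempty ι] {Z : D} {Y : C}
    (r : Z ⟶ F.obj Y) (a : ι → (Y ⟶ A.V.X)) (x : Y ⟶ A.P) :
    (F.faaMap f).eval (fun i => r ≫ F.map (a i)) (r ≫ F.map x) = r ≫ F.map (f.eval a x) := by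
  unfold FaaHom.eval
  rw [F.map_comp, ← Category.assoc, ← F.tuple_elem, Category.assoc]
  rfl


lemma sum_elem (A : CMon C) {Z : D} {Y : C} (r : Z ⟶ F.obj Y) {ι : Type*} (s : Finset ι)
    (f : ι → (Y ⟶ A.X)) :
    r ≫ F.map (∑ i ∈ s, f i) = (∑ i ∈ s, (r ≫ F.map (f i) : Z ⟶ (F.mapCMon A).X)) := by
  classical
  induction s using Finset.induction_on with
  | empty => exact F.zero_elem A r
  | insert i s hi ih => rw [Finset.sum_insert hi, Finset.sum_insert hi, F.add_elem, ih]

lemma faaMap_comp {A B B' : Faa C} (f : FaaHom A B) (g : FaaHom B B') :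
    F.faaMap (f.comp g) = (F.faaMap f).comp (F.faaMap g) := by
  refine ext_eval (F.map_comp _ _) fun n Z a x => ?_
  obtain ⟨r, hr, hx⟩ := F.exists_elem a x
  obtain rfl := funext hr
  subst hx
  rw [F.faaMap_eval, eval_comp, eval_comp]
  unfold compVal
  rw [F.sum_elem]
  refine Finset.sum_congr rfl fun s _ => ?_
  unfold term
  rw [← F.faaMap_eval]
  congr 1
  · funext q
    exact (F.faaMap_eval f r _ _).symm
  · rw [F.map_comp, Category.assoc]
    rfl

instance {A B : CMon C} (u : A.X ⟶ B.X) [IsAddMonHom u] : IsAddMonHom (F.map u) where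
  zero_hom := by
    change (eqToHom F.obj_unit.symm ≫ F.map A.zero) ≫ F.map u = eqToHom F.obj_unit.symm ≫ F.map B.zero
    rw [Category.assoc, ← F.map_comp, IsAddMonHom.zero_hom]
  add_hom := by
    change (eqToHom (F.obj_prod _ _).symm ≫ F.map A.add) ≫ F.map u =
      (F.map u ⊗ₘ F.map u) ≫ eqToHom (F.obj_prod _ _).symm ≫ F.map B.add
    rw [Category.assoc, ← F.map_comp, IsAddMonHom.add_hom, F.map_comp, ← Category.assoc,
      ← Category.assoc]
    congr 1
    rw [← cancel_epi (eqToHom (F.obj_prod A.X A.X)), ← cancel_mono (eqToHom (F.obj_prod B.X B.X))]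
    have h : (u ⊗ₘ u) = lift (fst _ _ ≫ u) (snd _ _ ≫ u) := by simp
    have h' : (F.map u ⊗ₘ F.map u) = lift (fst _ _ ≫ F.map u) (snd _ _ ≫ F.map u) := by simp
    rw [h, h']
    simp only [Category.assoc, eqToHom_trans, eqToHom_trans_assoc, eqToHom_refl, Category.id_comp,
      Category.comp_id, comp_lift, F.map_lift, F.map_comp, F.map_fst, F.map_snd]

lemma faaMap_lin_app {A B : Faa C} (p : A.P ⟶ B.P) (u : A.V.X ⟶ B.V.X) [IsAddMonHom u] (n : ℕ+) :
    (F.faaMap (lin p u)).app n = if (n : ℕ) = 1 then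
      proj (F.obj A.V.X) (F.obj A.P) ⟨0, n.pos⟩ ≫ F.map u else (0 : _ ⟶ (F.mapCMon B.V).X) := by
  unfold faaMap lin
  split_ifs with h
  · simp only [h, if_true]
    rw [F.map_comp, F.map_proj]
    simp
  · simp only [h, if_false]
    exact F.zero_elem B.V _

lemma faaMap_id (A : Faa C) : F.faaMap (lin (𝟙 A.P) (𝟙 A.V.X)) =
    (lin (𝟙 (F.obj A.P)) (𝟙 (F.obj A.V.X)) : FaaHom (F.faaObj A) (F.faaObj A)) := by
  refine FaaHom.ext (F.map_id _) (funext fun n => ?_)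
  rw [faaMap_lin_app, F.map_id]
  rfl

lemma cmon_ext {A B : CMon D} (h : A.X = B.X) (h' : A.X ⊗ A.X = B.X ⊗ B.X)
    (ha : A.add ≫ eqToHom h = eqToHom h' ≫ B.add) : A = B := by
  obtain @⟨X, mX, cX⟩ := A
  obtain @⟨Y, mY, cY⟩ := B
  obtain rfl : X = Y := h
  simp only [eqToHom_refl, Category.comp_id, Category.id_comp] at ha
  obtain rfl : mX = mY := AddMonObj.ext _ _ ha
  rfl

lemma mapCMon_triv : F.mapCMon (CMon.triv C) = CMon.triv D :=
  cmon_ext F.obj_unit (congrArg (fun X => X ⊗ X) F.obj_unit) (toUnit_unique _ _)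

lemma prod_add (A B : CMon D) : (A.prod B).add =
    lift (lift (fst _ _ ≫ fst _ _) (snd _ _ ≫ fst _ _) ≫ A.add)
      (lift (fst _ _ ≫ snd _ _) (snd _ _ ≫ snd _ _) ≫ B.add) := by
  have h1 : (A.prod B).add ≫ fst A.X B.X = (fst A.X B.X ⊗ₘ fst A.X B.X) ≫ A.add :=
    IsAddMonHom.add_hom (fst A.X B.X)
  have h2 : (A.prod B).add ≫ snd A.X B.X = (snd A.X B.X ⊗ₘ snd A.X B.X) ≫ B.add :=
    IsAddMonHom.add_hom (snd A.X B.X)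
  refine CartesianMonoidalCategory.hom_ext _ _ ?_ ?_
  · rw [h1, lift_fst, ← lift_fst_comp_snd_comp]
  · rw [h2, lift_snd, ← lift_fst_comp_snd_comp]

lemma mapCMon_prod (A B : CMon C) :
    F.mapCMon (A.prod B) = (F.mapCMon A).prod (F.mapCMon B) := by
  refine cmon_ext (F.obj_prod _ _) (congrArg (fun X => X ⊗ X) (F.obj_prod A.X B.X)) ?_
  rw [mapCMon_add, prod_add, prod_add, Category.assoc]
  have e := F.map_lift (lift (fst (A.X ⊗ B.X) (A.X ⊗ B.X) ≫ fst _ _) (snd _ _ ≫ fst _ _) ≫ A.add)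
      (lift (fst (A.X ⊗ B.X) (A.X ⊗ B.X) ≫ snd _ _) (snd _ _ ≫ snd _ _) ≫ B.add)
  refine (congrArg (fun k => eqToHom (F.obj_prod _ _).symm ≫ k) e).trans ?_
  rw [comp_lift, comp_lift]
  have h1 : ∀ {X Y : C} {W : D} (h : F.obj (X ⊗ Y) = W) (hh : F.obj (X ⊗ Y) ⊗ F.obj (X ⊗ Y) = W ⊗ W)
      (k : W ⟶ F.obj X), F.map (fst X Y) = eqToHom h ≫ k →
      eqToHom (F.obj_prod (X ⊗ Y) (X ⊗ Y)).symm ≫ F.map (fst _ _ ≫ fst X Y) =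
      eqToHom hh ≫ fst _ _ ≫ k := by
    rintro X Y W rfl hh k hk
    rw [F.map_comp, hk, F.map_fst]
    simp
  have h2 : ∀ {X Y : C} {W : D} (h : F.obj (X ⊗ Y) = W) (hh : F.obj (X ⊗ Y) ⊗ F.obj (X ⊗ Y) = W ⊗ W)
      (k : W ⟶ F.obj X), F.map (fst X Y) = eqToHom h ≫ k →
      eqToHom (F.obj_prod (X ⊗ Y) (X ⊗ Y)).symm ≫ F.map (snd _ _ ≫ fst X Y) =
      eqToHom hh ≫ snd _ _ ≫ k := by
    rintro X Y W rfl hh k hk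
    rw [F.map_comp, hk, F.map_snd]
    simp
  have h3 : ∀ {X Y : C} {W : D} (h : F.obj (X ⊗ Y) = W) (hh : F.obj (X ⊗ Y) ⊗ F.obj (X ⊗ Y) = W ⊗ W)
      (k : W ⟶ F.obj Y), F.map (snd X Y) = eqToHom h ≫ k →
      eqToHom (F.obj_prod (X ⊗ Y) (X ⊗ Y)).symm ≫ F.map (fst _ _ ≫ snd X Y) =
      eqToHom hh ≫ fst _ _ ≫ k := by
    rintro X Y W rfl hh k hk
    rw [F.map_comp, hk, F.map_fst]
    simp
  have h4 : ∀ {X Y : C} {W : D} (h : F.obj (X ⊗ Y) = W) (hh : F.obj (X ⊗ Y) ⊗ F.obj (X ⊗ Y) = W ⊗ W)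
      (k : W ⟶ F.obj Y), F.map (snd X Y) = eqToHom h ≫ k →
      eqToHom (F.obj_prod (X ⊗ Y) (X ⊗ Y)).symm ≫ F.map (snd _ _ ≫ snd X Y) =
      eqToHom hh ≫ snd _ _ ≫ k := by
    rintro X Y W rfl hh k hk
    rw [F.map_comp, hk, F.map_snd]
    simp
  have hh := congrArg (fun X => X ⊗ X) (F.obj_prod A.X B.X)
  congr 1
  · rw [← F.elem_map, h1 (F.obj_prod _ _) hh _ (F.map_fst _ _),
      h2 (F.obj_prod _ _) hh _ (F.map_fst _ _), ← comp_lift, Category.assoc]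
    rfl
  · rw [← F.elem_map, h3 (F.obj_prod _ _) hh _ (F.map_snd _ _),
      h4 (F.obj_prod _ _) hh _ (F.map_snd _ _), ← comp_lift, Category.assoc]
    rfl

lemma faaHom_heq {A A' B B' : Faa D} (hA : A = A') (hB : B = B') (f : A ⟶ B) (g : A' ⟶ B')
    (hp : f.pt ≍ g.pt) (ha : ∀ n, f.app n ≍ g.app n) : f ≍ g := by
  subst hA hB
  exact heq_of_eq (faa_ext (eq_of_heq hp) fun n => eq_of_heq (ha n))

lemma lin_app_heq {W W' V V' : D} (hW : W = W') (hV : V = V') (M : CMon D) (k : W' ⟶ M.X)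
    (n : ℕ+) : (if (n : ℕ) = 1 then proj W V ⟨0, n.pos⟩ ≫ (eqToHom hW ≫ k) else 0) ≍
      (if (n : ℕ) = 1 then proj W' V' ⟨0, n.pos⟩ ≫ k else 0) := by
  subst hW hV
  simp

/-- The functor `Faa C ⥤ Faa D` induced by a functor `C ⥤ D` preserving products exactly. -/
noncomputable def faa : StrictFunctor (Faa C) (Faa D) where
  obj := F.faaObj
  map f := F.faaMap f
  map_id A := F.faaMap_id A
  map_comp f g := F.faaMap_comp f g
  obj_unit := congr (congrArg Faa.mk F.mapCMon_triv) F.obj_unit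
  obj_prod A B := congr (congrArg Faa.mk (F.mapCMon_prod A.V B.V)) (F.obj_prod A.P B.P)
  map_fst A B := by
    have hobj : F.faaObj (A ⊗ B) = F.faaObj A ⊗ F.faaObj B :=
      congr (congrArg Faa.mk (F.mapCMon_prod A.V B.V)) (F.obj_prod A.P B.P)
    refine eq_of_heq (HEq.trans ?_ (eqToHom_comp_heq _ _).symm)
    refine faaHom_heq hobj rfl _ _ ?_ fun n => ?_
    · exact (heq_of_eq (F.map_fst A.P B.P)).trans (eqToHom_comp_heq _ _)
    · refine (heq_of_eq (F.faaMap_lin_app (A := A.prod B) (B := A) _ _ n)).trans ?_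
      rw [F.map_fst]
      exact lin_app_heq (F.obj_prod _ _) (F.obj_prod _ _) (F.mapCMon A.V) _ n
  map_snd A B := by
    have hobj : F.faaObj (A ⊗ B) = F.faaObj A ⊗ F.faaObj B :=
      congr (congrArg Faa.mk (F.mapCMon_prod A.V B.V)) (F.obj_prod A.P B.P)
    refine eq_of_heq (HEq.trans ?_ (eqToHom_comp_heq _ _).symm)
    refine faaHom_heq hobj rfl _ _ ?_ fun n => ?_
    · exact (heq_of_eq (F.map_snd A.P B.P)).trans (eqToHom_comp_heq _ _)
    · refine (heq_of_eq (F.faaMap_lin_app (A := A.prod B) (B := B) _ _ n)).trans ?_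
      rw [F.map_snd]
      exact lin_app_heq (F.obj_prod _ _) (F.obj_prod _ _) (F.mapCMon B.V) _ n

end StrictFunctor


namespace StrictFunctor

lemma mapCMon_id (A : CMon C) : (StrictFunctor.id C).mapCMon A = A :=
  cmon_ext rfl rfl ((Category.comp_id _).trans (by rw [mapCMon_add]; rfl))

lemma mapCMon_comp {D : Type u} [Category.{v} D] [CartesianMonoidalCategory D]
    {E : Type u} [Category.{v} E] [CartesianMonoidalCategory E] (F : StrictFunctor C D)
    (G : StrictFunctor D E) (A : CMon C) : (F.comp G).mapCMon A = G.mapCMon (F.mapCMon A) := by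
  refine cmon_ext rfl rfl ?_
  change (eqToHom _ ≫ G.map (F.map A.add)) ≫ 𝟙 _ =
    𝟙 _ ≫ eqToHom _ ≫ G.map (eqToHom (F.obj_prod A.X A.X).symm ≫ F.map A.add)
  rw [G.map_comp, eqToHom_map, Category.comp_id, Category.id_comp]
  exact (congrArg (fun k => k ≫ G.map (F.map A.add)) (eqToHom_trans _ _).symm).trans
    (Category.assoc _ _ _)

lemma faa_id (C : Type u) [Category.{v} C] [CartesianMonoidalCategory C] :
    (StrictFunctor.id C).faa = StrictFunctor.id (Faa C) := by
  refine ext' ?_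
  have hobj : ∀ A : Faa C, (StrictFunctor.id C).faaObj A = A := fun A =>
    congrArg (fun V => Faa.mk V A.P) (mapCMon_id A.V)
  refine Functor.hext hobj fun A B f => ?_
  exact faaHom_heq (hobj A) (hobj B) _ _ HEq.rfl fun n => eqToHom_comp_heq _ _

lemma faa_comp {D : Type u} [Category.{v} D] [CartesianMonoidalCategory D]
    {E : Type u} [Category.{v} E] [CartesianMonoidalCategory E] (F : StrictFunctor C D)
    (G : StrictFunctor D E) : (F.comp G).faa = F.faa.comp G.faa := by
  refine ext' ?_
  have hobj : ∀ A : Faa C, (F.comp G).faaObj A = G.faaObj (F.faaObj A) := fun A =>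
    congrArg (fun V => Faa.mk V (G.obj (F.obj A.P))) (mapCMon_comp F G A.V)
  refine Functor.hext hobj fun A B f => ?_
  refine faaHom_heq (hobj A) (hobj B) _ _ HEq.rfl fun n => ?_
  refine (eqToHom_comp_heq _ _).trans (HEq.trans ?_ (eqToHom_comp_heq _ _).symm)
  change G.map (F.map (f.app n)) ≍ G.map (eqToHom (F.obj_pow A.V.X A.P n).symm ≫ F.map (f.app n))
  rw [G.map_comp, eqToHom_map]
  exact (eqToHom_comp_heq _ _).symm

end StrictFunctor

/-- The endofunctor `Faa` of the category of cartesian categories. -/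
noncomputable def faaFunctor : CartCat.{v, u} ⥤ CartCat.{v, u} where
  obj C := { carrier := Faa C.carrier }
  map F := StrictFunctor.faa F
  map_id C := StrictFunctor.faa_id C.carrier
  map_comp F G := StrictFunctor.faa_comp F G

/-- The counit `((A, +, 0), X) ↦ X`, `(f_*, f₁, f₂, …) ↦ f_*`. -/
noncomputable def faaCounit : faaFunctor.{v, u} ⟶ 𝟭 CartCat.{v, u} where
  app C :=
    { obj := fun A : Faa C.carrier => A.P
      map := fun f => f.pt
      map_id := fun _ => rfl
      map_comp := fun _ _ => rfl
      obj_unit := rfl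
      obj_prod := fun _ _ => rfl
      map_fst := fun _ _ => (Category.id_comp _).symm
      map_snd := fun _ _ => (Category.id_comp _).symm }
  naturality _ _ _ := rfl

/-! ### The comultiplication -/

section Lam

variable {A B D : Faa C}

lemma lin_congr {p p' : A.P ⟶ B.P} {u u' : A.V.X ⟶ B.V.X} [IsAddMonHom u] [IsAddMonHom u']
    (hp : p = p') (hu : u = u') : lin p u = lin p' u' := by
  subst hp hu
  rfl

lemma lin_comp_lin (p : A.P ⟶ B.P) (u : A.V.X ⟶ B.V.X) [IsAddMonHom u]
    (q : B.P ⟶ D.P) (w : B.V.X ⟶ D.V.X) [IsAddMonHom w] :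
    (lin p u).comp (lin q w) = lin (p ≫ q) (u ≫ w) := by
  refine faa_ext rfl fun n => ?_
  refine (Faa.comp_lin_app (lin p u) q w n).trans ?_
  unfold lin
  dsimp only
  split_ifs with h
  · rw [Category.assoc]
  · exact zero_comp w

lemma lift_lin (p : A.P ⟶ B.P) (u : A.V.X ⟶ B.V.X) [IsAddMonHom u]
    (q : A.P ⟶ D.P) (w : A.V.X ⟶ D.V.X) [IsAddMonHom w] :
    (lift (lin p u : A ⟶ B) (lin q w : A ⟶ D) : A ⟶ B ⊗ D) =
      (lin (A := A) (B := B.prod D) (lift p q) (lift u w) : A ⟶ B ⊗ D) := by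
  refine CartesianMonoidalCategory.hom_ext _ _ ?_ ?_
  · rw [lift_fst]
    refine Eq.trans ?_ (lin_comp_lin (B := B.prod D) _ _ (fst B.P D.P) (fst B.V.X D.V.X)).symm
    exact lin_congr (lift_fst _ _).symm (lift_fst _ _).symm
  · rw [lift_snd]
    refine Eq.trans ?_ (lin_comp_lin (B := B.prod D) _ _ (snd B.P D.P) (snd B.V.X D.V.X)).symm
    exact lin_congr (lift_snd _ _).symm (lift_snd _ _).symm

end Lam

/-- The object `((A, +, 0), A)` of `Faa C`. -/
abbrev diag (A : CMon C) : Faa C := ⟨A, A.X⟩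

/-- The zero `(0, π₀ 0, 0, …)` of `((A, +, 0), A)`. -/
def lamZero (A : CMon C) : 𝟙_ (Faa C) ⟶ diag A := lin (A := Faa.triv C) (B := diag A) A.zero A.zero

/-- The addition `(+, π₀ +, 0, …)` of `((A, +, 0), A)`. -/
def lamAdd (A : CMon C) : diag A ⊗ diag A ⟶ diag A :=
  lin (A := (diag A).prod (diag A)) (B := diag A) A.add A.add

/-- A homomorphism of monoids as a morphism of `Faa C`. -/
def linD {A B : CMon C} (u : A.X ⟶ B.X) [IsAddMonHom u] : diag A ⟶ diag B :=
  lin (A := diag A) (B := diag B) u u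

lemma lift_lamAdd {A : CMon C} {B : CMon C} (u w : B.X ⟶ A.X) [IsAddMonHom u] [IsAddMonHom w] :
    ∃ _ : IsAddMonHom (lift u w ≫ A.add), lift (linD u) (linD w) ≫ lamAdd A =
      linD (B := A) (A := B) (lift u w ≫ A.add) := by
  refine ⟨inferInstance, ?_⟩
  unfold linD lamAdd
  rw [lift_lin]
  exact lin_comp_lin (B := (diag A).prod (diag A)) _ _ _ _

lemma linD_congr {A B : CMon C} {u w : A.X ⟶ B.X} [IsAddMonHom u] [IsAddMonHom w] (h : u = w) :
    linD u = linD w := by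
  subst h
  rfl

lemma linD_comp {A B D : CMon C} (u : A.X ⟶ B.X) (w : B.X ⟶ D.X) [IsAddMonHom u]
    [IsAddMonHom w] : linD u ≫ linD w = linD (A := A) (B := D) (u ≫ w) :=
  lin_comp_lin (A := diag A) (B := diag B) (D := diag D) u u w w

lemma toUnit_lamZero (A B : CMon C) :
    toUnit (diag B) ≫ lamZero A = linD (A := B) (B := A) (toUnit B.X ≫ A.zero) := by
  have h : toUnit (diag B) =
      (lin (A := diag B) (B := Faa.triv C) (toUnit B.X) (toUnit B.X) : FaaHom _ _) :=
    toUnit_unique _ _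
  rw [h]
  exact lin_comp_lin (A := diag B) (B := Faa.triv C) (D := diag A) _ _ _ _

/-- The commutative monoid `(((A, +, 0), A), (+, π₀ +, 0, …), (0, π₀ 0, 0, …))` in `Faa C`. -/
@[reducible] def lam (A : CMon C) : CMon (Faa C) :=
  letI : AddMonObj (diag A) :=
    { zero := lamZero A
      add := lamAdd A
      zero_add := by
        rw [StrictFunctor.whisker_unit_left, leftUnitor_hom]
        have h2 : snd (𝟙_ (Faa C)) (diag A) =
          linD (A := (CMon.triv C).prod A) (B := A) (snd _ _) := rfl
        have h1 : toUnit (𝟙_ (Faa C) ⊗ diag A) ≫ lamZero A = _ :=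
          toUnit_lamZero A ((CMon.triv C).prod A)
        rw [h1, h2]
        obtain ⟨_, h⟩ := lift_lamAdd (A := A) (B := (CMon.triv C).prod A) (toUnit _ ≫ A.zero)
          (snd (𝟙_ C) A.X)
        exact h.trans (linD_congr (AddMonObj.lift_comp_zero_left _ _))
      add_zero := by
        rw [StrictFunctor.whisker_unit_right, rightUnitor_hom]
        have h2 : fst (diag A) (𝟙_ (Faa C)) =
          linD (A := A.prod (CMon.triv C)) (B := A) (fst _ _) := rfl
        have h1 : toUnit (diag A ⊗ 𝟙_ (Faa C)) ≫ lamZero A = _ :=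
          toUnit_lamZero A (A.prod (CMon.triv C))
        rw [h1, h2]
        obtain ⟨_, h⟩ := lift_lamAdd (A := A) (B := A.prod (CMon.triv C)) (fst A.X (𝟙_ C))
          (toUnit _ ≫ A.zero)
        exact h.trans (linD_congr (AddMonObj.lift_comp_zero_right _ _))
      add_assoc := by
        let B : CMon C := (A.prod A).prod A
        rw [StrictFunctor.whisker_right_eq, StrictFunctor.whisker_left_eq,
          ← Category.assoc (α_ _ _ _).hom, comp_lift,
          associator_hom_fst, ← Category.assoc _ (snd _ _), StrictFunctor.assoc_snd]
        have e1 : fst (diag A ⊗ diag A) (diag A) ≫ lamAdd A =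
            linD (A := B) (B := A) (fst (A.X ⊗ A.X) A.X ≫ A.add) :=
          linD_comp (A := B) (B := A.prod A) (D := A) (fst (A.X ⊗ A.X) A.X) A.add
        have e2 : snd (diag A ⊗ diag A) (diag A) =
            linD (A := B) (B := A) (snd (A.X ⊗ A.X) A.X) := rfl
        have e3 : fst (diag A ⊗ diag A) (diag A) ≫ fst _ _ =
            linD (A := B) (B := A) (fst (A.X ⊗ A.X) A.X ≫ fst _ _) :=
          linD_comp (A := B) (B := A.prod A) (D := A) (fst (A.X ⊗ A.X) A.X) (fst A.X A.X)
        have e4 : fst (diag A ⊗ diag A) (diag A) ≫ snd _ _ =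
            linD (A := B) (B := A) (fst (A.X ⊗ A.X) A.X ≫ snd _ _) :=
          linD_comp (A := B) (B := A.prod A) (D := A) (fst (A.X ⊗ A.X) A.X) (snd A.X A.X)
        rw [e1, e2, e3, e4]
        obtain ⟨_, h1⟩ := lift_lamAdd (A := A) (B := B) (fst (A.X ⊗ A.X) A.X ≫ A.add)
          (snd (A.X ⊗ A.X) A.X)
        obtain ⟨_, h2⟩ := lift_lamAdd (A := A) (B := B) (fst (A.X ⊗ A.X) A.X ≫ snd _ _)
          (snd (A.X ⊗ A.X) A.X)
        obtain ⟨_, h3⟩ := lift_lamAdd (A := A) (B := B) (fst (A.X ⊗ A.X) A.X ≫ fst _ _)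
          (lift (fst (A.X ⊗ A.X) A.X ≫ snd _ _) (snd (A.X ⊗ A.X) A.X) ≫ A.add)
        refine h1.trans (Eq.trans ?_ ((congrArg (fun k => lift _ k ≫ lamAdd A) h2).trans h3).symm)
        refine linD_congr ?_
        rw [← AddMonObj.lift_lift_assoc, ← comp_lift (fst _ _), lift_fst_snd, Category.comp_id] }
  { X := diag A
    comm := ⟨by
      change lift (snd _ _) (fst _ _) ≫ lamAdd A = lamAdd A
      have e1 : fst (diag A) (diag A) = linD (A := A.prod A) (B := A) (fst A.X A.X) := rfl
      have e2 : snd (diag A) (diag A) = linD (A := A.prod A) (B := A) (snd A.X A.X) := rfl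
      rw [e1, e2]
      obtain ⟨_, h⟩ := lift_lamAdd (A := A) (B := A.prod A) (snd A.X A.X) (fst A.X A.X)
      exact h.trans (linD_congr (A := A.prod A) (B := A) (w := A.add)
        (IsCommAddMonObj.add_comm A.X))⟩ }

/-! The comultiplication sends a morphism `f` to the morphism of `Faa (Faa C)` whose component in
degree `n`, a morphism of `Faa C`, consists of `f.app n` and all its higher derivatives. The
derivative of order `m` of `f.app n` at a point `(a₁, …, aₙ, x)` in the directions
`(uⱼ₁, …, uⱼₙ, vⱼ)`, `j < m`, is a sum over the ways to use some of the directions for the vectors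
`aᵢ` (each direction and each vector at most once, as `f.app n` is additive in the vectors) and
the other directions for the point. -/

/-- The partial injections from an `n`-element set to an `m`-element set. -/
abbrev PartialInj (n m : ℕ) : Type :=
  {σ : Fin n → Option (Fin m) // ∀ i i' j, σ i = some j → σ i' = some j → i = i'}

noncomputable instance (n m : ℕ) : Fintype (PartialInj n m) := Fintype.ofFinite _

/-- The vectors and further directions at which the component of degree `n + m - |σ|` is evaluated
in the summand belonging to `σ`. -/
abbrev Slots {n m : ℕ} (σ : PartialInj n m) : Type :=
  Fin n ⊕ {j : Fin m // ∀ i, σ.1 i ≠ some j}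

instance {n m : ℕ+} (σ : PartialInj n m) : Nonempty (Slots σ) := ⟨Sum.inl ⟨0, n.pos⟩⟩

/-- The comultiplication on objects. -/
abbrev deltaObj (A : Faa C) : Faa (Faa C) := ⟨lam A.V, A⟩

section Delta

variable {A B : Faa C}

/-- The domain of the component of degree `n` of the comultiplication, an object of `Faa C`. -/
noncomputable abbrev deltaDom (A : Faa C) (n : ℕ) : Faa C := pow (deltaObj A).V.X A n

/-- The `i`-th vector, as a morphism of `Faa C`. -/
noncomputable abbrev deltaVec (A : Faa C) {n : ℕ} (i : Fin n) : deltaDom A n ⟶ diag A.V :=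
  proj (diag A.V) A i

/-- The point, as a morphism of `Faa C`. -/
noncomputable abbrev deltaBase (A : Faa C) (n : ℕ) : deltaDom A n ⟶ A := base (diag A.V) A n

/-- The point component of the component of degree `n`: the map `f.app n`. -/
noncomputable def deltaPt (f : A ⟶ B) (n : ℕ+) : (deltaDom A n).P ⟶ B.V.X :=
  FaaHom.eval f (fun i : Fin n => (deltaVec A i).pt) (deltaBase A n).pt

/-- The derivative of order `m` of `f.app n`. Here `a i` and `x` are the components of the point,
and `u i j` and `w j` the components of the direction `j`. -/
noncomputable def deltaApp (f : A ⟶ B) (n m : ℕ+) :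
    pow (deltaDom A n).V.X (deltaDom A n).P m ⟶ B.V.X :=
  let dir (j : Fin m) := proj (deltaDom A n).V.X (deltaDom A n).P j
  let pt := base (deltaDom A n).V.X (deltaDom A n).P m
  let a (i : Fin n) : _ ⟶ A.V.X := pt ≫ (deltaVec A i).pt
  let x : _ ⟶ A.P := pt ≫ (deltaBase A n).pt
  let u (i : Fin n) (j : Fin m) : _ ⟶ A.V.X :=
    FaaHom.eval (deltaVec A i) (fun _ : Unit => dir j) pt
  let w (j : Fin m) : _ ⟶ A.V.X := FaaHom.eval (deltaBase A n) (fun _ : Unit => dir j) pt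
  ∑ σ : PartialInj n m, FaaHom.eval f (ι := Slots σ)
    (Sum.elim (fun i => (σ.1 i).elim (a i) (u i)) (fun j => w j)) x

/-- `d` is the value of the comultiplication at the morphism `f`. -/
structure IsDelta (f : A ⟶ B) (d : deltaObj A ⟶ deltaObj B) : Prop where
  pt : d.pt = f
  app_pt (n : ℕ+) : FaaHom.pt (d.app n) = deltaPt f n
  app_app (n m : ℕ+) : FaaHom.app (d.app n) m = deltaApp f n m

end Delta

/-- A morphism of cartesian categories as a functor. -/
abbrev CartCat.functor {C D : CartCat.{v, u}} (F : C ⟶ D) : StrictFunctor C.carrier D.carrier := F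

/-- The component at `C` of a natural transformation `Faa ⟶ Faa²`, as a functor. -/
noncomputable def comulFunctor (δ : faaFunctor.{v, u} ⟶ faaFunctor ⋙ faaFunctor)
    (C : CartCat.{v, u}) : Faa C.carrier ⥤ Faa (Faa C.carrier) :=
  (CartCat.functor (δ.app C)).toFunctor

/-- `δ` is the comultiplication of `Faa`. This determines `δ`. -/
structure IsFaaComul (δ : faaFunctor.{v, u} ⟶ faaFunctor ⋙ faaFunctor) : Prop where
  obj (C : CartCat.{v, u}) (A : Faa C.carrier) : (comulFunctor δ C).obj A = deltaObj A
  map (C : CartCat.{v, u}) {A B : Faa C.carrier} (f : A ⟶ B) :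
    ∃ d : deltaObj A ⟶ deltaObj B, IsDelta f d ∧ (comulFunctor δ C).map f ≍ d

/-- The Faà di Bruno comonad with counit `faaCounit` and comultiplication `δ`. -/
noncomputable def faaComonad (δ : faaFunctor.{v, u} ⟶ faaFunctor ⋙ faaFunctor)
    (coassoc : ∀ C, δ.app C ≫ faaFunctor.map (δ.app C) = δ.app C ≫ δ.app (faaFunctor.obj C))
    (left_counit : ∀ C, δ.app C ≫ faaCounit.app (faaFunctor.obj C) = 𝟙 (faaFunctor.obj C))
    (right_counit : ∀ C, δ.app C ≫ faaFunctor.map (faaCounit.app C) = 𝟙 (faaFunctor.obj C)) :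
    Comonad CartCat.{v, u} where
  toFunctor := faaFunctor
  ε := faaCounit
  δ := δ
  coassoc := coassoc
  left_counit := left_counit
  right_counit := right_counit

/-! ### Generalized cartesian differential categories -/

/-- The data of a generalized cartesian differential structure, with the equations for `L`. -/
structure GCDData (C : Type u) [Category.{v} C] [CartesianMonoidalCategory C] where
  L : C → CMon C
  L_obj (X : C) : L (L X).X = L X
  L_unit : L (𝟙_ C) = CMon.triv C
  L_prod (X Y : C) : L (X ⊗ Y) = (L X).prod (L Y)
  D {X Y : C} (f : X ⟶ Y) : (L X).X ⊗ X ⟶ (L Y).X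

namespace GCDData

/-- The object of vectors. -/
abbrev L₀ (S : GCDData C) (X : C) : C := (S.L X).X

lemma L₀_dom (S : GCDData C) (X : C) : S.L₀ (S.L₀ X ⊗ X) = S.L₀ X ⊗ S.L₀ X := by
  unfold L₀
  rw [S.L_prod, S.L_obj]

lemma L₀_L₀ (S : GCDData C) (X : C) : S.L₀ (S.L₀ X) = S.L₀ X := congrArg CMon.X (S.L_obj X)

/-- The second derivative `D[D[f]]`, with its domain and codomain rewritten by the equations
for `L`. -/
def D₂ (S : GCDData C) {X Y : C} (f : X ⟶ Y) :
    (S.L₀ X ⊗ S.L₀ X) ⊗ (S.L₀ X ⊗ X) ⟶ S.L₀ Y :=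
  eqToHom (congrArg (fun V => V ⊗ (S.L₀ X ⊗ X)) (S.L₀_dom X).symm) ≫ S.D (S.D f) ≫
    eqToHom (S.L₀_L₀ Y)

end GCDData

/-- A generalized cartesian differential structure on a cartesian category. In `cd1`, `cd3` and
`cd4` the two sides have the same domain and codomain by the equations for `L`. -/
structure GCDStr (C : Type u) [Category.{v} C] [CartesianMonoidalCategory C] extends
    GCDData C where
  cd1_add (X : C) : D (L X).add ≍ fst ((L X).X ⊗ (L X).X) ((L X).X ⊗ (L X).X) ≫ (L X).add
  cd1_zero (X : C) : D (L X).zero ≍ fst (𝟙_ C) (𝟙_ C) ≫ (L X).zero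
  cd2_add {X Y Z : C} (f : X ⟶ Y) (a b : Z ⟶ (L X).X) (c : Z ⟶ X) :
    lift (a + b) c ≫ D f = lift a c ≫ D f + lift b c ≫ D f
  cd2_zero {X Y Z : C} (f : X ⟶ Y) (c : Z ⟶ X) : lift 0 c ≫ D f = 0
  cd3_fst (X Y : C) : D (fst X Y) ≍ fst ((L X).X ⊗ (L Y).X) (X ⊗ Y) ≫ fst (L X).X (L Y).X
  cd3_snd (X Y : C) : D (snd X Y) ≍ fst ((L X).X ⊗ (L Y).X) (X ⊗ Y) ≫ snd (L X).X (L Y).X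
  cd4 {X Y Z : C} (f : X ⟶ Y) (g : X ⟶ Z) : D (lift f g) ≍ lift (D f) (D g)
  cd5 {X Y Z : C} (f : X ⟶ Y) (g : Y ⟶ Z) :
    D (f ≫ g) = lift (D f) (snd (L X).X X ≫ f) ≫ D g
  cd6 {X Y Z : C} (f : X ⟶ Y) (a c : Z ⟶ (L X).X) (d : Z ⟶ X) :
    lift (lift a 0) (lift c d) ≫ toGCDData.D₂ f = lift a d ≫ D f
  cd7 {X Y Z : C} (f : X ⟶ Y) (b c : Z ⟶ (L X).X) (d : Z ⟶ X) :
    lift (lift 0 b) (lift c d) ≫ toGCDData.D₂ f = lift (lift 0 c) (lift b d) ≫ toGCDData.D₂ f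

/-- A functor preserving the chosen finite products preserves the differential structure. -/
structure GCDStr.Preserves {C : Type u} [Category.{v} C] [CartesianMonoidalCategory C]
    {D : Type u} [Category.{v} D] [CartesianMonoidalCategory D] (S : GCDStr C) (T : GCDStr D)
    (F : StrictFunctor C D) : Prop where
  L_eq (X : C) : T.L (F.obj X) = F.mapCMon (S.L X)
  D_heq {X Y : C} (f : X ⟶ Y) : T.D (F.map f) ≍ F.map (S.D f)

/-- A generalized cartesian differential category. -/
structure GCDCat : Type (max u v + 1) where
  cart : CartCat.{v, u}
  str : GCDStr cart.carrier

lemma GCDStr.preserves_id {C : Type u} [Category.{v} C] [CartesianMonoidalCategory C]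
    (S : GCDStr C) : S.Preserves S (StrictFunctor.id C) where
  L_eq X := (StrictFunctor.mapCMon_id _).symm
  D_heq _ := HEq.rfl

lemma GCDStr.Preserves.comp {C D E : Type u} [Category.{v} C] [CartesianMonoidalCategory C]
    [Category.{v} D] [CartesianMonoidalCategory D] [Category.{v} E] [CartesianMonoidalCategory E]
    {S : GCDStr C} {T : GCDStr D} {U : GCDStr E} {F : StrictFunctor C D} {G : StrictFunctor D E}
    (hF : S.Preserves T F) (hG : T.Preserves U G) : S.Preserves U (F.comp G) where
  L_eq X := ((hG.L_eq _).trans (congrArg G.mapCMon (hF.L_eq X))).trans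
    (StrictFunctor.mapCMon_comp F G _).symm
  D_heq {X Y} f := by
    refine (hG.D_heq (F.map f)).trans ?_
    have h : ∀ {P P' Q Q' : D} (_ : P = P') (_ : Q = Q') (k : P ⟶ Q) (k' : P' ⟶ Q'), k ≍ k' →
        G.map k ≍ G.map k' := by
      rintro P _ Q _ rfl rfl k k' h
      rw [eq_of_heq h]
    refine h ?_ (congrArg CMon.X (hF.L_eq Y)) _ _ (hF.D_heq f)
    rw [F.obj_prod, hF.L_eq X]

/-- Generalized cartesian differential categories and functors preserving the chosen finite
products and the differential structure exactly. -/
instance : Category.{max u v} GCDCat.{v, u} where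
  Hom A B := {F : StrictFunctor A.cart.carrier B.cart.carrier // A.str.Preserves B.str F}
  id A := ⟨StrictFunctor.id _, A.str.preserves_id⟩
  comp F G := ⟨F.1.comp G.1, F.2.comp G.2⟩

/-- The forgetful functor to cartesian categories. -/
def GCDCat.forget : GCDCat.{v, u} ⥤ CartCat.{v, u} where
  obj A := A.cart
  map F := F.1

/-- The coalgebra structure `a` and the differential structure `S` correspond to each other:
`a` sends `X` to `(L X, X)` and `D[f]` is the component of degree one of the value of `a`
at `f`. -/
structure Corresponds {C : CartCat.{v, u}} (a : C ⟶ faaFunctor.obj C) (S : GCDStr C.carrier) :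
    Prop where
  obj (X : C.carrier) : ((CartCat.functor a).obj X : Faa C.carrier) = ⟨S.L X, X⟩
  map {X Y : C.carrier} (f : X ⟶ Y) :
    FaaHom.app (C := C.carrier) ((CartCat.functor a).map f) 1 ≍ S.D f

end GenDiff

open GenDiff

/-!
The theorem is true because `Faa C` is itself a generalized cartesian differential category, and the
cofree one on `C`.

*The structure of `Faa C`* (`faaStr`). A morphism `f` of `Faa C` is a map together with candidates
`f₁, f₂, …` for its iterated derivatives, so it has a formal derivative `FaaHom.deriv f`: its point
component is `f₁`, and its higher components are obtained by formally differentiating those of `f`,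
using that `fₙ₊₁` stands for the derivative of `fₙ` in the point and that `fₙ` is additive in the
vectors (`FaaHom.dval`). The chain rule [CD.5] holds because a partition of `n + 1` elements is a
partition of `n` elements together with a place for the last one (`FaaHom.compVal_option`,
`FaaHom.dval_comp`); [CD.6] and [CD.7] are additivity and symmetry of the components
(`FaaHom.deriv_dval_left`, `FaaHom.deriv_dval_symm`).

*Jets.* A differential structure `S` on `C` gives a functor `S.jetFunctor : C ⥤ Faa C`, sending `X`
to `(L X, X)` and `f` to the sequence of its iterated derivatives. These are symmetric by [CD.7] and
additive by [CD.2], their derivatives are computed by [CD.6] and [CD.7] (`GCDStr.iter_D`), and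
functoriality is the Faà di Bruno formula, which follows by iterating the chain rule
(`GCDStr.jet_comp_eval_fin`). The jet functor preserves the differential structures
(`GCDStr.preserves_jetFunctor`), and a functor preserves given differential structures if and only
if it commutes with the jet functors (`StrictFunctor.jetFunctor_comp_faa`,
`GCDStr.preserves_of_comp_faa`).

*The comonad.* The comultiplication at `C` is the jet functor of `faaStr C`. Its naturality and its
coassociativity are both instances of `StrictFunctor.jetFunctor_comp_faa`: the first for the functor
`Faa C ⥤ Faa D` induced by a functor `C ⥤ D` (`StrictFunctor.preserves_faa`), the second for the jet
functor `Faa C ⥤ Faa (Faa C)`. The explicit formula, a sum over partial injections, follows by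
induction on the number of derivatives: each further derivative goes in a new direction of the outer
morphism or differentiates one of the vectors already present (`jet_eval_lin`, `isDelta_jet`).

*Coalgebras.* Coassociativity of a coalgebra `a` in degree one says that `a` sends the map `D f =
a(f)₁` to the formal derivative of `a(f)` (`FaaSection.map_D_heq`). The axioms [CD.1]-[CD.7] for `D`
can therefore be read off from the degree one part of the structure of `Faa C` (`FaaSection.str`),
and the components of `a(f)` of degree `n + 1` are determined by those of `a(D f)` of degree `n`, so
that `a` is the jet functor of this structure (`FaaSection.eq_jetFunctor`). Conversely every jet
functor is a coalgebra. The forgetful functor is left adjoint to `C ↦ (Faa C, faaStr C)`, with the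
jet functors as unit (`forgetAdj`), and the comparison functor of this adjunction is the isomorphism
just described.
-/

namespace GenDiff

attribute [local instance] BraidedCategory.ofCartesianMonoidalCategory Hom.addCommMonoid

/-! ### Casts along equations between objects -/

section

variable {C : Type u} [Category.{v} C] [CartesianMonoidalCategory C]

lemma isAddMonHom_eqToHom {A B : CMon C} (h : A = B) (h' : A.X = B.X) :
    IsAddMonHom (eqToHom h') := by
  subst h
  exact (inferInstance : IsAddMonHom (𝟙 A.X))

lemma eqToHom_fst {A A' B B' : C} (h : A = A') (h' : B = B') (H : A ⊗ B = A' ⊗ B') :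
    eqToHom H ≫ fst A' B' = fst A B ≫ eqToHom h := by
  subst h h'
  simp

lemma eqToHom_snd {A A' B B' : C} (h : A = A') (h' : B = B') (H : A ⊗ B = A' ⊗ B') :
    eqToHom H ≫ snd A' B' = snd A B ≫ eqToHom h' := by
  subst h h'
  simp

lemma lift_comp_eqToHom {Z A A' B B' : C} (h : A = A') (h' : B = B') (H : A ⊗ B = A' ⊗ B')
    (a : Z ⟶ A) (b : Z ⟶ B) : lift a b ≫ eqToHom H = lift (a ≫ eqToHom h) (b ≫ eqToHom h') := by
  subst h h'
  simp

/-- Heterogeneous equalities like those in the axioms [CD.1] and [CD.3], as equations between maps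
of one source. -/
lemma eq_of_heq_dom {A A' B B' Y Y' : C} (h : A = A') (h' : B = B') (hY : Y' = Y)
    (f : A ⊗ B ⟶ Y) (g : A' ⊗ B' ⟶ Y') (e : f ≍ g) :
    f = lift (fst _ _ ≫ eqToHom h) (snd _ _ ≫ eqToHom h') ≫ g ≫ eqToHom hY := by
  subst h h' hY
  simpa using e

/-! ### Calculus in a generalized cartesian differential category -/

namespace GCDStr

variable (S : GCDStr C)

/-- The identification of `L₀ (L₀ X)` with `L₀ X`. -/
def flat (X : C) : S.L₀ (S.L₀ X) ⟶ S.L₀ X := eqToHom (S.L₀_L₀ X)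

/-- The inverse of `flat`. -/
def unflat (X : C) : S.L₀ X ⟶ S.L₀ (S.L₀ X) := eqToHom (S.L₀_L₀ X).symm

lemma L₀_prod (X Y : C) : S.L₀ (X ⊗ Y) = S.L₀ X ⊗ S.L₀ Y := congrArg CMon.X (S.L_prod X Y)

/-- The identification of `L₀ (X ⊗ Y)` with `L₀ X ⊗ L₀ Y`. -/
def split (X Y : C) : S.L₀ (X ⊗ Y) ⟶ S.L₀ X ⊗ S.L₀ Y := eqToHom (S.L₀_prod X Y)

/-- The inverse of `split`. -/
def unsplit (X Y : C) : S.L₀ X ⊗ S.L₀ Y ⟶ S.L₀ (X ⊗ Y) := eqToHom (S.L₀_prod X Y).symm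

instance (X : C) : IsAddMonHom (S.flat X) := isAddMonHom_eqToHom (S.L_obj X) _
instance (X : C) : IsAddMonHom (S.unflat X) := isAddMonHom_eqToHom (S.L_obj X).symm _
instance (X Y : C) : IsAddMonHom (S.split X Y) := isAddMonHom_eqToHom (S.L_prod X Y) _
instance (X Y : C) : IsAddMonHom (S.unsplit X Y) := isAddMonHom_eqToHom (S.L_prod X Y).symm _

@[simp] lemma flat_unflat (X : C) : S.flat X ≫ S.unflat X = 𝟙 _ := by simp [flat, unflat]
@[simp] lemma unflat_flat (X : C) : S.unflat X ≫ S.flat X = 𝟙 _ := by simp [flat, unflat]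
@[simp] lemma unflat_flat_assoc (X : C) {Z : C} (k : _ ⟶ Z) :
    S.unflat X ≫ S.flat X ≫ k = k := by simp [flat, unflat]
@[simp] lemma split_unsplit (X Y : C) : S.split X Y ≫ S.unsplit X Y = 𝟙 _ := by
  simp [split, unsplit]
@[simp] lemma unsplit_split (X Y : C) : S.unsplit X Y ≫ S.split X Y = 𝟙 _ := by
  simp [split, unsplit]

/-- The vector of a product with components `a` and `b`. -/
def pr {X Y Z : C} (a : Z ⟶ S.L₀ X) (b : Z ⟶ S.L₀ Y) : Z ⟶ S.L₀ (X ⊗ Y) :=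
  lift a b ≫ S.unsplit X Y

section pr
variable {S} {X Y Z W : C}

lemma comp_pr (h : W ⟶ Z) (a : Z ⟶ S.L₀ X) (b : Z ⟶ S.L₀ Y) :
    h ≫ S.pr a b = S.pr (h ≫ a) (h ≫ b) := by
  simp only [pr, ← Category.assoc, comp_lift]

@[simp] lemma pr_split (a : Z ⟶ S.L₀ X) (b : Z ⟶ S.L₀ Y) : S.pr a b ≫ S.split X Y = lift a b := by
  simp [pr]

@[simp] lemma pr_split_assoc (a : Z ⟶ S.L₀ X) (b : Z ⟶ S.L₀ Y) (k : _ ⟶ W) :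
    S.pr a b ≫ S.split X Y ≫ k = lift a b ≫ k := by
  rw [← Category.assoc, pr_split]

lemma pr_add (a a' : Z ⟶ S.L₀ X) (b b' : Z ⟶ S.L₀ Y) :
    S.pr (a + a') (b + b') = S.pr a b + S.pr a' b' := by
  rw [pr, lift_add, add_comp]
  rfl

lemma pr_zero : S.pr (0 : Z ⟶ S.L₀ X) (0 : Z ⟶ S.L₀ Y) = 0 := by
  rw [pr, lift_zero, zero_comp]

lemma pr_eta (a : Z ⟶ S.L₀ (X ⊗ Y)) :
    S.pr (a ≫ S.split X Y ≫ fst _ _) (a ≫ S.split X Y ≫ snd _ _) = a := by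
  rw [pr, ← comp_lift, ← comp_lift]
  simp

end pr

variable {X Y Z W : C}

lemma D_lift (f : X ⟶ Y) (g : X ⟶ Z) : S.D (lift f g) = S.pr (S.D f) (S.D g) := by
  have h := S.cd4 f g
  unfold pr unsplit
  refine eq_of_heq (h.trans ?_)
  exact (comp_eqToHom_heq _ _).symm

lemma D_fst (X Y : C) : S.D (fst X Y) = fst _ _ ≫ S.split X Y ≫ fst _ _ := by
  rw [eq_of_heq_dom (S.L₀_prod X Y) rfl rfl _ _ (S.cd3_fst X Y)]
  simp [split]

lemma D_snd (X Y : C) : S.D (snd X Y) = fst _ _ ≫ S.split X Y ≫ snd _ _ := by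
  rw [eq_of_heq_dom (S.L₀_prod X Y) rfl rfl _ _ (S.cd3_snd X Y)]
  simp [split]

/-- The derivative of an identity follows from the chain rule and the derivative of the first
projection, which is a split epimorphism. -/
lemma D_id (X : C) : S.D (𝟙 X) = fst _ _ := by
  have h := S.cd5 (fst X X) (𝟙 X)
  rw [Category.comp_id, D_fst] at h
  have h' := congrArg (fun k => lift (S.pr (fst (S.L₀ X) X) (fst _ _)) (lift (snd _ _) (snd _ _))
    ≫ k) h
  simp only [lift_fst_assoc, pr_split_assoc, lift_fst] at h'
  rw [h', ← Category.assoc, comp_lift]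
  simp

/-- A map `k'` which is the derivative of some `k` at every point preserves zero, by [CD.2]. The
point `x` is only needed to apply the axiom. -/
lemma zero_comp_of_D {k : X ⟶ Y} {k' : S.L₀ X ⟶ S.L₀ Y} (h : S.D k = fst _ _ ≫ k')
    (x : Z ⟶ X) : (0 : Z ⟶ S.L₀ X) ≫ k' = 0 := by
  have := S.cd2_zero k x
  rw [h] at this
  simpa using this

lemma D_comp_of_D {k : X ⟶ Y} {k' : S.L₀ X ⟶ S.L₀ Y} (h : S.D k = fst _ _ ≫ k') (f : W ⟶ X) :
    S.D (f ≫ k) = S.D f ≫ k' := by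
  rw [S.cd5, h, lift_fst_assoc]

lemma D_zero (X Y : C) : S.D (0 : X ⟶ S.L₀ Y) = 0 := by
  have h : S.D (S.L Y).zero = 0 := by
    rw [eq_of_heq_dom (congrArg CMon.X S.L_unit) rfl (S.L₀_L₀ Y).symm _ _ (S.cd1_zero Y)]
    have : ∀ (Z : C) (k : Z ⟶ 𝟙_ C), k ≫ (S.L Y).zero = 0 := fun Z k => by
      rw [toUnit_unique k (toUnit _), zero_eq]
    rw [Category.assoc, ← Category.assoc, ← Category.assoc, this]
    exact zero_comp (S.unflat Y)
  rw [zero_eq, S.cd5, h, comp_zero]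

/-- A map `k` which is linear with derivative given by `k'`, in the sense that the derivative of `k`
at any point is `k'` and likewise for `k'`. -/
structure IsLin (k : X ⟶ Y) (k' : S.L₀ X ⟶ S.L₀ Y) : Prop where
  D_eq : S.D k = fst _ _ ≫ k'
  D_eq' : S.D k' = fst _ _ ≫ S.flat X ≫ k' ≫ S.unflat Y

namespace IsLin
variable {S}

lemma eqToHom (h : X = Y) : S.IsLin (eqToHom h) (eqToHom (congrArg S.L₀ h)) := by
  subst h
  constructor <;> simp [D_id]

lemma id (X : C) : S.IsLin (𝟙 X) (𝟙 _) := eqToHom rfl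

lemma comp {k : X ⟶ Y} {k' : S.L₀ X ⟶ S.L₀ Y} (h : S.IsLin k k') {l : Y ⟶ Z}
    {l' : S.L₀ Y ⟶ S.L₀ Z} (hl : S.IsLin l l') : S.IsLin (k ≫ l) (k' ≫ l') where
  D_eq := by rw [S.D_comp_of_D hl.D_eq, h.D_eq, Category.assoc]
  D_eq' := by rw [S.D_comp_of_D hl.D_eq', h.D_eq']; simp

lemma zero (X Y : C) : S.IsLin (0 : X ⟶ S.L₀ Y) 0 where
  D_eq := by rw [D_zero, comp_zero]
  D_eq' := by rw [D_zero, zero_comp, comp_zero, comp_zero]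

lemma flat (X : C) : S.IsLin (S.flat X) (S.flat (S.L₀ X)) := eqToHom _
lemma unflat (X : C) : S.IsLin (S.unflat X) (S.unflat (S.L₀ X)) := eqToHom _

/-- The derivative of a linear map is linear. In this sense the two conditions of `IsLin` imply the
linearity of all further derivatives. -/
lemma deriv {k : X ⟶ Y} {k' : S.L₀ X ⟶ S.L₀ Y} (h : S.IsLin k k') :
    S.IsLin k' (S.flat X ≫ k' ≫ S.unflat Y) where
  D_eq := h.D_eq'
  D_eq' := by
    rw [S.D_comp_of_D (k := k' ≫ S.unflat Y) (k' := (S.flat X ≫ k' ≫ S.unflat Y) ≫ S.unflat _),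
      (IsLin.flat X).D_eq]
    · simp
    · rw [S.D_comp_of_D (IsLin.unflat Y).D_eq, h.D_eq']
      simp

lemma fst (X Y : C) : S.IsLin (fst X Y) (S.split X Y ≫ CartesianMonoidalCategory.fst _ _) where
  D_eq := S.D_fst X Y
  D_eq' := by
    rw [S.D_comp_of_D (S.D_fst _ _)]
    unfold split
    rw [(IsLin.eqToHom _).D_eq]
    unfold GCDStr.flat GCDStr.unflat
    simp only [Category.assoc, eqToHom_trans_assoc]
    rw [← eqToHom_fst (S.L₀_L₀ X).symm (S.L₀_L₀ Y).symm (by rw [S.L₀_L₀, S.L₀_L₀]),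
      eqToHom_trans_assoc]

lemma snd (X Y : C) : S.IsLin (snd X Y) (S.split X Y ≫ CartesianMonoidalCategory.snd _ _) where
  D_eq := S.D_snd X Y
  D_eq' := by
    rw [S.D_comp_of_D (S.D_snd _ _)]
    unfold split
    rw [(IsLin.eqToHom _).D_eq]
    unfold GCDStr.flat GCDStr.unflat
    simp only [Category.assoc, eqToHom_trans_assoc]
    rw [← eqToHom_snd (S.L₀_L₀ X).symm (S.L₀_L₀ Y).symm (by rw [S.L₀_L₀, S.L₀_L₀]),
      eqToHom_trans_assoc]

lemma unsplit (X Y : C) : S.IsLin (S.unsplit X Y)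
    (S.pr (S.split _ _ ≫ CartesianMonoidalCategory.fst _ _ ≫ S.flat X)
      (S.split _ _ ≫ CartesianMonoidalCategory.snd _ _ ≫ S.flat Y) ≫ S.unflat _) := by
  have e : S.pr (S.split _ _ ≫ CartesianMonoidalCategory.fst _ _ ≫ S.flat X)
      (S.split _ _ ≫ CartesianMonoidalCategory.snd _ _ ≫ S.flat Y) ≫ S.unflat _ =
      CategoryTheory.eqToHom (congrArg S.L₀ (S.L₀_prod X Y).symm) := by
    unfold GCDStr.pr GCDStr.flat GCDStr.unflat GCDStr.split GCDStr.unsplit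
    rw [← comp_lift, ← lift_comp_eqToHom (S.L₀_L₀ X) (S.L₀_L₀ Y)
      (by rw [S.L₀_L₀, S.L₀_L₀])]
    simp
  rw [e]
  exact IsLin.eqToHom _

lemma lift {k : W ⟶ X} {k' : S.L₀ W ⟶ S.L₀ X} (h : S.IsLin k k') {l : W ⟶ Y}
    {l' : S.L₀ W ⟶ S.L₀ Y} (hl : S.IsLin l l') : S.IsLin (lift k l) (S.pr k' l') where
  D_eq := by rw [D_lift, h.D_eq, hl.D_eq, comp_pr]
  D_eq' := by
    change S.D (CartesianMonoidalCategory.lift k' l' ≫ S.unsplit X Y) = _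
    rw [S.D_comp_of_D (IsLin.unsplit _ _).D_eq, D_lift, h.D_eq',
      hl.D_eq', ← Category.assoc (S.pr _ _),
      comp_pr]
    simp only [pr_split_assoc, lift_fst_assoc, lift_snd_assoc, Category.assoc, unflat_flat,
      Category.comp_id]
    simp only [← Category.assoc, ← comp_pr]

lemma pr {k : W ⟶ S.L₀ X} {k' : S.L₀ W ⟶ S.L₀ (S.L₀ X)} (h : S.IsLin k k') {l : W ⟶ S.L₀ Y}
    {l' : S.L₀ W ⟶ S.L₀ (S.L₀ Y)} (hl : S.IsLin l l') :
    S.IsLin (S.pr k l) (S.pr (k' ≫ S.flat X) (l' ≫ S.flat Y) ≫ S.unflat _) := by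
  have e := (h.lift hl).comp (IsLin.unsplit X Y)
  rw [← Category.assoc, comp_pr] at e
  simp only [pr_split_assoc, lift_fst_assoc, lift_snd_assoc] at e
  exact e

end IsLin

/-- Second derivatives, with the cast in `D₂` replaced by the identification `unflat` of the vector
of directions `u`. -/
lemma lift_D₂ (f : X ⟶ Y) (u w : Z ⟶ S.L₀ X) (p : Z ⟶ S.L₀ X ⊗ X) :
    lift (lift u w) p ≫ S.D₂ f =
      lift (S.pr (X := S.L₀ X) (u ≫ S.unflat X) w) p ≫ S.D (S.D f) ≫ S.flat Y := by
  unfold GCDData.D₂ pr unsplit unflat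
  have e := lift_comp_eqToHom (S.L₀_L₀ X).symm rfl (by rw [S.L₀_L₀]) u w
  rw [eqToHom_refl, Category.comp_id] at e
  rw [← e, ← Category.assoc, lift_comp_eqToHom (S.L₀_dom X).symm rfl, eqToHom_refl,
    Category.comp_id, Category.assoc, eqToHom_trans]
  rfl

end GCDStr

end

/-! ### Iterated derivatives -/

section

variable {C : Type u} [Category.{v} C] [CartesianMonoidalCategory C]

lemma sum_comp {A B Z : C} [AddMonObj A] [IsCommAddMonObj A] [AddMonObj B] [IsCommAddMonObj B]
    {ι : Type*} (s : Finset ι) (f : ι → (Z ⟶ A)) (u : A ⟶ B) [IsAddMonHom u] :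
    (∑ i ∈ s, f i) ≫ u = ∑ i ∈ s, f i ≫ u := by
  classical
  induction s using Finset.induction_on with
  | empty => exact zero_comp u
  | insert i s hi ih => rw [Finset.sum_insert hi, Finset.sum_insert hi, add_comp, ih]

namespace GCDStr

variable (S : GCDStr C)

/-- The vector `(u, w)` at a point of `L₀ X ⊗ X`. -/
def tan {X Z : C} (u w : Z ⟶ S.L₀ X) : Z ⟶ S.L₀ (S.L₀ X ⊗ X) := S.pr (u ≫ S.unflat X) w

section tan
variable {S} {X Y Z W : C}

lemma comp_tan (h : W ⟶ Z) (u w : Z ⟶ S.L₀ X) : h ≫ S.tan u w = S.tan (h ≫ u) (h ≫ w) := by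
  rw [tan, comp_pr, ← Category.assoc]
  rfl

lemma tan_add (u u' w w' : Z ⟶ S.L₀ X) :
    S.tan (u + u') (w + w') = S.tan u w + S.tan u' w' := by
  rw [tan, add_comp, pr_add]
  rfl

lemma tan_zero : S.tan (0 : Z ⟶ S.L₀ X) 0 = 0 := by
  rw [tan, zero_comp, pr_zero]

lemma exists_tan (v : Z ⟶ S.L₀ (S.L₀ X ⊗ X)) : ∃ u w, v = S.tan u w :=
  ⟨v ≫ S.split _ _ ≫ fst _ _ ≫ S.flat X, v ≫ S.split _ _ ≫ snd _ _, by
    simp only [tan, Category.assoc, flat_unflat, Category.comp_id]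
    rw [pr_eta]⟩

lemma IsLin.tan {k l : W ⟶ S.L₀ X} {k' l' : S.L₀ W ⟶ S.L₀ (S.L₀ X)} (h : S.IsLin k k')
    (hl : S.IsLin l l') :
    S.IsLin (S.tan k l) (S.tan (k' ≫ S.flat X) (l' ≫ S.flat X) ≫ S.unflat _) := by
  convert (h.comp (IsLin.unflat X)).pr hl using 3
  all_goals simp [GCDStr.tan]

@[simp] lemma tan_split (u w : Z ⟶ S.L₀ X) :
    S.tan u w ≫ S.split (S.L₀ X) X = lift (u ≫ S.unflat X) w := pr_split _ _

@[simp] lemma tan_split_assoc (u w : Z ⟶ S.L₀ X) (k : _ ⟶ W) :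
    S.tan u w ≫ S.split (S.L₀ X) X ≫ k = lift (u ≫ S.unflat X) w ≫ k := pr_split_assoc _ _ _

end tan

variable {X Y Z W : C}

lemma cd6_tan (f : X ⟶ Y) (a c : Z ⟶ S.L₀ X) (d : Z ⟶ X) :
    lift (S.tan a 0) (lift c d) ≫ S.D (S.D f) ≫ S.flat Y = lift a d ≫ S.D f := by
  rw [← S.cd6 f a c d, lift_D₂]
  rfl

lemma cd7_tan (f : X ⟶ Y) (b c : Z ⟶ S.L₀ X) (d : Z ⟶ X) :
    lift (S.tan 0 b) (lift c d) ≫ S.D (S.D f) ≫ S.flat Y =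
      lift (S.tan 0 c) (lift b d) ≫ S.D (S.D f) ≫ S.flat Y := by
  have := S.cd7 f b c d
  rw [lift_D₂, lift_D₂] at this
  exact this

/-- The `n`-th derivative of `f`, as a map of `n` vectors and a point, for `n ≥ 1`. The vector `a 0`
is the one used by the innermost derivative: the derivative in the directions `a 0, …, a (n + 1)` at
`x` is the derivative of `D f` in the directions `(0, a 1), …, (0, a (n + 1))` at `(a 0, x)`. The
value `0` for `n = 0` is a convention. -/
noncomputable def iter : ∀ (n : ℕ) {X Y : C} (_ : X ⟶ Y), pow (S.L₀ X) X n ⟶ S.L₀ Y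
  | 0, _, _, _ => 0
  | 1, _, _, f => S.D f
  | n + 2, X, Y, f =>
    tuple (n := n + 1) (fun i => S.tan 0 (proj (S.L₀ X) X i.succ))
      (lift (proj (S.L₀ X) X (0 : Fin (n + 2))) (base (S.L₀ X) X (n + 2))) ≫
      iter (n + 1) (S.D f) ≫ S.flat Y

lemma tuple_iter_one (f : X ⟶ Y) (a : Fin 1 → (Z ⟶ S.L₀ X)) (x : Z ⟶ X) :
    tuple a x ≫ S.iter 1 f = lift (a 0) x ≫ S.D f := rfl

lemma tuple_iter_succ (n : ℕ) (f : X ⟶ Y) (a : Fin (n + 2) → (Z ⟶ S.L₀ X)) (x : Z ⟶ X) :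
    tuple a x ≫ S.iter (n + 2) f =
      tuple (n := n + 1) (fun i => S.tan 0 (a i.succ)) (lift (a 0) x) ≫ S.iter (n + 1) (S.D f) ≫
        S.flat Y := by
  rw [iter, ← Category.assoc, comp_tuple]
  simp only [comp_tan, tuple_proj, comp_lift, tuple_base, comp_zero]

variable {S}

/-- Precomposition with a linear map. -/
lemma IsLin.comp_iter {k : X ⟶ Y} {k' : S.L₀ X ⟶ S.L₀ Y} (h : S.IsLin k k') (g : Y ⟶ W) (n : ℕ)
    (a : Fin n → (Z ⟶ S.L₀ X)) (x : Z ⟶ X) :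
    tuple a x ≫ S.iter n (k ≫ g) = tuple (fun i => a i ≫ k') (x ≫ k) ≫ S.iter n g := by
  induction n using Nat.strong_induction_on generalizing X Y W with
  | h n ih =>
    match n with
    | 0 => simp only [iter, comp_zero]
    | 1 =>
      rw [tuple_iter_one, tuple_iter_one, S.cd5, h.D_eq, ← Category.assoc, comp_lift]
      simp
    | n + 2 =>
      have hD : S.D (k ≫ g) =
          CartesianMonoidalCategory.lift (CartesianMonoidalCategory.fst (S.L₀ X) X ≫ k')
            (CartesianMonoidalCategory.snd (S.L₀ X) X ≫ k) ≫ S.D g := by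
        rw [S.cd5, h.D_eq]
      have hl := ((IsLin.fst (S.L₀ X) X).comp h.deriv).lift ((IsLin.snd (S.L₀ X) X).comp h)
      rw [tuple_iter_succ, tuple_iter_succ, hD, ← Category.assoc, ih (n + 1) (by omega) hl,
        Category.assoc]
      congr 2
      · funext i
        rw [comp_pr]
        unfold GCDStr.tan
        simp only [Category.assoc, pr_split_assoc, lift_fst_assoc, lift_snd_assoc,
          unflat_flat_assoc]
        rw [← Category.assoc 0 k', S.zero_comp_of_D h.D_eq x]
      · rw [comp_lift]
        simp

/-- Postcomposition with a linear map. -/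
lemma IsLin.iter_comp {k : X ⟶ Y} {k' : S.L₀ X ⟶ S.L₀ Y} (h : S.IsLin k k') (f : W ⟶ X) (n : ℕ) :
    S.iter (n + 1) (f ≫ k) = S.iter (n + 1) f ≫ k' := by
  induction n generalizing X Y W with
  | zero => exact S.D_comp_of_D h.D_eq f
  | succ n ih =>
    rw [iter, iter, S.D_comp_of_D h.D_eq, ih h.deriv]
    simp

variable (S)

/-- The iterated derivatives of both sides of [CD.6]. The arguments of `D (D f)` are linear in `(a,
c, d)`, so the vectors transform in the same way as the point. -/
lemma cd6_iter (f : X ⟶ Y) (n : ℕ) (p q w : Fin (n + 1) → (Z ⟶ S.L₀ X)) (a c : Z ⟶ S.L₀ X)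
    (d : Z ⟶ X) :
    tuple (fun i => S.tan (S.tan (p i) 0) (S.tan (q i) (w i))) (lift (S.tan a 0) (lift c d)) ≫
        S.iter (n + 1) (S.D (S.D f)) ≫ S.flat (S.L₀ Y) =
      tuple (fun i => S.tan (p i) (w i)) (lift a d) ≫ S.iter (n + 1) (S.D f) := by
  have h₁ := ((IsLin.fst (S := S) (S.L₀ X) (S.L₀ X ⊗ X)).tan (IsLin.zero _ X)).lift
    (IsLin.snd (S.L₀ X) (S.L₀ X ⊗ X))
  have h₂ := (IsLin.fst (S := S) (S.L₀ X) (S.L₀ X ⊗ X)).lift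
    ((IsLin.snd (S.L₀ X) (S.L₀ X ⊗ X)).comp (IsLin.snd (S.L₀ X) X))
  have e : lift (S.tan (fst (S.L₀ X) (S.L₀ X ⊗ X)) 0) (snd _ _) ≫ (S.D (S.D f) ≫ S.flat Y) =
      lift (fst _ _) (snd _ _ ≫ snd _ _) ≫ S.D f := by
    rw [← S.cd6_tan f _ (snd _ _ ≫ fst _ _), ← comp_lift, lift_fst_snd, Category.comp_id]
  have h := h₁.comp_iter (S.D (S.D f) ≫ S.flat Y) (n + 1)
    (fun i => S.pr (p i ≫ S.unflat X) (S.tan (q i) (w i))) (lift a (lift c d))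
  rw [e, h₂.comp_iter, (IsLin.flat Y).iter_comp] at h
  simp only [comp_pr, comp_tan, comp_lift, comp_zero, ← Category.assoc] at h
  simp only [Category.assoc, pr_split_assoc, lift_fst, lift_snd,
    unflat_flat, Category.comp_id, tan_split] at h
  refine (h.trans ?_).symm
  simp only [tan, zero_comp]

/-- The iterated derivatives of both sides of [CD.7], obtained as in `cd6_iter`. -/
lemma cd7_iter (f : X ⟶ Y) (n : ℕ) (p q w : Fin (n + 1) → (Z ⟶ S.L₀ X)) (b c : Z ⟶ S.L₀ X)
    (d : Z ⟶ X) :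
    tuple (fun i => S.tan (S.tan 0 (p i)) (S.tan (q i) (w i))) (lift (S.tan 0 b) (lift c d)) ≫
        S.iter (n + 1) (S.D (S.D f)) ≫ S.flat (S.L₀ Y) =
      tuple (fun i => S.tan (S.tan 0 (q i)) (S.tan (p i) (w i))) (lift (S.tan 0 c) (lift b d)) ≫
        S.iter (n + 1) (S.D (S.D f)) ≫ S.flat (S.L₀ Y) := by
  have h₁ := ((IsLin.zero (S := S) _ X).tan (IsLin.fst (S.L₀ X) (S.L₀ X ⊗ X))).lift
    (IsLin.snd (S.L₀ X) (S.L₀ X ⊗ X))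
  have h₂ := ((IsLin.snd (S := S) (S.L₀ X) (S.L₀ X ⊗ X)).comp (IsLin.fst (S.L₀ X) X)).lift
    ((IsLin.fst (S.L₀ X) (S.L₀ X ⊗ X)).lift
      ((IsLin.snd (S.L₀ X) (S.L₀ X ⊗ X)).comp (IsLin.snd (S.L₀ X) X)))
  have e : lift (S.tan 0 (fst (S.L₀ X) (S.L₀ X ⊗ X))) (snd _ _) ≫ (S.D (S.D f) ≫ S.flat Y) =
      lift (snd _ _ ≫ fst _ _) (lift (fst _ _) (snd _ _ ≫ snd _ _)) ≫
        lift (S.tan 0 (fst (S.L₀ X) (S.L₀ X ⊗ X))) (snd _ _) ≫ (S.D (S.D f) ≫ S.flat Y) := by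
    rw [← Category.assoc (lift _ (lift _ _)), comp_lift, comp_tan, lift_fst, lift_snd, comp_zero,
      ← S.cd7_tan, ← comp_lift, lift_fst_snd, Category.comp_id]
  have h := congrArg (fun k => tuple (fun i => S.pr (p i ≫ S.unflat X) (S.tan (q i) (w i)))
    (lift b (lift c d)) ≫ S.iter (n + 1) k) e
  rw [h₂.comp_iter, h₁.comp_iter, h₁.comp_iter, (IsLin.flat Y).iter_comp] at h
  simp only [comp_pr, comp_tan, comp_lift, comp_zero, ← Category.assoc] at h
  simp only [Category.assoc, lift_fst, lift_snd, unflat_flat, Category.comp_id, tan_split,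
    pr_split] at h
  simpa only [tan, Category.assoc, zero_comp, comp_zero, flat_unflat, Category.comp_id] using h

/-- Symmetry in the two innermost vectors: this is [CD.7], iterated over the remaining vectors. -/
lemma iter_swap (n : ℕ) (f : X ⟶ Y) (b c : Z ⟶ S.L₀ X) (a : Fin n → (Z ⟶ S.L₀ X)) (x : Z ⟶ X) :
    tuple (Fin.cons b (Fin.cons c a) : Fin (n + 2) → _) x ≫ S.iter (n + 2) f =
      tuple (Fin.cons c (Fin.cons b a) : Fin (n + 2) → _) x ≫ S.iter (n + 2) f := by
  rw [tuple_iter_succ, tuple_iter_succ]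
  cases n with
  | zero => exact S.cd7_tan f c b x
  | succ n =>
    rw [← Category.assoc, ← Category.assoc, tuple_iter_succ, tuple_iter_succ]
    congr 1
    have h := S.cd7_iter f n 0 0 a c b x
    simp only [Pi.zero_apply, tan_zero] at h
    exact h

/-- Iterated derivatives are symmetric. Adjacent transpositions generate the symmetric group; the
first one is `iter_swap`, the others are transpositions of vectors of `D f`. -/
lemma iter_perm (n : ℕ) (f : X ⟶ Y) (a : Fin n → (Z ⟶ S.L₀ X)) (x : Z ⟶ X)
    (e : Equiv.Perm (Fin n)) : tuple (a ∘ e) x ≫ S.iter n f = tuple a x ≫ S.iter n f := by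
  induction n generalizing X Y with
  | zero => exact congrArg (fun k => tuple k x ≫ S.iter 0 f) (funext fun i => i.elim0)
  | succ n ih =>
    have he : e ∈ Submonoid.closure
        (Set.range fun i : Fin n => Equiv.swap i.castSucc i.succ) := by
      rw [Equiv.Perm.mclosure_swap_castSucc_succ]
      trivial
    induction he using Submonoid.closure_induction generalizing a with
    | one => rfl
    | mul e e' _ _ h h' =>
      rw [Equiv.Perm.coe_mul, ← Function.comp_assoc, h', h]
    | mem e he =>
      obtain ⟨i, rfl⟩ := he
      cases n with
      | zero => exact i.elim0
      | succ n =>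
        -- The first transposition involves `a 0`, which is part of the point of `D f`; the others
        -- only permute the vectors of `D f`.
        refine Fin.cases ?_ (fun j => ?_) i
        · have := S.iter_swap n f (a 1) (a 0) (fun j => a j.succ.succ) x
          convert this using 3
          · funext k
            refine Fin.cases ?_ (fun k => Fin.cases ?_ (fun k => ?_) k) k
            · simp
            · simp
            · simp only [Function.comp_apply, Fin.cons_succ]
              rw [Equiv.swap_apply_of_ne_of_ne]
              · simp
              · exact fun h => by simpa using congrArg Fin.val h
          · funext k
            refine Fin.cases rfl (fun k => Fin.cases rfl (fun k => rfl) k) k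
        · rw [tuple_iter_succ, tuple_iter_succ, ← Category.assoc, ← Category.assoc]
          congr 1
          have := ih (S.D f) (fun i => S.tan 0 (a i.succ)) (lift (a 0) x)
            (Equiv.swap j.castSucc j.succ)
          convert this using 3
          · funext k
            simp only [Function.comp_apply, Fin.castSucc_succ, (Fin.succ_injective _).map_swap]
          · dsimp only [Function.comp_apply]
            rw [Fin.castSucc_succ, Equiv.swap_apply_of_ne_of_ne (Fin.succ_ne_zero _).symm
              (Fin.succ_ne_zero _).symm]

/-- Iterated derivatives are additive in each vector. For one vector this is [CD.2]; the vectors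
after the first are vectors of an iterated derivative of `D f`, and symmetry reduces the first one
to these. -/
lemma iter_add (n : ℕ) (f : X ⟶ Y) (a : Fin n → (Z ⟶ S.L₀ X)) (x : Z ⟶ X) (i : Fin n)
    (s t : Z ⟶ S.L₀ X) :
    tuple (Function.update a i (s + t)) x ≫ S.iter n f =
      tuple (Function.update a i s) x ≫ S.iter n f +
        tuple (Function.update a i t) x ≫ S.iter n f := by
  induction n using Nat.strong_induction_on generalizing X Y with
  | h n ih =>
    match n, ih, a, i with
    | 1, _, a, i =>
      obtain rfl : i = 0 := Subsingleton.elim _ _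
      simp only [tuple_iter_one, Function.update_self, S.cd2_add]
    | n + 2, ih, a, i =>
      have key : ∀ (a : Fin (n + 2) → (Z ⟶ S.L₀ X)) (i : Fin (n + 1)),
          tuple (Function.update a i.succ (s + t)) x ≫ S.iter (n + 2) f =
          tuple (Function.update a i.succ s) x ≫ S.iter (n + 2) f +
          tuple (Function.update a i.succ t) x ≫ S.iter (n + 2) f := by
        intro a i
        have h : ∀ s : Z ⟶ S.L₀ X, tuple (Function.update a i.succ s) x ≫ S.iter (n + 2) f =
            (tuple (Function.update (fun i => S.tan 0 (a i.succ)) i (S.tan 0 s)) (lift (a 0) x) ≫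
              S.iter (n + 1) (S.D f)) ≫ S.flat Y := by
          intro s
          rw [tuple_iter_succ, Category.assoc]
          congr 2
          funext j
          by_cases hj : j = i
          · subst hj; simp
          · simp [Function.update_of_ne hj, Function.update_of_ne
              (fun h => hj (Fin.succ_injective _ h))]
        rw [h, h, h, ← add_comp, ← ih (n + 1) (by omega), ← tan_add, add_zero]
      -- The vector `a 0`, which is part of the point of `D f`, is exchanged with `a 1`.
      refine Fin.cases ?_ (key a) i
      have h : ∀ s : Z ⟶ S.L₀ X, tuple (Function.update a 0 s) x ≫ S.iter (n + 2) f =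
          tuple (Function.update (a ∘ Equiv.swap 0 1) (Fin.succ 0) s) x ≫ S.iter (n + 2) f := by
        intro s
        rw [← S.iter_perm _ _ (Function.update a 0 s) x (Equiv.swap 0 1)]
        congr 2
        rw [Function.update_comp_equiv]
        simp
      rw [h, h, h]
      exact key _ _

lemma iter_zero (n : ℕ) (f : X ⟶ Y) (a : Fin n → (Z ⟶ S.L₀ X)) (x : Z ⟶ X) (i : Fin n) :
    tuple (Function.update a i 0) x ≫ S.iter n f = 0 := by
  induction n using Nat.strong_induction_on generalizing X Y with
  | h n ih =>
    match n, ih, a, i with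
    | 1, _, a, i =>
      obtain rfl : i = 0 := Subsingleton.elim _ _
      simp only [tuple_iter_one, Function.update_self, S.cd2_zero]
    | n + 2, ih, a, i =>
      have key : ∀ (a : Fin (n + 2) → (Z ⟶ S.L₀ X)) (i : Fin (n + 1)),
          tuple (Function.update a i.succ 0) x ≫ S.iter (n + 2) f = 0 := by
        intro a i
        rw [tuple_iter_succ]
        have := ih (n + 1) (by omega) (S.D f) (fun i => S.tan 0 (a i.succ)) (lift (a 0) x) i
        rw [← zero_comp (S.flat Y), ← this, Category.assoc]
        congr 2
        funext j
        by_cases hj : j = i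
        · subst hj; simp [tan_zero]
        · simp [Function.update_of_ne hj, Function.update_of_ne
            (fun h => hj (Fin.succ_injective _ h))]
      refine Fin.cases ?_ (key a) i
      rw [← S.iter_perm _ _ (Function.update a 0 0) x (Equiv.swap 0 1), Function.update_comp_equiv]
      exact key _ 0

/-- The decomposition of the first vector `(u 0, w 0)` as `(u 0, 0) + (0, w 0)`. -/
lemma tan_eq_update {n : ℕ} (u w : Fin (n + 1) → (Z ⟶ S.L₀ X)) :
    (fun i => S.tan (u i) (w i)) = Function.update (fun i => S.tan (u i) (w i)) 0
      (S.tan (u 0) 0 + S.tan 0 (w 0)) := by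
  rw [← tan_add, add_zero, zero_add, Function.update_eq_self]

/-- The derivative of an iterated derivative: the point is differentiated in the direction `a`, or
one of the vectors `w i` is replaced by its direction of change `u i`. -/
lemma iter_D (n : ℕ) (f : X ⟶ Y) (u w : Fin (n + 1) → (Z ⟶ S.L₀ X)) (a : Z ⟶ S.L₀ X) (x : Z ⟶ X) :
    tuple (fun i => S.tan (u i) (w i)) (lift a x) ≫ S.iter (n + 1) (S.D f) ≫ S.flat Y =
      tuple (Fin.cons a w : Fin (n + 2) → _) x ≫ S.iter (n + 2) f +
        ∑ i, tuple (Function.update w i (u i)) x ≫ S.iter (n + 1) f := by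
  induction n generalizing X Y with
  | zero =>
    rw [tan_eq_update, ← Category.assoc, iter_add, add_comp, Category.assoc, Category.assoc,
      add_comm, Fin.sum_univ_one]
    congr 1
    · rw [tuple_iter_succ]
      rfl
    · exact S.cd6_tan f _ _ _
  | succ n ih =>
    -- By additivity the first vector may be taken to be `(0, w 0)`, where [CD.7] exchanges `w 0`
    -- and `a` so that the induction hypothesis for `D f` applies, or `(u 0, 0)`, where [CD.6]
    -- applies.
    rw [tan_eq_update, ← Category.assoc, iter_add, add_comp, tuple_iter_succ, tuple_iter_succ,
      add_comm, Fin.sum_univ_succ]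
    refine Eq.trans ?_ ((add_right_comm _ _ _).trans (add_assoc _ _ _))
    congr 1
    · have h := S.cd7_iter f n 0 (fun i => u i.succ) (fun i => w i.succ) (w 0) a x
      simp only [Pi.zero_apply, tan_zero] at h
      simp only [Function.update_self, Function.update_of_ne (Fin.succ_ne_zero _)]
      rw [h, ih (S.D f) (fun i => S.tan 0 (u i.succ)) (fun i => S.tan 0 (w i.succ)), add_comp,
        sum_comp, Category.assoc]
      congr 1
      · have e : w = Fin.cons (w 0) fun i => w i.succ := (Fin.cons_self_tail w).symm
        rw [e, iter_swap, tuple_iter_succ]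
        congr 2
        funext i
        refine Fin.cases rfl (fun i => rfl) i
      · refine Finset.sum_congr rfl fun i _ => ?_
        rw [tuple_iter_succ, Category.assoc]
        congr 2
        funext j
        by_cases hj : j = i
        · subst hj; simp
        · simp [Function.update_of_ne hj, Function.update_of_ne
              (fun h => hj (Fin.succ_injective _ h))]
    · have h := S.cd6_iter f n 0 (fun i => u i.succ) (fun i => w i.succ) (u 0) a x
      simp only [Pi.zero_apply, tan_zero] at h
      simp only [Function.update_self, Function.update_of_ne (Fin.succ_ne_zero _)]
      rw [h, tuple_iter_succ, Category.assoc]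
      congr 2

/-- The morphism of `Faa C` consisting of `f` and its iterated derivatives. -/
noncomputable def jet (f : X ⟶ Y) : FaaHom (⟨S.L X, X⟩ : Faa C) ⟨S.L Y, Y⟩ where
  pt := f
  app n := S.iter n f
  map_add n _ a x i s t := S.iter_add n f a x i s t
  map_zero n _ a x i := S.iter_zero n f a x i
  map_perm n _ a x e := S.iter_perm n f a x e

end GCDStr

end

/-! ### Derivatives of morphisms of `Faa C` -/

section

variable {C : Type u} [Category.{v} C] [CartesianMonoidalCategory C]

namespace FaaHom

variable {A B D' : Faa C}

/-- The equivalence relation on `Option ι` obtained from `r` by adding `none` as a block of its own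
if `o = none`, or to the block `q` if `o = some q`. -/
def extend {ι : Type*} (r : Setoid ι) (o : Option (Quotient r)) : Setoid (Option ι) :=
  Setoid.ker fun i => i.elim o fun j => some (Quotient.mk r j)

lemma extend_apply {ι : Type*} (r : Setoid ι) (o : Option (Quotient r)) (i j : Option ι) :
    extend r o i j ↔ i.elim o (fun j => some (Quotient.mk r j)) =
      j.elim o (fun j => some (Quotient.mk r j)) := Iff.rfl

/-- An equivalence relation on `Option ι` is an equivalence relation on `ι` together with the place
of `none`. -/
lemma extend_bijective (ι : Type*) : Function.Bijective
    (fun p : (r : Setoid ι) × Option (Quotient r) => extend p.1 p.2) := by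
  constructor
  · rintro ⟨r, o⟩ ⟨r', o'⟩ h
    dsimp only at h
    have key : ∀ i j, extend r o i j ↔ extend r' o' i j := fun i j => by rw [h]
    obtain rfl : r = r' := by
      ext i j
      have := key (some i) (some j)
      simp only [extend_apply, Option.elim, Option.some.injEq] at this
      exact Quotient.eq.symm.trans (this.trans Quotient.eq)
    congr 1
    have hq : ∀ q, o = some q ↔ o' = some q := by
      intro q
      obtain ⟨i, rfl⟩ := q.exists_rep
      exact key none (some i)
    cases o with
    | none =>
      cases o' with
      | none => rfl
      | some q => exact (hq q).2 rfl
    | some q => exact ((hq q).1 rfl).symm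
  · intro t
    by_cases h : ∃ j, t none (some j)
    · obtain ⟨j, hj⟩ := h
      refine ⟨⟨t.comap some, some (Quotient.mk _ j)⟩, ?_⟩
      ext a b
      simp only [extend_apply]
      cases a with
      | none =>
        cases b with
        | none => exact ⟨fun _ => t.refl _, fun _ => rfl⟩
        | some b =>
          simp only [Option.elim, Option.some.injEq, Quotient.eq, Setoid.comap_rel]
          exact ⟨fun h => t.trans hj h, fun h => t.trans (t.symm hj) h⟩
      | some a =>
        cases b with
        | none =>
          simp only [Option.elim, Option.some.injEq, Quotient.eq, Setoid.comap_rel]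
          exact ⟨fun h => t.trans h (t.symm hj), fun h => t.trans h hj⟩
        | some b =>
          simp only [Option.elim, Option.some.injEq, Quotient.eq, Setoid.comap_rel]
    · refine ⟨⟨t.comap some, none⟩, ?_⟩
      ext a b
      simp only [extend_apply]
      cases a with
      | none =>
        cases b with
        | none => exact ⟨fun _ => t.refl _, fun _ => rfl⟩
        | some b =>
          simp only [Option.elim]
          exact ⟨fun h => (nomatch h), fun h' => (h ⟨b, h'⟩).elim⟩
      | some a =>
        cases b with
        | none =>
          simp only [Option.elim]
          exact ⟨fun h => (nomatch h), fun h' => (h ⟨a, t.symm h'⟩).elim⟩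
        | some b =>
          simp only [Option.elim, Option.some.injEq, Quotient.eq, Setoid.comap_rel]

/-- The summand of the Faà di Bruno formula for the fibres of a surjection. -/
lemma term_ker (f : FaaHom A B) (g : FaaHom B D') {ι κ : Type*} [Finite ι] [Nonempty ι] [Finite κ]
    [Nonempty κ] {Z : C} (a : ι → (Z ⟶ A.V.X)) (x : Z ⟶ A.P) (φ : ι → κ)
    [∀ k, Nonempty {i // φ i = k}] :
    f.term g a x (Setoid.ker φ) =
      g.eval (fun k => f.eval (fun i : {i // φ i = k} => a i) x) (x ≫ f.pt) := by
  have hφ : Function.Surjective φ := fun k =>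
    let ⟨i, hi⟩ := (inferInstance : Nonempty {i // φ i = k})
    ⟨i, hi⟩
  unfold term
  rw [← g.eval_equiv _ _ (Setoid.quotientKerEquivOfSurjective φ hφ)]
  congr 1
  funext q
  induction q using Quotient.inductionOn with
  | h i =>
    exact f.eval_equiv (ι := {j // φ j = φ i}) (κ := Block (Setoid.ker φ) (Quotient.mk _ i))
      (fun i => a i) x (Equiv.subtypeEquivRight fun j => Quotient.eq)

open Classical in
/-- The derivative of `f.eval` at vectors `w i` and a point `x`, in the direction `u i` for the
vectors and `a` for the point. -/
noncomputable def dval (f : FaaHom A B) {ι : Type*} [Finite ι] [Nonempty ι] {Z : C}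
    (u w : ι → (Z ⟶ A.V.X)) (a : Z ⟶ A.V.X) (x : Z ⟶ A.P) : Z ⟶ B.V.X :=
  letI := Fintype.ofFinite ι
  f.eval (fun o : Option ι => o.elim a w) x + ∑ i, f.eval (Function.update w i (u i)) x

lemma dval_eq (f : FaaHom A B) {ι : Type*} [Fintype ι] [DecidableEq ι] [Nonempty ι] {Z : C}
    (u w : ι → (Z ⟶ A.V.X)) (a : Z ⟶ A.V.X) (x : Z ⟶ A.P) :
    f.dval u w a x =
      f.eval (fun o : Option ι => o.elim a w) x + ∑ i, f.eval (Function.update w i (u i)) x := by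
  unfold dval
  congr!

lemma comp_dval (f : FaaHom A B) {ι : Type*} [Finite ι] [Nonempty ι] {Z W : C}
    (h : W ⟶ Z) (u w : ι → (Z ⟶ A.V.X)) (a : Z ⟶ A.V.X) (x : Z ⟶ A.P) :
    h ≫ f.dval u w a x = f.dval (fun i => h ≫ u i) (fun i => h ≫ w i) (h ≫ a) (h ≫ x) := by
  classical
  have := Fintype.ofFinite ι
  rw [dval_eq, dval_eq, comp_add, comp_sum, comp_eval]
  congr 1
  · congr 1
    funext o
    cases o <;> rfl
  · refine Finset.sum_congr rfl fun i _ => ?_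
    rw [comp_eval]
    congr 1
    funext j
    by_cases hj : j = i
    · subst hj; simp
    · simp [Function.update_of_ne hj]

lemma dval_equiv (f : FaaHom A B) {ι κ : Type*} [Finite ι] [Nonempty ι]
    [Finite κ] [Nonempty κ] {Z : C}
    (u w : ι → (Z ⟶ A.V.X)) (a : Z ⟶ A.V.X) (x : Z ⟶ A.P) (e : κ ≃ ι) :
    f.dval (u ∘ e) (w ∘ e) a x = f.dval u w a x := by
  classical
  have := Fintype.ofFinite ι
  have := Fintype.ofFinite κ
  rw [dval_eq, dval_eq]
  congr 1
  · rw [← f.eval_equiv _ x (Equiv.optionCongr e)]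
    congr 1
    funext o
    cases o <;> rfl
  · refine Fintype.sum_equiv e _ _ fun i => ?_
    rw [← f.eval_equiv _ x e, Function.update_comp_equiv]
    simp

lemma dval_zero (f : FaaHom A B) {ι : Type*} [Finite ι] [Nonempty ι] {Z : C}
    (w : ι → (Z ⟶ A.V.X)) (a : Z ⟶ A.V.X) (x : Z ⟶ A.P) :
    f.dval (fun _ => 0) w a x = f.eval (fun o : Option ι => o.elim a w) x := by
  classical
  have := Fintype.ofFinite ι
  rw [dval_eq, Finset.sum_eq_zero fun i _ => f.eval_zero w x i, add_zero]

/-- The Faà di Bruno formula with one more vector: this vector is used to differentiate the outer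
morphism, or one of the inner ones. -/
lemma compVal_option (f : FaaHom A B) (g : FaaHom B D') {ι : Type*} [Finite ι] [Nonempty ι] {Z : C}
    (w : ι → (Z ⟶ A.V.X)) (a : Z ⟶ A.V.X) (x : Z ⟶ A.P) :
    f.compVal g (fun o : Option ι => o.elim a w) x =
      ∑ r : Setoid ι, g.dval
        (fun q : Quotient r => f.eval (fun o : Option (Block r q) => o.elim a fun i => w i) x)
        (fun q => f.eval (fun i : Block r q => w i) x) (f.eval (fun _ : Unit => a) x)
        (x ≫ f.pt) := by
  classical
  have (r : Setoid ι) : Fintype (Quotient r) := Fintype.ofFinite _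
  unfold compVal
  rw [← (extend_bijective ι).sum_comp, Fintype.sum_sigma]
  refine Finset.sum_congr rfl fun r _ => ?_
  rw [Fintype.sum_option]
  rw [dval_eq]
  congr 1
  · unfold extend
    have h₁ : ∀ q : Option (Quotient r), Nonempty
        {i : Option ι // i.elim none (fun j => some (Quotient.mk r j)) = q} := by
      rintro (_ | q)
      · exact ⟨⟨none, rfl⟩⟩
      · obtain ⟨i, rfl⟩ := q.exists_rep
        exact ⟨⟨some i, rfl⟩⟩
    rw [term_ker]
    congr 1
    funext q
    cases q with
    | none =>
      exact (f.eval_equiv (ι := Unit) (fun _ => a) x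
        (κ := {i : Option ι // i.elim none (fun j => some (Quotient.mk r j)) = none})
        { toFun := fun _ => ()
          invFun := fun _ => ⟨none, rfl⟩
          left_inv := by
            rintro ⟨_ | i, h⟩
            · rfl
            · exact nomatch h
          right_inv := fun _ => rfl } ▸ by
            congr 1
            funext i
            obtain ⟨_ | i, h⟩ := i
            · rfl
            · exact nomatch h)
    | some q =>
      refine (f.eval_equiv (κ := Block r q)
        (ι := {i : Option ι // i.elim none (fun j => some (Quotient.mk r j)) = some q}) _ x
        { toFun := fun i => ⟨some i.1, congrArg some i.2⟩
          invFun := fun i => match i with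
            | ⟨some i, h⟩ => ⟨i, Option.some.inj h⟩
          left_inv := fun _ => rfl
          right_inv := by
            rintro ⟨_ | i, h⟩
            · exact nomatch h
            · rfl }).symm
  · refine Finset.sum_congr rfl fun q₀ _ => ?_
    have hker : extend r (some q₀) = Setoid.ker
        (fun i : Option ι => i.elim q₀ fun j => Quotient.mk r j) := by
      ext i j
      unfold extend
      simp only [Setoid.ker_def]
      cases i <;> cases j <;> simp
    have h₁ : ∀ q : Quotient r, Nonempty
        {i : Option ι // i.elim q₀ (fun j => Quotient.mk r j) = q} := by
      intro q
      obtain ⟨i, rfl⟩ := q.exists_rep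
      exact ⟨⟨some i, rfl⟩⟩
    rw [hker, term_ker]
    congr 1
    funext q
    by_cases hq : q = q₀
    · subst hq
      rw [Function.update_self]
      refine (f.eval_equiv (κ := Option (Block r q))
        (ι := {i : Option ι // i.elim q (fun j => Quotient.mk r j) = q}) _ x
        { toFun := fun i => i.elim ⟨none, rfl⟩ fun i => ⟨some i.1, i.2⟩
          invFun := fun i => match i with
            | ⟨some i, h⟩ => some ⟨i, h⟩
            | ⟨none, _⟩ => none
          left_inv := by rintro (_ | i) <;> rfl
          right_inv := by rintro ⟨_ | i, h⟩ <;> rfl }).symm.trans ?_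
      congr 1
      funext i
      cases i <;> rfl
    · rw [Function.update_of_ne hq]
      refine (f.eval_equiv (κ := Block r q)
        (ι := {i : Option ι // i.elim q₀ (fun j => Quotient.mk r j) = q}) _ x
        { toFun := fun i => ⟨some i.1, i.2⟩
          invFun := fun i => match i with
            | ⟨some i, h⟩ => ⟨i, h⟩
            | ⟨none, h⟩ => (hq h.symm).elim
          left_inv := fun _ => rfl
          right_inv := by
            rintro ⟨_ | i, h⟩
            · exact (hq h.symm).elim
            · rfl }).symm

/-! ### The derivative as a morphism of `Faa C` -/

lemma eval_unique (f : FaaHom A B) {ι : Type*} [Finite ι] [Nonempty ι] [Subsingleton ι] {Z : C}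
    (a : ι → (Z ⟶ A.V.X)) (x : Z ⟶ A.P) (i : ι) : f.eval a x = lift (a i) x ≫ f.app 1 := by
  have := Fintype.ofFinite ι
  rw [f.eval_eq a x (n := 1) (Fintype.equivFinOfCardEq
    ((Fintype.card_eq_one_iff).2 ⟨i, fun j => Subsingleton.elim _ _⟩))]
  exact congrArg (fun j => lift (a j) x ≫ f.app 1) (Subsingleton.elim _ _)

lemma app_one_eq (f : FaaHom A B) {Z : C} (a : Z ⟶ A.V.X) (x : Z ⟶ A.P) :
    lift a x ≫ f.app 1 = f.eval (fun _ : Unit => a) x :=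
  (f.eval_unique (fun _ : Unit => a) x ()).symm

lemma dval_add (f : FaaHom A B) {ι : Type*} [Finite ι] [Nonempty ι] {Z : C}
    (u u' w : ι → (Z ⟶ A.V.X)) (a a' : Z ⟶ A.V.X) (x : Z ⟶ A.P) :
    f.dval (fun i => u i + u' i) w (a + a') x = f.dval u w a x + f.dval u' w a' x := by
  classical
  have := Fintype.ofFinite ι
  simp only [dval_eq, eval_add, Finset.sum_add_distrib]
  have h : ∀ a : Z ⟶ A.V.X, (fun o : Option ι => o.elim a w) =
      Function.update (fun o : Option ι => o.elim a w) none a := fun a => by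
    conv_lhs => rw [← Function.update_eq_self none (fun o : Option ι => o.elim a w)]
    rfl
  have h' : ∀ a a' : Z ⟶ A.V.X, Function.update (fun o : Option ι => o.elim a w) none a' =
      fun o : Option ι => o.elim a' w := fun a a' => by
    funext o
    cases o <;> simp
  rw [h (a + a'), eval_add, h' _ a, h' _ a']
  abel

lemma dval_zero_zero (f : FaaHom A B) {ι : Type*} [Finite ι] [Nonempty ι] {Z : C}
    (w : ι → (Z ⟶ A.V.X)) (x : Z ⟶ A.P) : f.dval (fun _ => 0) w 0 x = 0 := by
  classical
  rw [dval_zero]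
  exact f.eval_zero' _ _ none rfl

/-- The chain rule for derivatives of composites in `Faa C`. -/
lemma dval_comp (f : FaaHom A B) (g : FaaHom B D') {ι : Type*} [Finite ι] [Nonempty ι] {Z : C}
    (u w : ι → (Z ⟶ A.V.X)) (a : Z ⟶ A.V.X) (x : Z ⟶ A.P) :
    (f.comp g).dval u w a x =
      ∑ r : Setoid ι, g.dval
        (fun q : Quotient r => f.dval (fun i : Block r q => u i) (fun i => w i) a x)
        (fun q => f.eval (fun i : Block r q => w i) x) (f.eval (fun _ : Unit => a) x)
        (x ≫ f.pt) := by
  classical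
  have := Fintype.ofFinite ι
  have (r : Setoid ι) : Fintype (Quotient r) := Fintype.ofFinite _
  have (r : Setoid ι) (q : Quotient r) : Fintype (Block r q) := Fintype.ofFinite _
  simp only [dval_eq (f.comp g), eval_comp]
  rw [compVal_option]
  unfold compVal
  rw [Finset.sum_comm, ← Finset.sum_add_distrib]
  refine Finset.sum_congr rfl fun r _ => ?_
  simp only [dval_eq, eval_add, Finset.sum_add_distrib]
  rw [add_assoc]
  congr 2
  rw [← (Equiv.sigmaFiberEquiv (Quotient.mk r)).sum_comp, Fintype.sum_sigma]
  refine Finset.sum_congr rfl fun q _ => ?_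
  refine Eq.trans ?_ ((g.evalMulti (Quotient r) (x ≫ f.pt)).map_update_sum Finset.univ q _ _).symm
  refine Finset.sum_congr rfl fun i _ => ?_
  obtain ⟨i, rfl⟩ := i
  exact term_update f g w x i (u i) r

lemma option_elim_update {ι V : Type*} [DecidableEq ι] (a : V) (w : ι → V) (i : ι) (s : V) :
    (fun o : Option ι => o.elim a (Function.update w i s)) =
      Function.update (fun o : Option ι => o.elim a w) (some i) s := by
  funext o
  cases o with
  | none => rfl
  | some j =>
    by_cases hj : j = i
    · subst hj; simp
    · simp [Function.update_of_ne hj, Function.update_of_ne (fun h => hj (Option.some.inj h))]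

lemma dval_update_add (f : FaaHom A B) {ι : Type*} [Finite ι] [Nonempty ι] [DecidableEq ι] {Z : C}
    (u w : ι → (Z ⟶ A.V.X)) (a : Z ⟶ A.V.X) (x : Z ⟶ A.P) (i : ι) (s t s' t' : Z ⟶ A.V.X) :
    f.dval (Function.update u i (s + t)) (Function.update w i (s' + t')) a x =
      f.dval (Function.update u i s) (Function.update w i s') a x +
        f.dval (Function.update u i t) (Function.update w i t') a x := by
  have := Fintype.ofFinite ι
  simp only [dval_eq]
  rw [option_elim_update, eval_add, ← option_elim_update, ← option_elim_update,
    add_add_add_comm, ← Finset.sum_add_distrib]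
  congr 1
  refine Finset.sum_congr rfl fun j _ => ?_
  by_cases hj : j = i
  · subst hj
    simp only [Function.update_idem, Function.update_self, eval_add]
  · simp only [Function.update_of_ne hj, Function.update_comm (Ne.symm hj), eval_add]

lemma dval_update_zero (f : FaaHom A B) {ι : Type*} [Finite ι] [Nonempty ι] [DecidableEq ι] {Z : C}
    (u w : ι → (Z ⟶ A.V.X)) (a : Z ⟶ A.V.X) (x : Z ⟶ A.P) (i : ι) :
    f.dval (Function.update u i 0) (Function.update w i 0) a x = 0 := by
  have := Fintype.ofFinite ι
  rw [dval_eq, option_elim_update, eval_zero, zero_add]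
  refine Finset.sum_eq_zero fun j _ => ?_
  by_cases hj : j = i
  · subst hj
    simp only [Function.update_idem, Function.update_self, eval_zero]
  · simp only [Function.update_of_ne hj, Function.update_comm (Ne.symm hj), eval_zero]

lemma update_comp_eq {ι V W : Type*} [DecidableEq ι] (d : ι → V) (i : ι) (s : V) (k : V → W) :
    (fun j => k (Function.update d i s j)) = Function.update (fun j => k (d j)) i (k s) :=
  Function.comp_update k d i s

/-- The formal derivative of a morphism `f` of `Faa C`. Its point component is `f.app 1`, a map of a
vector and a point; its components of higher degree are the derivatives `FaaHom.dval` of those of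
`f`, where the vectors of the source are pairs of a direction and a vector. -/
noncomputable def deriv (f : FaaHom A B) : FaaHom ((diag A.V).prod A) (diag B.V) where
  pt := f.app 1
  app n := f.dval (fun i : Fin n => proj _ _ i ≫ fst A.V.X A.V.X) (fun i => proj _ _ i ≫ snd _ _)
    (base _ _ n ≫ fst A.V.X A.P) (base _ _ n ≫ snd _ _)
  map_add n Z d x i s t := by
    simp only [comp_dval, tuple_proj_assoc, tuple_base_assoc]
    simp only [update_comp_eq _ _ _ fun s => s ≫ fst A.V.X A.V.X,
      update_comp_eq _ _ _ fun s => s ≫ snd A.V.X A.V.X, add_comp]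
    exact f.dval_update_add _ _ _ _ i _ _ _ _
  map_zero n Z d x i := by
    simp only [comp_dval, tuple_proj_assoc, tuple_base_assoc]
    simp only [update_comp_eq _ _ _ fun s => s ≫ fst A.V.X A.V.X,
      update_comp_eq _ _ _ fun s => s ≫ snd A.V.X A.V.X, zero_comp]
    exact f.dval_update_zero _ _ _ _ i
  map_perm n Z d x e := by
    simp only [comp_dval, tuple_proj_assoc, tuple_base_assoc]
    exact f.dval_equiv (fun j => d j ≫ fst A.V.X A.V.X) (fun j => d j ≫ snd A.V.X A.V.X) _ _ e

lemma deriv_eval (f : FaaHom A B) {ι : Type*} [Finite ι] [Nonempty ι] {Z : C}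
    (d : ι → (Z ⟶ A.V.X ⊗ A.V.X)) (x : Z ⟶ A.V.X ⊗ A.P) :
    f.deriv.eval d x = f.dval (fun i => d i ≫ fst _ _) (fun i => d i ≫ snd _ _) (x ≫ fst _ _)
      (x ≫ snd _ _) := by
  unfold eval deriv
  simp only [comp_dval, tuple_proj_assoc, tuple_base_assoc]
  exact f.dval_equiv (fun i => d i ≫ fst _ _) (fun i => d i ≫ snd _ _) _ _ (enum ι).symm

/-- The derivative of a morphism without components of degree at least two is its component of
degree one, applied to the direction. This gives [CD.1] and [CD.3] in `Faa C`. -/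
lemma lin_deriv (p : A.P ⟶ B.P) (u : A.V.X ⟶ B.V.X) [IsAddMonHom u] :
    (lin p u : FaaHom A B).deriv = (Faa.fst' (diag A.V) A).comp (lin (B := diag B.V) u u) := by
  classical
  refine ext_eval rfl fun n Z d x => ?_
  rw [deriv_eval, dval_eq, lin_eval_nontrivial, zero_add, comp_lin_eval]
  unfold Faa.fst'
  cases subsingleton_or_nontrivial (Fin n) with
  | inl h =>
    obtain ⟨i⟩ : Nonempty (Fin n) := inferInstance
    rw [Fintype.sum_subsingleton _ i, lin_eval_subsingleton _ _ _ _ i,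
      lin_eval_subsingleton _ _ _ _ i, Function.update_self]
  | inr h =>
    rw [lin_eval_nontrivial, zero_comp]
    exact Finset.sum_eq_zero fun i _ => lin_eval_nontrivial _ _ _ _

lemma lift'_eval {Z' : Faa C} (f : FaaHom Z' A) (g : FaaHom Z' B) {ι : Type*}
    [Finite ι] [Nonempty ι]
    {Z : C} (a : ι → (Z ⟶ Z'.V.X)) (x : Z ⟶ Z'.P) :
    FaaHom.eval (Faa.lift' f g) a x = lift (f.eval a x) (g.eval a x) := comp_lift _ _ _

lemma lift_sum {Z : C} {A B : CMon C} {ι : Type*} (s : Finset ι)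
    (f : ι → (Z ⟶ A.X)) (g : ι → (Z ⟶ B.X)) :
    lift (∑ i ∈ s, f i) (∑ i ∈ s, g i) = ∑ i ∈ s, lift (f i) (g i) := by
  classical
  induction s using Finset.induction_on with
  | empty => exact lift_zero
  | insert i s hi ih => rw [Finset.sum_insert hi, Finset.sum_insert hi, Finset.sum_insert hi,
      lift_add, ih]

lemma lift'_deriv {Z' : Faa C} (f : FaaHom Z' A) (g : FaaHom Z' B) :
    FaaHom.deriv (Faa.lift' f g) = Faa.lift' (A := diag A.V) (B := diag B.V) f.deriv g.deriv := by
  refine ext_eval rfl fun n Z d x => ?_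
  simp only [lift'_eval, deriv_eval]
  rw [dval_eq, dval_eq, dval_eq, lift_add, lift_sum]
  simp only [lift'_eval]

/-- The value of the derivative of a composite with first component `lift a c`. -/
lemma lift'_comp_deriv_eval {Z' : Faa C} (f : FaaHom A B) (a : FaaHom Z' (diag A.V))
    (c : FaaHom Z' A) {ι : Type*} [Finite ι] [Nonempty ι] {Z : C} (v : ι → (Z ⟶ Z'.V.X))
    (z : Z ⟶ Z'.P) :
    ((Faa.lift' a c : FaaHom Z' ((diag A.V).prod A)).comp f.deriv).eval v z =
      ∑ r : Setoid ι, f.dval (fun q : Quotient r => a.eval (fun i : Block r q => v i) z)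
        (fun q => c.eval (fun i : Block r q => v i) z) (z ≫ a.pt) (z ≫ c.pt) := by
  rw [eval_comp]
  refine Finset.sum_congr rfl fun r _ => ?_
  unfold term
  rw [deriv_eval]
  simp only [lift'_eval, lift_fst, lift_snd]
  congr 1
  · change (z ≫ lift a.pt c.pt) ≫ _ = _
    simp
  · change (z ≫ lift a.pt c.pt) ≫ _ = _
    simp

lemma comp_app_one (f : FaaHom A B) (g : FaaHom B D') :
    (f.comp g).app 1 = lift (f.app 1) (snd A.V.X A.P ≫ f.pt) ≫ g.app 1 := by
  have : Subsingleton (Setoid (Fin ((1 : ℕ+) : ℕ))) :=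
    ⟨fun r s => by
      ext i j
      obtain rfl : i = j := Subsingleton.elim (α := Fin 1) _ _
      exact ⟨fun _ => s.refl _, fun _ => r.refl _⟩⟩
  have h1 : Subsingleton (Fin ((1 : ℕ+) : ℕ)) := inferInstanceAs (Subsingleton (Fin 1))
  let i : Fin ((1 : ℕ+) : ℕ) := ⟨0, Nat.one_pos⟩
  change ∑ r : Setoid (Fin ((1 : ℕ+) : ℕ)), _ = _
  rw [Fintype.sum_subsingleton _ (⊤ : Setoid (Fin ((1 : ℕ+) : ℕ)))]
  unfold term
  rw [eval_unique _ _ _ (Quotient.mk _ i), eval_unique _ _ _ ⟨i, rfl⟩]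
  change lift (lift (fst _ _) (snd _ _ ≫ 𝟙 _) ≫ _) ((snd _ _ ≫ 𝟙 _) ≫ _) ≫ _ = _
  simp only [Category.comp_id, lift_fst_snd]
  exact congrArg (fun k => lift k _ ≫ g.app 1) (Category.id_comp (f.app 1))

/-- The chain rule [CD.5] for morphisms of `Faa C`. -/
lemma comp_deriv (f : FaaHom A B) (g : FaaHom B D') :
    (f.comp g).deriv = (Faa.lift' (A := diag B.V) (B := B) f.deriv
      ((Faa.snd' (diag A.V) A).comp f)).comp g.deriv := by
  refine ext_eval (comp_app_one f g) fun n Z d x => ?_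
  rw [deriv_eval, dval_comp, lift'_comp_deriv_eval]
  refine Finset.sum_congr rfl fun r _ => ?_
  simp only [deriv_eval]
  unfold Faa.snd'
  simp only [lin_comp_eval]
  congr 1
  · rw [← app_one_eq, ← comp_lift]
    simp [deriv]
  · rw [Category.assoc]
    rfl

lemma deriv_dval (f : FaaHom A B) {ι : Type*} [Fintype ι] [Nonempty ι] [DecidableEq ι] {Z : C}
    (u u' w w' : ι → (Z ⟶ A.V.X)) (a a' c : Z ⟶ A.V.X) (d : Z ⟶ A.P) :
    f.deriv.dval (fun i => lift (u i) (u' i)) (fun i => lift (w i) (w' i)) (lift a a') (lift c d) =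
      f.dval (fun o : Option ι => o.elim a w) (fun o => o.elim a' w') c d +
        ∑ j, f.dval (Function.update w j (u j)) (Function.update w' j (u' j)) c d := by
  rw [dval_eq, deriv_eval]
  simp only [deriv_eval, lift_fst, lift_snd]
  congr 1
  · congr 1 <;> funext o <;> cases o <;> simp
  · refine Finset.sum_congr rfl fun j _ => ?_
    simp only [update_comp_eq _ _ _ fun s => s ≫ fst A.V.X A.V.X,
      update_comp_eq _ _ _ fun s => s ≫ snd A.V.X A.V.X, lift_fst, lift_snd]

/-- [CD.6] for the components of higher degree. -/
lemma deriv_dval_left (f : FaaHom A B) {ι : Type*} [Finite ι] [Nonempty ι] {Z : C}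
    (u w v : ι → (Z ⟶ A.V.X)) (a c : Z ⟶ A.V.X) (d : Z ⟶ A.P) :
    f.deriv.dval (fun i => lift (u i) 0) (fun i => lift (v i) (w i)) (lift a 0) (lift c d) =
      f.dval u w a d := by
  classical
  have := Fintype.ofFinite ι
  rw [deriv_dval]
  simp only [dval_eq]
  congr 1
  · rw [f.eval_zero' _ _ (some none) rfl, zero_add, Fintype.sum_option,
      Finset.sum_eq_zero fun i _ => f.eval_zero' _ _ none (by simp), add_zero]
    congr 1
    funext o
    cases o <;> simp
  · refine Finset.sum_congr rfl fun i _ => ?_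
    rw [f.eval_zero' _ _ (some i) (by simp), zero_add, Finset.sum_eq_single i]
    · simp
    · intro j _ hj
      exact f.eval_zero' _ _ i (by simp [Function.update_of_ne hj.symm])
    · simp

/-- The second derivative in directions for which [CD.7] is stated: two vectors `b` and `c`, and for
each `i` two directions `u i` and `v i` for the vector `w i`. Each of the three contributions is
symmetric under the exchange of `b, u` with `c, v`. -/
lemma deriv_dval_right (f : FaaHom A B) {ι : Type*} [Fintype ι] [Nonempty ι] [DecidableEq ι] {Z : C}
    (u w v : ι → (Z ⟶ A.V.X)) (b c : Z ⟶ A.V.X) (d : Z ⟶ A.P) :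
    f.deriv.dval (fun i => lift 0 (u i)) (fun i => lift (v i) (w i)) (lift 0 b) (lift c d) =
      f.eval (fun o : Option (Option ι) => o.elim c fun o => o.elim b w) d +
        (∑ i, f.eval (fun o : Option ι => o.elim b (Function.update w i (v i))) d +
        ∑ i, f.eval (fun o : Option ι => o.elim c (Function.update w i (u i))) d) +
        ∑ i, ∑ j, if j = i then 0 else
          f.eval (Function.update (Function.update w i (u i)) j (v j)) d := by
  rw [deriv_dval]
  simp only [dval_eq]
  have h0 : f.eval (Function.update (fun o : Option ι => o.elim b w) none
    ((none : Option ι).elim 0 v)) d = 0 := f.eval_zero _ d none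
  rw [Finset.sum_add_distrib, Fintype.sum_option, h0, zero_add]
  simp only [add_assoc]
  refine congrArg₂ (· + ·) rfl (congrArg₂ (· + ·) ?_ (congrArg₂ (· + ·) rfl ?_))
  · refine Finset.sum_congr rfl fun i _ => ?_
    congr 1
    funext o
    cases o with
    | none => simp
    | some j => by_cases hj : j = i <;> simp [Function.update_apply, hj]
  · refine Finset.sum_congr rfl fun i _ => Finset.sum_congr rfl fun j _ => ?_
    split_ifs with h
    · subst h
      exact f.eval_zero' _ _ j (by simp)
    · simp [Function.update_of_ne h]

/-- [CD.7] for the components of higher degree. -/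
lemma deriv_dval_symm (f : FaaHom A B) {ι : Type*} [Finite ι] [Nonempty ι] {Z : C}
    (u w v : ι → (Z ⟶ A.V.X)) (b c : Z ⟶ A.V.X) (d : Z ⟶ A.P) :
    f.deriv.dval (fun i => lift 0 (u i)) (fun i => lift (v i) (w i)) (lift 0 b) (lift c d) =
      f.deriv.dval (fun i => lift 0 (v i)) (fun i => lift (u i) (w i)) (lift 0 c) (lift b d) := by
  classical
  have := Fintype.ofFinite ι
  rw [deriv_dval_right, deriv_dval_right, Finset.sum_comm]
  congr 1
  · rw [add_comm (∑ i, _)]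
    congr 1
    rw [← f.eval_equiv _ d (Equiv.swap none (some none))]
    congr 1
    funext o
    obtain _ | _ | i := o
    · simp
    · simp
    · rw [Function.comp_apply, Equiv.swap_apply_of_ne_of_ne (by simp) (by simp)]
      rfl
  · refine Finset.sum_congr rfl fun i _ => Finset.sum_congr rfl fun j _ => ?_
    by_cases h : i = j
    · simp [h]
    · rw [if_neg h, if_neg (Ne.symm h), Function.update_comm (Ne.symm h)]

lemma app_one_add (f : FaaHom A B) {Z : C} (s t : Z ⟶ A.V.X) (x : Z ⟶ A.P) :
    lift (s + t) x ≫ f.app 1 = lift s x ≫ f.app 1 + lift t x ≫ f.app 1 :=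
  f.map_add 1 (fun _ => s) x 0 s t

lemma app_one_zero (f : FaaHom A B) {Z : C} (x : Z ⟶ A.P) :
    lift 0 x ≫ f.app 1 = 0 :=
  f.map_zero 1 (fun _ => 0) x 0

lemma deriv_app_one (f : FaaHom A B) {Z : C} (u w a : Z ⟶ A.V.X) (x : Z ⟶ A.P) :
    lift (lift u w) (lift a x) ≫ f.deriv.app 1 =
      f.dval (fun _ : Unit => u) (fun _ : Unit => w) a x := by
  refine (f.deriv.app_one_eq _ _).trans ?_
  rw [deriv_eval]
  simp

/-- [CD.6] on points. -/
lemma deriv_app_one_left (f : FaaHom A B) {Z : C} (a c : Z ⟶ A.V.X) (d : Z ⟶ A.P) :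
    lift (lift a 0) (lift c d) ≫ f.deriv.app 1 = lift a d ≫ f.app 1 := by
  refine (f.deriv_app_one _ _ _ _).trans ?_
  rw [app_one_eq, dval_eq, f.eval_zero' _ _ (some ()) rfl, zero_add,
    Fintype.sum_unique]
  congr 1

/-- [CD.7] on points. -/
lemma deriv_app_one_symm (f : FaaHom A B) {Z : C} (b c : Z ⟶ A.V.X) (d : Z ⟶ A.P) :
    lift (lift 0 b) (lift c d) ≫ f.deriv.app 1 = lift (lift 0 c) (lift b d) ≫ f.deriv.app 1 := by
  refine (f.deriv_app_one _ _ _ _).trans (Eq.trans ?_ (f.deriv_app_one _ _ _ _).symm)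
  rw [dval_zero, dval_zero,
    ← f.eval_equiv _ d (Equiv.swap none (some ()))]
  congr 1
  funext o
  obtain _ | _ := o <;> simp

end FaaHom

end

/-! ### The differential structure of `Faa C` -/

section

variable {C : Type u} [Category.{v} C] [CartesianMonoidalCategory C]

open FaaHom

variable {A B D' : Faa C}

lemma faa_lift {Z : Faa C} (f : Z ⟶ A) (g : Z ⟶ B) : lift f g = Faa.lift' f g :=
  CartesianMonoidalCategory.hom_ext _ _ ((lift_fst f g).trans (Faa.lift_fst' f g).symm)
    ((lift_snd f g).trans (Faa.lift_snd' f g).symm)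

/-- The derivative of a morphism of `Faa C`, as a morphism of `Faa C`. -/
noncomputable abbrev faaD (f : A ⟶ B) : diag A.V ⊗ A ⟶ diag B.V := FaaHom.deriv f

noncomputable instance (M : CMon C) : AddMonObj (diag M) := (lam M).mon

instance (M : CMon C) : IsCommAddMonObj (diag M) := (lam M).comm

lemma faa_add_eq {Z : Faa C} {M : CMon C} (a b : Z ⟶ diag M) :
    a + b = (Faa.lift' (A := diag M) (B := diag M) a b).comp
      (lin (A := (diag M).prod (diag M)) (B := diag M) M.add M.add) := by
  rw [add_eq, faa_lift]
  rfl

lemma faa_add_pt {Z : Faa C} {M : CMon C} (a b : Z ⟶ diag M) :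
    FaaHom.pt (a + b) = (FaaHom.pt a + FaaHom.pt b : Z.P ⟶ M.X) := by
  rw [faa_add_eq]
  rfl

lemma faa_add_eval {Z : Faa C} {M : CMon C} (a b : Z ⟶ diag M) {ι : Type*} [Finite ι]
    [Nonempty ι] {W : C} (v : ι → (W ⟶ Z.V.X)) (z : W ⟶ Z.P) :
    FaaHom.eval (a + b) v z = (FaaHom.eval a v z + FaaHom.eval b v z : W ⟶ M.X) := by
  rw [faa_add_eq, comp_lin_eval, lift'_eval]
  rfl

lemma faa_zero_eq {Z : Faa C} {M : CMon C} :
    (0 : Z ⟶ diag M) = (Faa.toTriv Z).comp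
      (lin (A := Faa.triv C) (B := diag M) M.zero M.zero) := by
  rw [zero_eq]
  exact congrArg (fun k => k ≫ lamZero M) (toUnit_unique (toUnit Z) (Faa.toTriv Z))

lemma faa_zero_pt {Z : Faa C} {M : CMon C} :
    FaaHom.pt (0 : Z ⟶ diag M) = (0 : Z.P ⟶ M.X) := by
  rw [faa_zero_eq]
  rfl

lemma faa_zero_eval {Z : Faa C} {M : CMon C} {ι : Type*} [Finite ι]
    [Nonempty ι] {W : C} (v : ι → (W ⟶ Z.V.X)) (z : W ⟶ Z.P) :
    FaaHom.eval (0 : Z ⟶ diag M) v z = (0 : W ⟶ M.X) := by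
  rw [faa_zero_eq, comp_lin_eval, zero_eq]
  exact congrArg (fun k => k ≫ M.zero) (toUnit_unique _ _)

/-- The axiom `L (X × Y) = L X × L Y` in `Faa C`. Both additions are linear morphisms, so it
suffices to compare the underlying maps. -/
lemma lam_prod (M N : CMon C) : lam (M.prod N) = (lam M).prod (lam N) := by
  refine StrictFunctor.cmon_ext rfl rfl ?_
  refine (Category.comp_id _).trans (Eq.trans ?_ (Category.id_comp _).symm)
  refine Eq.trans ?_ (StrictFunctor.prod_add (lam M) (lam N)).symm
  let P : CMon C := M.prod N
  have e1 : fst (diag P) (diag P) ≫ fst (diag M) (diag N) =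
      linD (A := P.prod P) (B := M) (fst P.X P.X ≫ fst M.X N.X) :=
    linD_comp (A := P.prod P) (B := P) (D := M) (fst P.X P.X) (fst M.X N.X)
  have e2 : snd (diag P) (diag P) ≫ fst (diag M) (diag N) =
      linD (A := P.prod P) (B := M) (snd P.X P.X ≫ fst M.X N.X) :=
    linD_comp (A := P.prod P) (B := P) (D := M) (snd P.X P.X) (fst M.X N.X)
  have e3 : fst (diag P) (diag P) ≫ snd (diag M) (diag N) =
      linD (A := P.prod P) (B := N) (fst P.X P.X ≫ snd M.X N.X) :=
    linD_comp (A := P.prod P) (B := P) (D := N) (fst P.X P.X) (snd M.X N.X)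
  have e4 : snd (diag P) (diag P) ≫ snd (diag M) (diag N) =
      linD (A := P.prod P) (B := N) (snd P.X P.X ≫ snd M.X N.X) :=
    linD_comp (A := P.prod P) (B := P) (D := N) (snd P.X P.X) (snd M.X N.X)
  obtain ⟨_, h1⟩ := lift_lamAdd (A := M) (B := P.prod P) (fst P.X P.X ≫ fst M.X N.X)
    (snd P.X P.X ≫ fst M.X N.X)
  obtain ⟨_, h2⟩ := lift_lamAdd (A := N) (B := P.prod P) (fst P.X P.X ≫ snd M.X N.X)
    (snd P.X P.X ≫ snd M.X N.X)
  change lamAdd P = lift (lift (fst (diag P) (diag P) ≫ fst (diag M) (diag N))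
    (snd (diag P) (diag P) ≫ fst (diag M) (diag N)) ≫ lamAdd M)
    (lift (fst (diag P) (diag P) ≫ snd (diag M) (diag N))
      (snd (diag P) (diag P) ≫ snd (diag M) (diag N)) ≫ lamAdd N)
  rw [e1, e2, e3, e4, h1, h2]
  unfold linD
  rw [lift_lin]
  exact lin_congr (A := (diag P).prod (diag P)) (B := diag P) (StrictFunctor.prod_add M N)
    (StrictFunctor.prod_add M N)

variable (C) in
/-- The differential data of `Faa C`. -/
noncomputable def faaData : GCDData (Faa C) where
  L A := lam A.V
  L_obj _ := rfl
  L_unit := StrictFunctor.cmon_ext rfl rfl (toUnit_unique _ _)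
  L_prod A B := lam_prod A.V B.V
  D f := faaD f

lemma faaData_D₂ (f : A ⟶ B) : (faaData C).D₂ f = faaD (faaD f) :=
  (Category.id_comp _).trans (Category.comp_id _)

variable (C) in
/-- The differential structure of `Faa C`. -/
noncomputable def faaStr : GCDStr (Faa C) where
  toGCDData := faaData C
  cd1_add A := by
    exact heq_of_eq (lin_deriv (A := (diag A.V).prod (diag A.V)) (B := diag A.V) A.V.add A.V.add)
  cd1_zero A := by
    exact heq_of_eq (lin_deriv (A := Faa.triv C) (B := diag A.V) A.V.zero A.V.zero)
  cd2_add {A B Z} f a b c := by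
    refine ext_eval ?_ fun n W v z => ?_
    · refine Eq.trans ?_ (faa_add_pt _ _).symm
      rw [faa_lift, faa_lift, faa_lift]
      refine (congrArg (fun k => lift k _ ≫ f.app 1) (faa_add_pt a b)).trans ?_
      exact f.app_one_add _ _ _
    · refine Eq.trans ?_ (faa_add_eval _ _ _ _).symm
      rw [faa_lift, faa_lift, faa_lift]
      refine (lift'_comp_deriv_eval f _ c v z).trans ?_
      refine Eq.trans ?_ (congrArg₂ (· + ·) (lift'_comp_deriv_eval f a c v z).symm
        (lift'_comp_deriv_eval f b c v z).symm)
      rw [← Finset.sum_add_distrib]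
      refine Finset.sum_congr rfl fun r _ => ?_
      rw [← dval_add]
      congr 1
      · funext q
        exact faa_add_eval _ _ _ _
      · rw [← comp_add]
        exact congrArg (fun k => z ≫ k) (faa_add_pt a b)
  cd2_zero {A B Z} f c := by
    refine ext_eval ?_ fun n W v z => ?_
    · refine Eq.trans ?_ faa_zero_pt.symm
      rw [faa_lift]
      refine (congrArg (fun k => lift k _ ≫ f.app 1) faa_zero_pt).trans ?_
      exact f.app_one_zero _
    · refine Eq.trans ?_ (faa_zero_eval _ _).symm
      rw [faa_lift]
      refine (lift'_comp_deriv_eval f _ c v z).trans ?_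
      refine Finset.sum_eq_zero fun r _ => ?_
      rw [← f.dval_zero_zero (fun q : Quotient r => c.eval (fun i : Block r q => v i) z) (z ≫ c.pt)]
      congr 1
      · funext q
        exact faa_zero_eval _ _
      · rw [← comp_zero z]
        exact congrArg (fun k => z ≫ k) faa_zero_pt
  cd3_fst A B := heq_of_eq (lin_deriv _ _)
  cd3_snd A B := heq_of_eq (lin_deriv _ _)
  cd4 f g := by
    rw [faa_lift]
    refine heq_of_eq ((lift'_deriv f g).trans ?_)
    exact (faa_lift _ _).symm
  cd5 f g := by
    rw [faa_lift]
    exact comp_deriv f g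
  cd6 {A B Z} f a c d := by
    rw [faaData_D₂, faa_lift, faa_lift, faa_lift, faa_lift]
    refine ext_eval ?_ fun n W v z => ?_
    · refine Eq.trans ?_ (f.deriv_app_one_left a.pt c.pt d.pt)
      exact congrArg (fun k => lift (lift a.pt k) (lift c.pt d.pt) ≫ f.deriv.app 1) faa_zero_pt
    · refine (lift'_comp_deriv_eval (faaD f) _ _ v z).trans ?_
      refine Eq.trans ?_ (lift'_comp_deriv_eval f a d v z).symm
      refine Finset.sum_congr rfl fun r _ => ?_
      rw [← f.deriv_dval_left _ _ (fun q : Quotient r => c.eval (fun i : Block r q => v i) z)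
        _ (z ≫ c.pt)]
      congr 1
      · funext q
        exact (lift'_eval _ _ _ _).trans (congrArg (lift (C := C) _) (faa_zero_eval _ _))
      · funext q
        exact lift'_eval _ _ _ _
      · refine (comp_lift _ _ _).trans (congrArg (lift (C := C) _) ?_)
        rw [← comp_zero z]
        exact congrArg (fun k => z ≫ k) faa_zero_pt
      · exact comp_lift _ _ _
  cd7 {A B Z} f b c d := by
    have key : ∀ b c : Z ⟶ diag A.V, ∀ {n : ℕ+} (W : C) (v : Fin n → (W ⟶ Z.V.X)) (z : W ⟶ Z.P),
        FaaHom.eval (lift (lift (0 : Z ⟶ diag A.V) b) (lift c d) ≫ faaD (faaD f)) v z =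
        ∑ r : Setoid (Fin n), f.deriv.dval
          (fun q : Quotient r => lift 0 (FaaHom.eval b (fun i : Block r q => v i) z))
          (fun q => lift (FaaHom.eval c (fun i : Block r q => v i) z)
            (FaaHom.eval d (fun i : Block r q => v i) z))
          (lift 0 (z ≫ FaaHom.pt b)) (lift (z ≫ FaaHom.pt c) (z ≫ FaaHom.pt d)) := by
      intro b c n W v z
      rw [faa_lift, faa_lift, faa_lift]
      refine (lift'_comp_deriv_eval (faaD f) _ _ v z).trans ?_
      refine Finset.sum_congr rfl fun r _ => ?_
      congr 1
      · funext q
        exact (lift'_eval _ _ _ _).trans (congrArg (fun k => lift (C := C) k _) (faa_zero_eval _ _))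
      · funext q
        exact lift'_eval _ _ _ _
      · refine (comp_lift _ _ _).trans (congrArg (fun k => lift (C := C) k _) ?_)
        rw [← comp_zero z]
        exact congrArg (fun k => z ≫ k) faa_zero_pt
      · exact comp_lift _ _ _
    rw [faaData_D₂]
    refine ext_eval ?_ fun n W v z => ?_
    · rw [faa_lift, faa_lift, faa_lift, faa_lift, faa_lift, faa_lift]
      refine (congrArg (fun k => lift (lift k b.pt) (lift c.pt d.pt) ≫ f.deriv.app 1)
        faa_zero_pt).trans ?_
      refine (f.deriv_app_one_symm b.pt c.pt d.pt).trans ?_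
      exact (congrArg (fun k => lift (lift k c.pt) (lift b.pt d.pt) ≫ f.deriv.app 1)
        faa_zero_pt).symm
    · refine (key b c W v z).trans (Eq.trans ?_ (key c b W v z).symm)
      exact Finset.sum_congr rfl fun r _ => f.deriv_dval_symm _ _ _ _ _ _

end

/-! ### The functor given by a differential structure -/

section

variable {C : Type u} [Category.{v} C] [CartesianMonoidalCategory C]

open FaaHom

namespace GCDStr

variable (S : GCDStr C) {X Y Z W : C}

lemma jet_eval_subsingleton (f : X ⟶ Y) {ι : Type*} [Finite ι] [Nonempty ι] [Subsingleton ι]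
    (a : ι → (Z ⟶ S.L₀ X)) (x : Z ⟶ X) (i : ι) : (S.jet f).eval a x = lift (a i) x ≫ S.D f :=
  eval_unique _ _ _ _

lemma exists_equiv_fin_succ (ι : Type*) [Finite ι] [Nonempty ι] :
    ∃ n, Nonempty (ι ≃ Fin (n + 1)) := by
  obtain ⟨n, ⟨e⟩⟩ := Finite.exists_equiv_fin ι
  cases n with
  | zero => exact ((e (Classical.arbitrary ι)).elim0)
  | succ n => exact ⟨n, ⟨e⟩⟩

/-- The derivative of a jet is the jet of the derivative. -/
lemma jet_dval (f : X ⟶ Y) {ι : Type*} [Finite ι] [Nonempty ι] (u w : ι → (Z ⟶ S.L₀ X))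
    (a : Z ⟶ S.L₀ X) (x : Z ⟶ X) :
    (S.jet (S.D f)).eval (fun i => S.tan (u i) (w i)) (lift a x) ≫ S.flat Y =
      (S.jet f).dval u w a x := by
  obtain ⟨n, ⟨e⟩⟩ := exists_equiv_fin_succ ι
  have h := S.iter_D n f (u ∘ e.symm) (w ∘ e.symm) a x
  rw [← dval_equiv (A := ⟨S.L X, X⟩) (B := ⟨S.L Y, Y⟩) (S.jet f) u w a x e.symm, dval_eq,
    eval_eq _ _ _ (n := ⟨n + 2, by omega⟩) (finSuccEquiv (n + 1)).symm,
    eval_eq (S.jet (S.D f)) _ _ (n := ⟨n + 1, by omega⟩) e, Category.assoc]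
  refine h.trans ?_
  refine congr (congrArg _ ?_) ?_
  · refine congrArg (fun b => tuple b x ≫ S.iter (n + 2) f) (funext fun i => ?_)
    refine Fin.cases ?_ (fun i => ?_) i
    · exact congrArg (fun o => Option.elim o a (w ∘ e.symm)) finSuccEquiv_zero.symm
    · exact congrArg (fun o => Option.elim o a (w ∘ e.symm)) (finSuccEquiv_succ i).symm
  · refine Finset.sum_congr rfl fun i _ => ?_
    exact (eval_eq (S.jet f) (Function.update (w ∘ e.symm) i ((u ∘ e.symm) i)) x
      (n := ⟨n + 1, n.succ_pos⟩) (Equiv.refl (Fin (n + 1)))).symm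

lemma jet_eval_option (f : X ⟶ Y) {ι : Type*} [Finite ι] [Nonempty ι] (w : ι → (Z ⟶ S.L₀ X))
    (a : Z ⟶ S.L₀ X) (x : Z ⟶ X) :
    (S.jet f).eval (fun o : Option ι => o.elim a w) x =
      (S.jet (S.D f)).eval (fun i => S.tan 0 (w i)) (lift a x) ≫ S.flat Y := by
  rw [jet_dval, dval_zero]

lemma jet_eval_succ (f : X ⟶ Y) {n : ℕ} (a : Fin (n + 2) → (Z ⟶ S.L₀ X)) (x : Z ⟶ X) :
    (S.jet f).eval a x =
      (S.jet (S.D f)).eval (fun i : Fin (n + 1) => S.tan 0 (a i.succ)) (lift (a 0) x) ≫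
        S.flat Y := by
  rw [← jet_eval_option, ← eval_equiv (A := ⟨S.L X, X⟩) (B := ⟨S.L Y, Y⟩) (S.jet f) a x
    (finSuccEquiv (n + 1)).symm]
  congr 1
  funext o
  cases o <;> simp

variable {S} in
lemma IsLin.jet_comp {k : X ⟶ Y} {k' : S.L₀ X ⟶ S.L₀ Y} (h : S.IsLin k k') (g : Y ⟶ W)
    {ι : Type*} [Finite ι] [Nonempty ι] (a : ι → (Z ⟶ S.L₀ X)) (x : Z ⟶ X) :
    (S.jet (k ≫ g)).eval a x = (S.jet g).eval (fun i => a i ≫ k') (x ≫ k) :=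
  h.comp_iter g _ _ x

variable {S} in
lemma IsLin.comp_jet {k : X ⟶ Y} {k' : S.L₀ X ⟶ S.L₀ Y} (h : S.IsLin k k') (f : W ⟶ X)
    {ι : Type*} [Finite ι] [Nonempty ι] (a : ι → (Z ⟶ S.L₀ W)) (x : Z ⟶ W) :
    (S.jet (f ≫ k)).eval a x = (S.jet f).eval a x ≫ k' := by
  obtain ⟨n, ⟨e⟩⟩ := exists_equiv_fin_succ ι
  rw [eval_eq _ _ _ (n := ⟨n + 1, by omega⟩) e, eval_eq _ _ _ (n := ⟨n + 1, by omega⟩) e,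
    Category.assoc]
  exact congrArg (fun k => _ ≫ k) (h.iter_comp f n)

lemma jet_lift (f : W ⟶ X) (g : W ⟶ Y) {ι : Type*} [Finite ι] [Nonempty ι]
    (a : ι → (Z ⟶ S.L₀ W)) (x : Z ⟶ W) :
    (S.jet (lift f g)).eval a x = S.pr ((S.jet f).eval a x) ((S.jet g).eval a x) := by
  have h₁ := (IsLin.fst (S := S) X Y).comp_jet (lift f g) a x
  have h₂ := (IsLin.snd (S := S) X Y).comp_jet (lift f g) a x
  rw [lift_fst] at h₁
  rw [lift_snd] at h₂
  rw [h₁, h₂, pr_eta]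

/-- The Faà di Bruno formula for iterated derivatives, with the vectors in a list. The induction
differentiates both sides, by `jet_eval_option` and `compVal_option`. -/
lemma jet_comp_eval_fin (n : ℕ) (f : X ⟶ Y) (g : Y ⟶ W) (a : Fin (n + 1) → (Z ⟶ S.L₀ X))
    (x : Z ⟶ X) : (S.jet (f ≫ g)).eval a x = (S.jet f).compVal (S.jet g) a x := by
  induction n generalizing X Y W with
  | zero =>
    have : Subsingleton (Fin (0 + 1)) := inferInstanceAs (Subsingleton (Fin 1))
    rw [← eval_comp, jet_eval_subsingleton _ _ _ _ 0, eval_unique _ _ _ 0, comp_app_one]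
    exact congrArg (fun k => _ ≫ k) (S.cd5 f g)
  | succ n ih =>
    rw [← eval_equiv _ _ _ (finSuccEquiv (n + 1)).symm,
      ← compVal_equiv _ _ _ _ (finSuccEquiv (n + 1)).symm]
    generalize a ∘ (finSuccEquiv (n + 1)).symm = b
    obtain ⟨w, c, rfl⟩ : ∃ w c, b = fun o => o.elim c w :=
      ⟨fun i => b (some i), b none, by funext o; cases o <;> rfl⟩
    rw [jet_eval_option, compVal_option, S.cd5, ih]
    unfold compVal
    rw [sum_comp]
    refine Finset.sum_congr rfl fun r _ => ?_
    rw [← jet_dval]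
    unfold term
    congr 2
    · funext q
      rw [jet_lift, (IsLin.snd (S.L₀ X) X).jet_comp]
      simp only [tan_split_assoc, lift_snd, jet_eval_option]
      rw [tan, Category.assoc, flat_unflat, Category.comp_id]
    · rw [jet_eval_subsingleton _ _ _ _ ()]
      change lift _ _ ≫ lift _ (_ ≫ f) = lift _ (x ≫ f)
      rw [comp_lift, lift_snd_assoc]

lemma jet_comp_eval (f : X ⟶ Y) (g : Y ⟶ W) {ι : Type*} [Finite ι] [Nonempty ι]
    (a : ι → (Z ⟶ S.L₀ X)) (x : Z ⟶ X) :
    (S.jet (f ≫ g)).eval a x = (S.jet f).compVal (S.jet g) a x := by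
  obtain ⟨n, ⟨e⟩⟩ := exists_equiv_fin_succ ι
  rw [← eval_equiv _ _ _ e.symm, ← compVal_equiv _ _ _ _ e.symm]
  exact S.jet_comp_eval_fin n f g _ x

lemma jet_comp (f : X ⟶ Y) (g : Y ⟶ W) : S.jet (f ≫ g) = (S.jet f).comp (S.jet g) :=
  ext_eval rfl fun n Z a x => by rw [jet_comp_eval, eval_comp]

/-- The jet of a map whose derivative does not depend on the point. -/
lemma jet_eq_lin {k : X ⟶ Y} {k' : S.L₀ X ⟶ S.L₀ Y} [IsAddMonHom k']
    (h : S.D k = fst _ _ ≫ k') :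
    S.jet k = lin (A := ⟨S.L X, X⟩) (B := ⟨S.L Y, Y⟩) k k' := by
  refine ext_eval rfl fun n Z a x => ?_
  cases subsingleton_or_nontrivial (Fin n) with
  | inl _ =>
    obtain ⟨i⟩ : Nonempty (Fin n) := inferInstance
    rw [jet_eval_subsingleton _ _ _ _ i, lin_eval_subsingleton _ _ _ _ i, h, lift_fst_assoc]
  | inr _ =>
    obtain ⟨⟨m, ⟨e⟩⟩⟩ : Nonempty (∃ m, Nonempty (Fin n ≃ Option (Fin (m + 1)))) := by
      obtain ⟨m, ⟨e⟩⟩ := exists_equiv_fin_succ (Fin n)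
      cases m with
      | zero =>
        have : Subsingleton (Fin (0 + 1)) := inferInstanceAs (Subsingleton (Fin 1))
        exact (not_subsingleton (Fin n) e.subsingleton).elim
      | succ m => exact ⟨m, ⟨e.trans (finSuccEquiv _)⟩⟩
    rw [lin_eval_nontrivial, ← eval_equiv _ a x e.symm]
    generalize a ∘ e.symm = b
    obtain ⟨w, c, rfl⟩ : ∃ w c, b = fun o => o.elim c w :=
      ⟨fun i => b (some i), b none, by funext o; cases o <;> rfl⟩
    rw [jet_eval_option, h, (IsLin.fst (S.L₀ X) X).jet_comp]
    simp only [tan_split_assoc, lift_fst, zero_comp]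
    rw [eval_zero' _ _ _ 0 rfl, zero_comp]

lemma jet_id (X : C) : S.jet (𝟙 X) = lin (A := ⟨S.L X, X⟩) (B := ⟨S.L X, X⟩) (𝟙 X) (𝟙 _) :=
  S.jet_eq_lin (IsLin.id X).D_eq

end GCDStr

lemma lin_of_eq {V M : CMon C} {P : C} {B : Faa C} (h : V = M) (p : P ⟶ B.P) (k : M.X ⟶ B.V.X)
    [IsAddMonHom k] (k' : V.X ⟶ B.V.X) [IsAddMonHom k']
    (hk : k' = eqToHom (congrArg CMon.X h) ≫ k) :
    (lin (A := ⟨V, P⟩) p k' : (⟨V, P⟩ : Faa C) ⟶ B) =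
      eqToHom (congrArg (fun V => Faa.mk V P) h) ≫
          (lin (A := ⟨M, P⟩) p k : (⟨M, P⟩ : Faa C) ⟶ B) := by
  subst h
  rw [eqToHom_refl, Category.id_comp]
  exact lin_congr rfl (hk.trans (Category.id_comp _))

section

variable {C : Type (max u v)} [Category.{v} C] [CartesianMonoidalCategory C]

/-- The functor `X ↦ (L X, X)` sending a map to its iterated derivatives. -/
noncomputable def GCDStr.jetFunctor (S : GCDStr C) : StrictFunctor C (Faa C) where
  obj X := ⟨S.L X, X⟩
  map f := S.jet f
  map_id X := S.jet_id X
  map_comp f g := S.jet_comp f g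
  obj_unit := congrArg (fun V => Faa.mk V (𝟙_ C)) S.L_unit
  obj_prod X Y := congrArg (fun V => Faa.mk V (X ⊗ Y)) (S.L_prod X Y)
  map_fst X Y := (S.jet_eq_lin (S.D_fst X Y)).trans
    (lin_of_eq (B := ⟨S.L X, X⟩) (S.L_prod X Y) (fst X Y) (fst (S.L₀ X) (S.L₀ Y)) _ rfl)
  map_snd X Y := (S.jet_eq_lin (S.D_snd X Y)).trans
    (lin_of_eq (B := ⟨S.L Y, Y⟩) (S.L_prod X Y) (snd X Y) (snd (S.L₀ X) (S.L₀ Y)) _ rfl)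

end

end

/-! ### Equality of morphisms of `Faa C` over equal objects -/

section

open FaaHom

section

variable {C : Type u} [Category.{v} C] [CartesianMonoidalCategory C]

/-- Morphisms of `Faa C` with equal sources and targets agree if they do so on vectors and points,
up to the casts. -/
lemma faaHom_heq_of_eval {A A' B B' : Faa C} (hA : A = A') (hB : B = B') (f : A ⟶ B) (g : A' ⟶ B')
    (hp : FaaHom.pt f ≫ eqToHom (congrArg Faa.P hB) = eqToHom (congrArg Faa.P hA) ≫ FaaHom.pt g)
    (h : ∀ (n : ℕ) {Z : C} (a : Fin (n + 1) → (Z ⟶ A.V.X)) (x : Z ⟶ A.P),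
      FaaHom.eval f a x ≫ eqToHom (congrArg (fun B => B.V.X) hB) =
        FaaHom.eval g (fun i => a i ≫ eqToHom (congrArg (fun B => B.V.X) hA))
          (x ≫ eqToHom (congrArg Faa.P hA))) : f ≍ g := by
  subst hA hB
  simp only [eqToHom_refl, Category.comp_id, Category.id_comp] at h hp
  refine heq_of_eq (ext_eval hp fun n Z a x => ?_)
  obtain ⟨n, hn⟩ := n
  obtain ⟨n, rfl⟩ : ∃ m, n = m + 1 := ⟨n - 1, by omega⟩
  exact h n a x

lemma lin_heq {V V' W W' : CMon C} {P Q : C} (hV : V = V') (hW : W = W') (p : P ⟶ Q)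
    (k : V.X ⟶ W.X) (k' : V'.X ⟶ W'.X) [IsAddMonHom k] [IsAddMonHom k'] (h : k ≍ k') :
    (lin (A := ⟨V, P⟩) (B := ⟨W, Q⟩) p k : (⟨V, P⟩ : Faa C) ⟶ ⟨W, Q⟩) ≍
      (lin (A := ⟨V', P⟩) (B := ⟨W', Q⟩) p k' : (⟨V', P⟩ : Faa C) ⟶ ⟨W', Q⟩) := by
  subst hV hW
  exact heq_of_eq (lin_congr rfl (eq_of_heq h))

lemma GCDStr.L_square (S : GCDStr C) (X : C) : S.L (S.L₀ X ⊗ S.L₀ X) = (S.L X).prod (S.L X) := by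
  rw [S.L_prod, S.L_obj]

lemma GCDStr.D_addMap (S : GCDStr C) (X : C) :
    S.D (S.L X).add = fst _ _ ≫ eqToHom (congrArg CMon.X (S.L_square X)) ≫ (S.L X).add ≫
      S.unflat X := by
  rw [eq_of_heq_dom (congrArg CMon.X (S.L_square X)) rfl (S.L₀_L₀ X).symm _ _ (S.cd1_add X)]
  simp [GCDStr.unflat]

lemma GCDStr.tan_eq (S : GCDStr C) {X Z : C} (u w : Z ⟶ S.L₀ X) :
    S.tan u w = lift u w ≫ eqToHom (S.L₀_dom X).symm := by
  unfold GCDStr.tan GCDStr.pr GCDStr.unsplit GCDStr.unflat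
  have := lift_comp_eqToHom (S.L₀_L₀ X).symm rfl
    (congrArg (fun V => V ⊗ S.L₀ X) (S.L₀_L₀ X).symm) u w
  rw [eqToHom_refl, Category.comp_id] at this
  rw [← this, Category.assoc, eqToHom_trans]

lemma GCDStr.tan_eqToHom (S : GCDStr C) {X Z : C} (u w : Z ⟶ S.L₀ X)
    (h : S.L₀ (S.L₀ X ⊗ X) = S.L₀ X ⊗ S.L₀ X) : S.tan u w ≫ eqToHom h = lift u w := by
  rw [tan_eq, Category.assoc, eqToHom_trans, eqToHom_refl, Category.comp_id]

end

variable {C : Type (max u v)} [Category.{v} C] [CartesianMonoidalCategory C]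

/-! ### Jets preserve the differential structure -/

namespace GCDStr

variable (S : GCDStr C)

/-- The jet functor preserves the chosen monoids, since addition is linear by [CD.1]. -/
lemma mapCMon_jetFunctor (X : C) : lam (S.L X) = S.jetFunctor.mapCMon (S.L X) := by
  have hX : diag (S.L X) = (⟨S.L (S.L₀ X), S.L₀ X⟩ : Faa C) :=
    congrArg (fun V => Faa.mk V (S.L₀ X)) (S.L_obj X).symm
  have := isAddMonHom_eqToHom (S.L_square X) (congrArg CMon.X (S.L_square X))
  refine StrictFunctor.cmon_ext hX (congrArg (fun A => A ⊗ A) hX) (eq_of_heq ?_)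
  refine (comp_eqToHom_heq _ _).trans (HEq.symm ?_)
  refine (eqToHom_comp_heq _ _).trans ((eqToHom_comp_heq _ _).trans ?_)
  refine (heq_of_eq (S.jet_eq_lin (S.D_addMap X))).trans ?_
  refine lin_heq (S.L_square X) (S.L_obj X) _ _ _ ?_
  exact (eqToHom_comp_heq _ _).trans (comp_eqToHom_heq _ _)

/-- The jet functor preserves the differential structure: by `jet_dval`, the jet of `D f` is the
formal derivative of the jet of `f`. -/
lemma preserves_jetFunctor : S.Preserves (faaStr C) S.jetFunctor where
  L_eq X := S.mapCMon_jetFunctor X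
  D_heq {X Y} f := by
    have hX : S.L (S.L₀ X ⊗ X) = (S.L X).prod (S.L X) := by rw [S.L_prod, S.L_obj]
    refine HEq.symm ?_
    refine faaHom_heq_of_eval (C := C) (congrArg (fun V => Faa.mk V (S.L₀ X ⊗ X)) hX)
      (congrArg (fun V => Faa.mk V (S.L₀ Y)) (S.L_obj Y)) (S.jet (S.D f)) (faaD (S.jet f)) ?_
      fun n Z a x => ?_
    · exact (Category.comp_id _).trans (Category.id_comp _).symm
    · obtain ⟨u, w, rfl⟩ : ∃ u w : Fin (n + 1) → (Z ⟶ S.L₀ X), a = fun i => S.tan (u i) (w i) := by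
        choose u w h using fun i => S.exists_tan (a i)
        exact ⟨u, w, funext h⟩
      obtain ⟨c, x, rfl⟩ : ∃ c y, x = lift c y := ⟨x ≫ fst _ _, x ≫ snd _ _, by simp⟩
      refine (S.jet_dval f u w c x).trans ?_
      refine Eq.trans ?_ (FaaHom.deriv_eval (S.jet f) _ _).symm
      have ht : ∀ i, S.tan (u i) (w i) ≫ eqToHom (S.L₀_dom X) = lift (u i) (w i) :=
        fun i => S.tan_eqToHom _ _ _
      have h₁ : (fun i => (S.tan (u i) (w i) ≫ eqToHom (S.L₀_dom X)) ≫ fst _ _) = u := by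
        funext i
        rw [ht, lift_fst]
      have h₂ : (fun i => (S.tan (u i) (w i) ≫ eqToHom (S.L₀_dom X)) ≫ snd _ _) = w := by
        funext i
        rw [ht, lift_snd]
      have h₃ : (lift c x ≫ 𝟙 _) ≫ fst _ _ = c := by rw [Category.comp_id, lift_fst]
      have h₄ : (lift c x ≫ 𝟙 _) ≫ snd _ _ = x := by rw [Category.comp_id, lift_snd]
      exact (congr (congr (congr (congrArg (dval (S.jet f)) h₁) h₂) h₃) h₄).symm

end GCDStr

/-! ### Functors preserving the differential structure -/

namespace StrictFunctor

section

variable {C : Type u} [Category.{v} C] [CartesianMonoidalCategory C]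
  {D : Type u} [Category.{v} D] [CartesianMonoidalCategory D] (F : StrictFunctor C D)

lemma map_zero {Z : C} (A : CMon C) : F.map (0 : Z ⟶ A.X) = (0 : F.obj Z ⟶ (F.mapCMon A).X) := by
  simpa using F.zero_elem A (𝟙 (F.obj Z))

lemma faaMap_dval {A B : Faa C} (f : FaaHom A B) {ι : Type*} [Finite ι] [Nonempty ι] {Z : D} {Y : C}
    (r : Z ⟶ F.obj Y) (u w : ι → (Y ⟶ A.V.X)) (a : Y ⟶ A.V.X) (x : Y ⟶ A.P) :
    (F.faaMap f).dval (fun i => r ≫ F.map (u i)) (fun i => r ≫ F.map (w i)) (r ≫ F.map a)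
      (r ≫ F.map x) = r ≫ F.map (f.dval u w a x) := by
  classical
  have := Fintype.ofFinite ι
  rw [dval_eq, dval_eq, F.add_elem, F.sum_elem, ← F.faaMap_eval]
  congr 1
  · congr 1
    funext o
    cases o <;> rfl
  · refine Finset.sum_congr rfl fun i _ => ?_
    rw [← F.faaMap_eval]
    congr 1
    exact (update_comp_eq w i (u i) (fun k => r ≫ F.map k)).symm

lemma mapCMon_faa (M : CMon C) : lam (F.mapCMon M) = F.faa.mapCMon (lam M) := by
  refine StrictFunctor.cmon_ext rfl rfl ((Category.comp_id _).trans
    (Eq.trans (eq_of_heq ?_) (Category.id_comp _).symm))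
  refine HEq.trans ?_ (eqToHom_comp_heq _ _).symm
  have hobj : diag (F.mapCMon M) ⊗ diag (F.mapCMon M) = F.faaObj ((diag M).prod (diag M)) :=
    (F.faa.obj_prod (diag M) (diag M)).symm
  refine faaHom_heq hobj rfl _ _ ?_ fun n => ?_
  · exact eqToHom_comp_heq _ _
  · refine HEq.trans ?_ (heq_of_eq (F.faaMap_lin_app (A := (diag M).prod (diag M)) (B := diag M)
      M.add M.add n)).symm
    exact lin_app_heq (F.obj_prod _ _).symm (F.obj_prod _ _).symm (F.mapCMon M) _ n

/-- The functor `Faa C ⥤ Faa D` induced by a functor preserves the differential structures, because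
the formal derivative is defined by sums of components. -/
lemma preserves_faa : (faaStr C).Preserves (faaStr D) F.faa where
  L_eq A := F.mapCMon_faa A.V
  D_heq {A B} f := by
    have hA : F.faaObj ((diag A.V).prod A) = (diag (F.mapCMon A.V)).prod (F.faaObj A) :=
      F.faa.obj_prod (diag A.V) A
    refine HEq.symm (faaHom_heq_of_eval hA rfl (F.faaMap (faaD f)) (faaD (F.faaMap f)) ?_
      fun n Z a x => ?_)
    · refine (Category.comp_id _).trans ?_
      change F.map (f.app 1) = eqToHom _ ≫ eqToHom _ ≫ F.map (f.app 1)
      exact (Category.id_comp _).symm.trans ((congrArg (fun k => k ≫ F.map (f.app 1))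
        (eqToHom_trans _ _).symm).trans (Category.assoc _ _ _))
    · obtain ⟨r, hr, hx⟩ := F.exists_elem a x
      obtain rfl := funext hr
      subst hx
      refine (Category.comp_id _).trans ?_
      refine (F.faaMap_eval (faaD f) r _ _).trans ?_
      refine (congrArg (fun k => r ≫ F.map k) (FaaHom.deriv_eval f _ _)).trans ?_
      refine (F.faaMap_dval f r _ _ _ _).symm.trans ?_
      refine Eq.trans ?_ (FaaHom.deriv_eval (F.faaMap f) _ _).symm
      have h₁ : ∀ {X Y : C} (q : pow (A.V.X ⊗ A.V.X) (A.V.X ⊗ A.P) (n + 1) ⟶ X ⊗ Y),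
          r ≫ F.map (q ≫ fst X Y) =
            ((r ≫ F.map q) ≫ eqToHom (F.obj_prod X Y)) ≫ fst _ _ := by
        intro X Y q
        rw [F.map_comp, F.map_fst]
        simp
      have h₂ : ∀ {X Y : C} (q : pow (A.V.X ⊗ A.V.X) (A.V.X ⊗ A.P) (n + 1) ⟶ X ⊗ Y),
          r ≫ F.map (q ≫ snd X Y) =
            ((r ≫ F.map q) ≫ eqToHom (F.obj_prod X Y)) ≫ snd _ _ := by
        intro X Y q
        rw [F.map_comp, F.map_snd]
        simp
      exact congr (congr (congr (congrArg (dval (F.faaMap f)) (funext fun i => h₁ _))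
        (funext fun i => h₂ _)) (h₁ _)) (h₂ _)

variable {S : GCDStr C} {T : GCDStr D}

lemma _root_.GenDiff.GCDStr.Preserves.L₀_eq {F : StrictFunctor C D} (h : S.Preserves T F) (X : C) :
    F.obj (S.L₀ X) = T.L₀ (F.obj X) := (congrArg CMon.X (h.L_eq X)).symm

lemma map_D {F : StrictFunctor C D} (h : S.Preserves T F) {X Y : C} (f : X ⟶ Y) :
    F.map (S.D f) = eqToHom (by rw [F.obj_prod, h.L₀_eq]) ≫ T.D (F.map f) ≫
      eqToHom (h.L₀_eq Y).symm := by
  refine eq_of_heq (HEq.trans (h.D_heq f).symm ?_)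
  exact ((eqToHom_comp_heq _ _).trans (comp_eqToHom_heq _ _)).symm

lemma map_tan {F : StrictFunctor C D} (h : S.Preserves T F) {X Z : C} (u w : Z ⟶ S.L₀ X)
    (e : F.obj (S.L₀ (S.L₀ X ⊗ X)) = T.L₀ (T.L₀ (F.obj X) ⊗ F.obj X)) :
    F.map (S.tan u w) ≫ eqToHom e =
      T.tan (F.map u ≫ eqToHom (h.L₀_eq X)) (F.map w ≫ eqToHom (h.L₀_eq X)) := by
  rw [GCDStr.tan_eq, GCDStr.tan_eq, F.map_comp, eqToHom_map]
  have e1 := F.map_lift u w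
  have e2 := lift_comp_eqToHom (h.L₀_eq X) (h.L₀_eq X) (by rw [h.L₀_eq X]) (F.map u) (F.map w)
  rw [← e2, ← e1]
  simp

/-- A functor preserving the differential structure preserves iterated derivatives. -/
lemma map_jet_eval {F : StrictFunctor C D} (h : S.Preserves T F) (n : ℕ) {X Y Z : C} (f : X ⟶ Y)
    (a : Fin (n + 1) → (Z ⟶ S.L₀ X)) (x : Z ⟶ X) :
    F.map ((S.jet f).eval a x) ≫ eqToHom (h.L₀_eq Y) =
      (T.jet (F.map f)).eval (fun i => F.map (a i) ≫ eqToHom (h.L₀_eq X)) (F.map x) := by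
  induction n generalizing X Y with
  | zero =>
    have : Subsingleton (Fin (0 + 1)) := inferInstanceAs (Subsingleton (Fin 1))
    rw [S.jet_eval_subsingleton _ _ _ 0, T.jet_eval_subsingleton _ _ _ 0, F.map_comp, map_D h]
    have e2 := lift_comp_eqToHom (h.L₀_eq X) rfl (congrArg (fun V => V ⊗ F.obj X) (h.L₀_eq X))
      (F.map (a 0)) (F.map x)
    rw [eqToHom_refl, Category.comp_id] at e2
    rw [← e2, ← F.map_lift]
    simp
  | succ n ih =>
    have hD : F.obj (S.L₀ X ⊗ X) = T.L₀ (F.obj X) ⊗ F.obj X := by rw [F.obj_prod, h.L₀_eq]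
    have e3 : F.map (lift (a 0) x) ≫ eqToHom hD =
        lift (F.map (a 0) ≫ eqToHom (h.L₀_eq X)) (F.map x) := by
      have e := lift_comp_eqToHom (h.L₀_eq X) rfl (congrArg (fun V => V ⊗ F.obj X) (h.L₀_eq X))
        (F.map (a 0)) (F.map x)
      rw [eqToHom_refl, Category.comp_id] at e
      rw [← e, ← F.map_lift]
      simp
    rw [S.jet_eval_succ, T.jet_eval_succ, F.map_comp, ← e3]
    have ih' := ih (S.D f) (fun i : Fin (n + 1) => S.tan 0 (a i.succ)) (lift (a 0) x)
    rw [map_D h, (GCDStr.IsLin.eqToHom _).jet_comp, (GCDStr.IsLin.eqToHom _).comp_jet] at ih'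
    have e4 : ∀ i : Fin (n + 1), (F.map (S.tan 0 (a i.succ)) ≫ eqToHom (h.L₀_eq (S.L₀ X ⊗ X))) ≫
        eqToHom (congrArg T.L₀ hD) = T.tan 0 (F.map (a i.succ) ≫ eqToHom (h.L₀_eq X)) := by
      intro i
      rw [Category.assoc, eqToHom_trans, map_tan h]
      congr 1
      have := isAddMonHom_eqToHom (h.L_eq X).symm (h.L₀_eq X)
      exact (congrArg (fun k => k ≫ eqToHom (h.L₀_eq X)) (F.map_zero (S.L X))).trans (zero_comp _)
    simp only [e4] at ih'
    have q : T.L₀ (F.obj (S.L₀ Y)) = T.L₀ (F.obj Y) := by rw [h.L₀_eq, T.L₀_L₀]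
    have e5 := congrArg (fun k => k ≫ eqToHom q) ih'
    simp only [Category.assoc, eqToHom_trans] at e5
    rw [GCDStr.flat, GCDStr.flat, eqToHom_map, Category.assoc, eqToHom_trans]
    exact e5

end

variable {D : Type (max u v)} [Category.{v} D] [CartesianMonoidalCategory D]
  {S : GCDStr C} {T : GCDStr D}

/-- A functor preserving the differential structure is compatible with the jet functors. -/
lemma jetFunctor_comp_faa {F : StrictFunctor C D} (h : S.Preserves T F) :
    S.jetFunctor.comp F.faa = F.comp T.jetFunctor := by
  have hobj : ∀ X : C, F.faaObj ⟨S.L X, X⟩ = ⟨T.L (F.obj X), F.obj X⟩ := fun X =>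
    congrArg (fun V => Faa.mk V (F.obj X)) (h.L_eq X).symm
  refine ext' (Functor.hext hobj fun X Y f => ?_)
  refine faaHom_heq_of_eval (hobj X) (hobj Y) (F.faaMap (S.jet f)) (T.jet (F.map f)) ?_
    fun n Z a x => ?_
  · exact (Category.comp_id _).trans (Category.id_comp _).symm
  · obtain ⟨r, hr, hx⟩ := F.exists_elem a x
    obtain rfl := funext hr
    subst hx
    refine (congrArg (fun k => k ≫ _) (F.faaMap_eval (S.jet f) r _ _)).trans ?_
    refine (Category.assoc _ _ _).trans ?_
    refine (congrArg (fun k => r ≫ k) (map_jet_eval h n f _ _)).trans ?_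
    refine (FaaHom.comp_eval _ _ _ _).trans ?_
    congr 1
    · funext i
      exact (Category.assoc _ _ _).symm
    · exact (Category.comp_id _).symm

end StrictFunctor

end

/-! ### The formula for the comultiplication -/

section

open FaaHom

section Formula

variable {C : Type u} [Category.{v} C] [CartesianMonoidalCategory C] {A B : Faa C}

lemma faaStr_tan_zero {Z : Faa C} (w : Z ⟶ diag A.V) :
    (faaStr C).tan (X := A) 0 w = lift (0 : Z ⟶ diag A.V) w := by
  have := (faaStr C).tan_eqToHom (X := A) (0 : Z ⟶ diag A.V) w rfl
  exact (Category.comp_id _).symm.trans this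

lemma faaStr_jet_eval_succ (f : A ⟶ B) {n : ℕ} {Z : Faa C} (a : Fin (n + 2) → (Z ⟶ diag A.V))
    (x : Z ⟶ A) :
    ((faaStr C).jet f).eval a x =
      ((faaStr C).jet (faaD f)).eval
        (fun i : Fin (n + 1) => lift (0 : Z ⟶ diag A.V) (a i.succ)) (lift (a 0) x) := by
  refine ((faaStr C).jet_eval_succ f a x).trans ((Category.comp_id _).trans ?_)
  congr 1
  funext i
  exact faaStr_tan_zero _

lemma faaStr_jet_eval_zero (f : A ⟶ B) {Z : Faa C} (a : Fin (0 + 1) → (Z ⟶ diag A.V))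
    (x : Z ⟶ A) :
    ((faaStr C).jet f).eval a x = lift (a 0) x ≫ faaD f :=
  have : Subsingleton (Fin (0 + 1)) := inferInstanceAs (Subsingleton (Fin 1))
  (faaStr C).jet_eval_subsingleton f a x 0

lemma eval_fin_succ (f : A ⟶ B) {n : ℕ} {Z : C} (a : Fin (n + 2) → (Z ⟶ A.V.X)) (x : Z ⟶ A.P) :
    FaaHom.eval f a x =
      FaaHom.eval f (fun o : Option (Fin (n + 1)) => o.elim (a 0) fun i => a i.succ) x := by
  rw [← eval_equiv f a x (finSuccEquiv (n + 1)).symm]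
  congr 1
  funext o
  cases o <;> simp

/-- The iterated derivatives of a morphism `f` of `Faa C` are on points the components of `f`. -/
lemma pt_jet_eval (n : ℕ) (f : A ⟶ B) {Z : Faa C} (a : Fin (n + 1) → (Z ⟶ diag A.V))
    (x : Z ⟶ A) :
    FaaHom.pt (((faaStr C).jet f).eval a x) =
      FaaHom.eval f (fun i => FaaHom.pt (a i)) (FaaHom.pt x) := by
  induction n generalizing A B with
  | zero =>
    have : Subsingleton (Fin (0 + 1)) := inferInstanceAs (Subsingleton (Fin 1))
    rw [faaStr_jet_eval_zero, eval_unique _ _ _ 0, faa_lift]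
    rfl
  | succ n ih =>
    rw [faaStr_jet_eval_succ, eval_fin_succ, ← dval_zero]
    refine (ih (faaD f) _ _).trans ((FaaHom.deriv_eval f _ _).trans ?_)
    simp only [faa_lift]
    refine congr (congr (congr (congrArg (dval f) (funext fun i => ?_)) (funext fun i => ?_)) ?_) ?_
    · exact (lift_fst _ _).trans faa_zero_pt
    · exact lift_snd _ _
    · exact lift_fst _ _
    · exact lift_snd _ _

/-- The partial injection `Fin (n + 1) ⇀ Fin m` given by `σ` and a value at `0`. -/
def PartialInj.cons {n m : ℕ} (σ : PartialInj n m) (o : Option {j : Fin m // ∀ i, σ.1 i ≠ some j}) :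
    PartialInj (n + 1) m :=
  ⟨Fin.cons (o.map Subtype.val) σ.1, by
    intro i i' j
    refine Fin.cases ?_ (fun i => ?_) i <;> refine Fin.cases ?_ (fun i' => ?_) i'
    · exact fun _ _ => rfl
    · cases o with
      | none => simp
      | some k =>
        rintro h h'
        simp only [Fin.cons_zero, Fin.cons_succ, Option.map_some] at h h'
        exact (k.2 i' (h'.trans h.symm)).elim
    · cases o with
      | none => simp
      | some k =>
        rintro h h'
        simp only [Fin.cons_zero, Fin.cons_succ, Option.map_some] at h h'
        exact (k.2 i (h.trans h'.symm)).elim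
    · intro h h'
      simp only [Fin.cons_succ] at h h'
      rw [σ.2 i i' j h h']⟩

lemma PartialInj.cons_bijective (n m : ℕ) : Function.Bijective
    (fun p : (σ : PartialInj n m) × Option {j : Fin m // ∀ i, σ.1 i ≠ some j} => p.1.cons p.2) := by
  constructor
  · rintro ⟨⟨σ, hσ⟩, o⟩ ⟨⟨τ, hτ⟩, o'⟩ h
    have h' := congrArg Subtype.val h
    simp only [PartialInj.cons] at h'
    obtain ⟨h1, h2⟩ := Fin.cons_inj.1 h'
    subst h2
    obtain rfl := Option.map_injective Subtype.val_injective h1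
    rfl
  · rintro ⟨τ, hτ⟩
    refine ⟨⟨⟨fun i => τ i.succ, fun i i' j h h' => Fin.succ_injective _ (hτ _ _ j h h')⟩,
      match h : τ 0 with
      | none => none
      | some j => some ⟨j, fun i hi => (Fin.succ_ne_zero i (hτ _ _ j hi h)).elim⟩⟩, ?_⟩
    apply Subtype.ext
    funext i
    refine Fin.cases ?_ (fun i => ?_) i
    · simp only [PartialInj.cons, Fin.cons_zero]
      split <;> simp [*]
    · simp [PartialInj.cons]

lemma sum_partialInj_succ {n m : ℕ} {M : Type*} [AddCommMonoid M] (g : PartialInj (n + 1) m → M) :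
    ∑ τ, g τ = ∑ σ : PartialInj n m, ∑ o, g (σ.cons o) := by
  rw [← (PartialInj.cons_bijective n m).sum_comp, Fintype.sum_sigma]

instance {M N : CMon C} : IsAddMonHom (0 : M.X ⟶ N.X) :=
  inferInstanceAs (IsAddMonHom (toUnit M.X ≫ N.zero))

lemma lift_zero_lin {Z : Faa C} {M : CMon C} (p : Z.P ⟶ M.X) (u : Z.V.X ⟶ M.X) [IsAddMonHom u] :
    lift (0 : Z ⟶ diag M) (lin (B := diag M) p u : Z ⟶ diag M) =
      (lin (A := Z) (B := diag (M.prod M)) (lift 0 p) (lift 0 u) : Z ⟶ diag M ⊗ diag M) := by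
  have h : (0 : Z ⟶ diag M) = (lin (B := diag M) 0 0 : Z ⟶ diag M) := by
    refine ext_eval faa_zero_pt fun n W v z => (faa_zero_eval v z).trans ?_
    cases subsingleton_or_nontrivial (Fin n) with
    | inl _ =>
      obtain ⟨i⟩ : Nonempty (Fin n) := inferInstance
      rw [lin_eval_subsingleton _ _ _ _ i, comp_zero]
    | inr _ => rw [lin_eval_nontrivial]
  rw [h, lift_lin]

/-- The vectors in the summand of the comultiplication belonging to `σ`. -/
abbrev slotVec {n m : ℕ} (σ : PartialInj n m) {V : Type*} (a : Fin n → V) (u : Fin n → Fin m → V)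
    (w : Fin m → V) : Slots σ → V :=
  Sum.elim (fun i => (σ.1 i).elim (a i) (u i)) (fun j => w j)

instance {n m : ℕ} (σ : PartialInj (n + 1) m) : Nonempty (Slots σ) := ⟨Sum.inl 0⟩

/-- Differentiating the outer morphism once more uses a new vector `a 0`: this is the summand of the
partial injection which is undefined at `0`. -/
lemma eval_slotVec_none (f : A ⟶ B) {n m : ℕ} (σ : PartialInj n m) [Nonempty (Slots σ)] {Z : C}
    (a : Fin (n + 1) → (Z ⟶ A.V.X)) (u : Fin (n + 1) → Fin m → (Z ⟶ A.V.X))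
    (w : Fin m → (Z ⟶ A.V.X)) (x : Z ⟶ A.P) :
    FaaHom.eval f (slotVec (σ.cons none) a u w) x =
      FaaHom.eval f (fun o : Option (Slots σ) =>
        o.elim (a 0) (slotVec σ (fun i => a i.succ) (fun i => u i.succ) w)) x := by
  let e : Option (Slots σ) ≃ Slots (σ.cons none) :=
    { toFun := fun o => o.elim (Sum.inl 0)
        (Sum.map Fin.succ fun j => ⟨j.1, Fin.cases (by simp [PartialInj.cons]) (by
          simpa [PartialInj.cons] using j.2)⟩)
      invFun := Sum.elim (Fin.cases none fun i => some (Sum.inl i))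
        fun j => some (Sum.inr ⟨j.1, fun i => by simpa [PartialInj.cons] using j.2 i.succ⟩)
      left_inv := by rintro (_ | i | j) <;> rfl
      right_inv := by
        rintro (i | j)
        · refine Fin.cases ?_ (fun i => ?_) i <;> rfl
        · rfl }
  rw [← eval_equiv f _ x e]
  congr 1
  funext o
  rcases o with _ | i | j <;> rfl

/-- Differentiating the free vector `w j` replaces it by its direction `u 0 j`: this is the summand
of the partial injection which sends `0` to `j`. -/
lemma eval_slotVec_some (f : A ⟶ B) {n m : ℕ} (σ : PartialInj n m) [Nonempty (Slots σ)]
    [DecidableEq (Slots σ)] (j : {j : Fin m // ∀ i, σ.1 i ≠ some j}) {Z : C}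
    (a : Fin (n + 1) → (Z ⟶ A.V.X)) (u : Fin (n + 1) → Fin m → (Z ⟶ A.V.X))
    (w : Fin m → (Z ⟶ A.V.X)) (x : Z ⟶ A.P) :
    FaaHom.eval f (slotVec (σ.cons (some j)) a u w) x =
      FaaHom.eval f (Function.update (slotVec σ (fun i => a i.succ) (fun i => u i.succ) w)
        (Sum.inr j) (u 0 j)) x := by
  let e : Slots σ ≃ Slots (σ.cons (some j)) :=
    { toFun := Sum.elim (fun i => Sum.inl i.succ) fun k =>
        if h : k = j then Sum.inl 0 else Sum.inr ⟨k.1, Fin.cases (by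
          simpa [PartialInj.cons, Subtype.ext_iff, eq_comm] using h) (by
          simpa [PartialInj.cons] using k.2)⟩
      invFun := Sum.elim (Fin.cases (Sum.inr j) Sum.inl)
        fun k => Sum.inr ⟨k.1, fun i => by simpa [PartialInj.cons] using k.2 i.succ⟩
      left_inv := by
        rintro (i | k)
        · rfl
        · by_cases h : k = j <;> simp [h]
      right_inv := by
        rintro (i | ⟨k, hk⟩)
        · refine Fin.cases ?_ (fun i => ?_) i <;> simp
        · have : k ≠ j := fun h => hk 0 (by simp [PartialInj.cons, h])
          simp [Subtype.ext_iff, this] }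
  rw [← eval_equiv f _ x e]
  congr 1
  funext s
  rcases s with i | k
  · rw [Function.update_of_ne Sum.inl_ne_inr]
    rfl
  · have he : e (Sum.inr k) = if h : k = j then Sum.inl 0 else _ := rfl
    by_cases h : k = j
    · subst h
      rw [Function.comp_apply, he, dif_pos rfl, Function.update_self]
      rfl
    · rw [Function.comp_apply, he, dif_neg h, Function.update_of_ne (by simpa using h)]
      rfl

/-- One more derivative of the summand of `σ` is the sum over the extensions of `σ` to one more
element of the source. -/
lemma dval_slotVec (f : A ⟶ B) {n m : ℕ} (σ : PartialInj n m) [Nonempty (Slots σ)] {Z : C}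
    (a : Fin (n + 1) → (Z ⟶ A.V.X)) (u : Fin (n + 1) → Fin m → (Z ⟶ A.V.X))
    (w : Fin m → (Z ⟶ A.V.X)) (x : Z ⟶ A.P) :
    FaaHom.dval f (ι := Slots σ) (Sum.elim (fun _ => 0) (fun j => u 0 j))
        (slotVec σ (fun i => a i.succ) (fun i => u i.succ) w) (a 0) x =
      ∑ o, FaaHom.eval f (slotVec (σ.cons o) a u w) x := by
  classical
  rw [dval_eq, Fintype.sum_option, eval_slotVec_none, Fintype.sum_sum_type,
    Finset.sum_eq_zero (fun i _ => ?_), zero_add]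
  · exact congrArg _ (Finset.sum_congr rfl fun j _ => (eval_slotVec_some f σ j a u w x).symm)
  · exact FaaHom.eval_zero f _ x (Sum.inl i)

/-- The iterated derivatives of a morphism of `Faa C` at linear arguments. The comultiplication is
the case where the arguments are projections. -/
lemma jet_eval_lin (n : ℕ) (f : A ⟶ B) {Z : Faa C} (p : Fin (n + 1) → (Z.P ⟶ A.V.X))
    (u : Fin (n + 1) → (Z.V.X ⟶ A.V.X)) [∀ i, IsAddMonHom (u i)] (q : Z.P ⟶ A.P)
    (w : Z.V.X ⟶ A.V.X) [IsAddMonHom w] {m : ℕ} [Nonempty (Fin m)] {W : C}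
    (d : Fin m → (W ⟶ Z.V.X)) (z : W ⟶ Z.P) :
    FaaHom.eval (((faaStr C).jet f).eval
        (fun i => (lin (B := diag A.V) (p i) (u i) : Z ⟶ diag A.V)) (lin q w : Z ⟶ A)) d z =
      ∑ σ : PartialInj (n + 1) m, FaaHom.eval f (slotVec σ (fun i => z ≫ p i)
        (fun i j => d j ≫ u i) (fun j => d j ≫ w)) (z ≫ q) := by
  induction n generalizing A B with
  | zero =>
    rw [faaStr_jet_eval_zero, lift_lin]
    refine (lin_comp_eval _ _ (faaD f) d z).trans ((FaaHom.deriv_eval f _ _).trans ?_)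
    rw [sum_partialInj_succ]
    have : Unique (PartialInj 0 m) :=
      { default := ⟨fun i => i.elim0, fun i => i.elim0⟩
        uniq := fun σ => Subtype.ext (funext fun i => i.elim0) }
    rw [Fintype.sum_unique]
    have : Nonempty (Slots (default : PartialInj 0 m)) :=
      let ⟨j⟩ := (inferInstance : Nonempty (Fin m))
      ⟨Sum.inr ⟨j, fun i => i.elim0⟩⟩
    rw [← dval_slotVec]
    let e : Slots (default : PartialInj 0 m) ≃ Fin m :=
      { toFun := Sum.elim (fun i => i.elim0) Subtype.val
        invFun := fun j => Sum.inr ⟨j, fun i => i.elim0⟩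
        left_inv := by
          rintro (i | j)
          · exact i.elim0
          · rfl
        right_inv := fun _ => rfl }
    rw [← dval_equiv f _ _ _ _ e]
    refine congr (congr (congr (congrArg (dval f) (funext fun s => ?_)) (funext fun s => ?_)) ?_) ?_
    · cases s with
      | inl i => exact i.elim0
      | inr j => exact (Category.assoc _ _ _).trans (congrArg (fun k => d j ≫ k) (lift_fst _ _))
    · cases s with
      | inl i => exact i.elim0
      | inr j => exact (Category.assoc _ _ _).trans (congrArg (fun k => d j ≫ k) (lift_snd _ _))
    · exact (Category.assoc _ _ _).trans (congrArg (fun k => z ≫ k) (lift_fst _ _))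
    · exact (Category.assoc _ _ _).trans (congrArg (fun k => z ≫ k) (lift_snd _ _))
  | succ n ih =>
    rw [faaStr_jet_eval_succ]
    simp only [lift_zero_lin, lift_lin]
    refine (ih (faaD f) (fun i => lift (0 : Z.P ⟶ A.V.X) (p i.succ))
      (fun i => lift (0 : Z.V.X ⟶ A.V.X) (u i.succ)) (lift (p 0) q) (lift (u 0) w)).trans ?_
    rw [sum_partialInj_succ (n := n + 1)]
    refine Finset.sum_congr rfl fun σ _ => ?_
    rw [← dval_slotVec]
    refine (FaaHom.deriv_eval f _ _).trans ?_
    refine congr (congr (congr (congrArg (dval f) (funext fun s => ?_)) (funext fun s => ?_)) ?_) ?_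
    · rcases s with i | j
      · simp only [Sum.elim_inl]
        cases σ.1 i
        · exact (Category.assoc _ _ _).trans ((congrArg (fun k => z ≫ k) (lift_fst _ _)).trans
            (comp_zero _))
        · exact (Category.assoc _ _ _).trans ((congrArg (fun k => d _ ≫ k) (lift_fst _ _)).trans
            (comp_zero _))
      · simp
    · rcases s with i | j
      · simp only [Sum.elim_inl]
        cases σ.1 i <;> simp
      · simp
    · simp
    · simp

/-- The projections of a power in `Faa C` are linear. -/
lemma exists_lin_proj (M : CMon C) (A : Faa C) {n : ℕ} (i : Fin n) :
    ∃ (u : (pow (diag M) A n).V.X ⟶ M.X) (_ : IsAddMonHom u),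
      proj (diag M) A i = (lin (B := diag M) (proj (diag M) A i).pt u : _ ⟶ diag M) := by
  induction n with
  | zero => exact i.elim0
  | succ n ih =>
    refine Fin.cases ?_ (fun i => ?_) i
    · exact ⟨fst M.X (pow (diag M) A n).V.X, inferInstance, rfl⟩
    · obtain ⟨u, hu, h⟩ := ih i
      have e := lin_comp_lin (A := diag M ⊗ pow (diag M) A n) (D := diag M)
        (snd M.X (pow (diag M) A n).P) (snd M.X (pow (diag M) A n).V.X) (proj (diag M) A i).pt u
      exact ⟨snd M.X (pow (diag M) A n).V.X ≫ u, inferInstance,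
        (congrArg (fun k => snd (diag M) (pow (diag M) A n) ≫ k) h).trans e⟩

lemma exists_lin_base (M : CMon C) (A : Faa C) (n : ℕ) :
    ∃ (u : (pow (diag M) A n).V.X ⟶ A.V.X) (_ : IsAddMonHom u),
      base (diag M) A n = (lin (base (diag M) A n).pt u : _ ⟶ A) := by
  induction n with
  | zero => exact ⟨𝟙 _, inferInstance, rfl⟩
  | succ n ih =>
    obtain ⟨u, hu, h⟩ := ih
    have e := lin_comp_lin (A := diag M ⊗ pow (diag M) A n) (D := A)
      (snd M.X (pow (diag M) A n).P) (snd M.X (pow (diag M) A n).V.X) (base (diag M) A n).pt u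
    exact ⟨snd M.X (pow (diag M) A n).V.X ≫ u, inferInstance,
      (congrArg (fun k => snd (diag M) (pow (diag M) A n) ≫ k) h).trans e⟩

lemma jet_app_eq {S : GCDStr C} {X Y : C} (f : X ⟶ Y) (n : ℕ) :
    (S.jet f).app ⟨n + 1, n.succ_pos⟩ = (S.jet f).eval
      (fun i : Fin (n + 1) => proj (S.L₀ X) X i) (base (S.L₀ X) X (n + 1)) := by
  have h := eval_fin (S.jet f) (n := ⟨n + 1, n.succ_pos⟩) (fun i => proj (S.L₀ X) X i)
    (base (S.L₀ X) X (n + 1))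
  refine Eq.trans ?_ h.symm
  exact ((congrArg (fun k => k ≫ _) (tuple_proj_base _ _ _)).trans (Category.id_comp _)).symm

/-- The comultiplication formula: the iterated derivatives of `f` are evaluated at the projections
of the power `(A, A)ⁿ × (A, X)`, which are linear. -/
lemma isDelta_jet (f : A ⟶ B) : IsDelta f ((faaStr C).jet f : deltaObj A ⟶ deltaObj B) where
  pt := rfl
  app_pt n := by
    obtain ⟨n, hn⟩ := n
    obtain ⟨n, rfl⟩ : ∃ m, n = m + 1 := ⟨n - 1, by omega⟩
    exact (congrArg FaaHom.pt (jet_app_eq (S := faaStr C) f n)).trans (pt_jet_eval n f _ _)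
  app_app n m := by
    obtain ⟨n, hn⟩ := n
    obtain ⟨n, rfl⟩ : ∃ m, n = m + 1 := ⟨n - 1, by omega⟩
    choose u hu hp using fun i : Fin (n + 1) => exists_lin_proj A.V A i
    obtain ⟨w, hw, hb⟩ := exists_lin_base A.V A (n + 1)
    let P := deltaDom A (n + 1)
    have h1 : FaaHom.app (((faaStr C).jet f).app ⟨n + 1, hn⟩) m =
        FaaHom.eval (((faaStr C).jet f).app ⟨n + 1, hn⟩) (fun i : Fin m => proj P.V.X P.P i)
          (base P.V.X P.P m) := by
      refine Eq.trans ?_ (eval_fin _ _ _).symm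
      exact ((congrArg (fun k => k ≫ _) (tuple_proj_base _ _ _)).trans (Category.id_comp _)).symm
    refine h1.trans ?_
    have h2 : ((faaStr C).jet f).app ⟨n + 1, hn⟩ = ((faaStr C).jet f).eval
        (fun i => (lin (B := diag A.V) (proj (diag A.V) A i).pt (u i) : P ⟶ diag A.V))
        (lin (base (diag A.V) A (n + 1)).pt w : P ⟶ A) := by
      refine (jet_app_eq (S := faaStr C) f n).trans ?_
      exact congr (congrArg ((faaStr C).jet f).eval (funext hp)) hb
    refine (congrArg (fun k : FaaHom P (diag B.V) => k.eval (fun i : Fin m => proj P.V.X P.P i)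
      (base P.V.X P.P m)) h2).trans ?_
    refine (jet_eval_lin n f _ u _ w _ _).trans ?_
    unfold deltaApp
    refine Finset.sum_congr rfl fun σ _ => ?_
    have e1 : ∀ i (j : Fin m), FaaHom.eval (deltaVec A i) (fun _ : Unit => proj P.V.X P.P j)
        (base P.V.X P.P m) = proj P.V.X P.P j ≫ u i := fun i j =>
      (congrArg (fun k : P ⟶ diag A.V => FaaHom.eval k (fun _ : Unit => proj P.V.X P.P j)
        (base P.V.X P.P m)) (hp i)).trans (lin_eval_subsingleton _ _ _ _ ())
    have e2 : ∀ j : Fin m, FaaHom.eval (deltaBase A (n + 1)) (fun _ : Unit => proj P.V.X P.P j)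
        (base P.V.X P.P m) = proj P.V.X P.P j ≫ w := fun j =>
      (congrArg (fun k : P ⟶ A => FaaHom.eval k (fun _ : Unit => proj P.V.X P.P j)
        (base P.V.X P.P m)) hb).trans (lin_eval_subsingleton _ _ _ _ ())
    have e3 : (fun i (j : Fin m) => proj P.V.X P.P j ≫ u i) = _ :=
      funext fun i => funext fun j => (e1 i j).symm
    have e4 : (fun (j : Fin m) => proj P.V.X P.P j ≫ w) = _ := funext fun j => (e2 j).symm
    rw [e3, e4]
    rfl

end Formula

/-! ### The comonad -/

/-- The comultiplication of `Faa`: the jet functor of the differential structure of `Faa C`. -/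
noncomputable def faaComul : faaFunctor.{v, u} ⟶ faaFunctor ⋙ faaFunctor where
  app C := (faaStr C.carrier).jetFunctor
  naturality _ _ F := (StrictFunctor.jetFunctor_comp_faa
    (StrictFunctor.preserves_faa (CartCat.functor F))).symm

lemma isFaaComul_faaComul : IsFaaComul faaComul.{v, u} where
  obj _ _ := rfl
  map _ _ _ f := ⟨_, isDelta_jet f, HEq.rfl⟩

lemma faaComul_coassoc (C : CartCat.{v, u}) : faaComul.app C ≫ faaFunctor.map (faaComul.app C) =
    faaComul.app C ≫ faaComul.app (faaFunctor.obj C) := by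
  have h : (faaStr C.carrier).jetFunctor.comp (faaStr C.carrier).jetFunctor.faa =
      (faaStr C.carrier).jetFunctor.comp (faaStr (Faa C.carrier)).jetFunctor :=
    StrictFunctor.jetFunctor_comp_faa (faaStr C.carrier).preserves_jetFunctor
  exact h

lemma faaComul_left_counit (C : CartCat.{v, u}) :
    faaComul.app C ≫ faaCounit.app (faaFunctor.obj C) = 𝟙 (faaFunctor.obj C) := rfl

lemma mapCMon_counit (C : CartCat.{v, u}) (M : CMon C.carrier) :
    (CartCat.functor (faaCounit.app C)).mapCMon (lam M) = M :=
  StrictFunctor.cmon_ext rfl rfl ((Category.comp_id _).trans rfl)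

/-- The point components of the iterated derivatives of `f` are the components of `f`. -/
lemma faaComul_right_counit (C : CartCat.{v, u}) :
    faaComul.app C ≫ faaFunctor.map (faaCounit.app C) = 𝟙 (faaFunctor.obj C) := by
  have hobj : ∀ A : Faa C.carrier,
      (CartCat.functor (faaCounit.app C)).faaObj (deltaObj A) = A := fun A =>
    congrArg (fun V => Faa.mk V A.P) (mapCMon_counit C A.V)
  refine StrictFunctor.ext' (Functor.hext hobj fun A B f => ?_)
  refine StrictFunctor.faaHom_heq (hobj A) (hobj B) _ _ HEq.rfl fun n => ?_
  refine (eqToHom_comp_heq _ _).trans ?_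
  let ε : StrictFunctor (Faa C.carrier) C.carrier := CartCat.functor (faaCounit.app C)
  have h : FaaHom.pt (((faaStr C.carrier).jet f).app n) =
      eqToHom (ε.obj_pow (diag A.V) A n) ≫ f.app n := by
    refine ((isDelta_jet f).app_pt n).trans ?_
    have e1 : (fun i : Fin n => FaaHom.pt (deltaVec A i)) = fun i : Fin n =>
        eqToHom (ε.obj_pow (diag A.V) A n) ≫ proj A.V.X A.P i :=
      funext fun i => ε.map_proj (diag A.V) A i
    have e2 : FaaHom.pt (deltaBase A n) =
        eqToHom (ε.obj_pow (diag A.V) A n) ≫ base A.V.X A.P n := ε.map_base (diag A.V) A n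
    unfold deltaPt
    refine (congr (congrArg (FaaHom.eval f) e1) e2).trans ((comp_eval f _ _ _).symm.trans ?_)
    refine congrArg (fun k => eqToHom (ε.obj_pow (diag A.V) A n) ≫ k) ((eval_fin _ _ _).trans ?_)
    exact (congrArg (fun k => k ≫ f.app n) (tuple_proj_base A.V.X A.P n)).trans
      (Category.id_comp _)
  exact (heq_of_eq h).trans (eqToHom_comp_heq _ _)

end

/-! ### Coalgebras -/

section

open FaaHom

section

variable {C : Type u} [Category.{v} C] [CartesianMonoidalCategory C]

lemma app_heq {A A' B B' : Faa C} (hA : A = A') (hB : B = B') {f : A ⟶ B} {g : A' ⟶ B'}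
    (h : f ≍ g) (n : ℕ+) : FaaHom.app f n ≍ FaaHom.app g n := by
  subst hA hB h
  rfl

lemma eval_of_heq {A A' B B' : Faa C} (hA : A = A') (hB : B = B') {f : A ⟶ B} {g : A' ⟶ B'}
    (h : f ≍ g) {ι : Type*} [Finite ι] [Nonempty ι] {Z : C} (a : ι → (Z ⟶ A.V.X)) (x : Z ⟶ A.P) :
    FaaHom.eval f a x ≫ eqToHom (congrArg (fun B => B.V.X) hB) =
      FaaHom.eval g (fun i => a i ≫ eqToHom (congrArg (fun B => B.V.X) hA))
        (x ≫ eqToHom (congrArg Faa.P hA)) := by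
  subst hA hB h
  simp

lemma add_heq {M N : CMon C} (h : M = N) : M.add ≍ N.add := by
  subst h
  rfl

lemma zero_heq {M N : CMon C} (h : M = N) : M.zero ≍ N.zero := by
  subst h
  rfl

end

variable {C : Type (max u v)} [Category.{v} C] [CartesianMonoidalCategory C]

variable (C) in
/-- A functor `C ⥤ Faa C` preserving the chosen finite products and sending each `X` to a pair `(L
X, X)`. The second component of the value at `X` is `X` by definition, so that no casts along the
counit law are needed. -/
structure FaaSection where
  L : C → CMon C
  map {X Y : C} (f : X ⟶ Y) : (⟨L X, X⟩ : Faa C) ⟶ ⟨L Y, Y⟩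
  map_id (X : C) : map (𝟙 X) = 𝟙 _
  map_comp {X Y Z : C} (f : X ⟶ Y) (g : Y ⟶ Z) : map (f ≫ g) = map f ≫ map g
  obj_unit : (⟨L (𝟙_ C), 𝟙_ C⟩ : Faa C) = 𝟙_ (Faa C)
  obj_prod (X Y : C) : (⟨L (X ⊗ Y), X ⊗ Y⟩ : Faa C) = (⟨L X, X⟩ : Faa C) ⊗ (⟨L Y, Y⟩ : Faa C)
  map_fst (X Y : C) : map (fst X Y) = eqToHom (obj_prod X Y) ≫ fst _ _
  map_snd (X Y : C) : map (snd X Y) = eqToHom (obj_prod X Y) ≫ snd _ _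

namespace FaaSection

/-- The functor itself. -/
abbrev functor (s : FaaSection C) : StrictFunctor C (Faa C) where
  obj X := ⟨s.L X, X⟩
  map := s.map
  map_id := s.map_id
  map_comp := s.map_comp
  obj_unit := s.obj_unit
  obj_prod := s.obj_prod
  map_fst := s.map_fst
  map_snd := s.map_snd

lemma exists_eq_functor (a : StrictFunctor C (Faa C)) (h : ∀ X, (a.obj X).P = X) :
    ∃ s : FaaSection C, a = s.functor := by
  cases a with
  | mk F h₃ h₄ h₅ h₆ =>
    rcases F with ⟨obj, m, h₁, h₂⟩
    dsimp only at h
    obtain ⟨L, rfl⟩ : ∃ L : C → CMon C, obj = fun X => ⟨L X, X⟩ :=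
      ⟨fun X => (obj X).V, funext fun X => congrArg (Faa.mk (obj X).V) (h X)⟩
    exact ⟨⟨L, m, h₁, @h₂, h₃, h₄, h₅, h₆⟩, rfl⟩

variable (s : FaaSection C)

/-- The vectors of the value at `X`. -/
abbrev L₀ (X : C) : C := (s.L X).X

/-- The component of degree one. -/
abbrev D {X Y : C} (f : X ⟶ Y) : s.L₀ X ⊗ X ⟶ s.L₀ Y := (s.map f).app 1

variable {s} (hpt : ∀ {X Y : C} (f : X ⟶ Y), FaaHom.pt (s.map f) = f)
  (coassoc : s.functor.comp (faaStr C).jetFunctor = s.functor.comp s.functor.faa)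

include coassoc

lemma lam_eq (X : C) : lam (s.L X) = s.functor.mapCMon (s.L X) :=
  congrArg Faa.V (Functor.congr_obj (congrArg StrictFunctor.toFunctor coassoc) X)

lemma L_obj (X : C) : s.L (s.L₀ X) = s.L X :=
  (congrArg (fun M => M.X.V) (lam_eq coassoc X)).symm

lemma obj_L₀ (X : C) : (⟨s.L (s.L₀ X), s.L₀ X⟩ : Faa C) = diag (s.L X) :=
  congrArg (fun V => Faa.mk V (s.L₀ X)) (L_obj coassoc X)

lemma obj_dom (X : C) :
    (⟨s.L (s.L₀ X ⊗ X), s.L₀ X ⊗ X⟩ : Faa C) = (diag (s.L X)).prod ⟨s.L X, X⟩ :=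
  (s.obj_prod _ _).trans (congrArg (fun A => A ⊗ (⟨s.L X, X⟩ : Faa C)) (obj_L₀ coassoc X))

/-- Coassociativity in degree one: the value at a derivative is the derivative of the value. -/
lemma map_D_heq {X Y : C} (f : X ⟶ Y) : s.map (s.D f) ≍ faaD (s.map f) := by
  have h := Functor.hcongr_hom (congrArg StrictFunctor.toFunctor coassoc) f
  have h' := app_heq (Functor.congr_obj (congrArg StrictFunctor.toFunctor coassoc) X)
    (Functor.congr_obj (congrArg StrictFunctor.toFunctor coassoc) Y) h 1
  exact ((eqToHom_comp_heq _ _).symm.trans h'.symm)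

lemma D_D_eq {X Y : C} (f : X ⟶ Y) : s.D (s.D f) ≍ (FaaHom.deriv (s.map f)).app 1 :=
  app_heq (obj_dom coassoc X) (obj_L₀ coassoc Y) (map_D_heq coassoc f) 1

lemma map_add_heq (X : C) : s.map (s.L X).add ≍ lamAdd (s.L X) := by
  have := add_heq (lam_eq coassoc X)
  exact ((eqToHom_comp_heq _ _).symm.trans this.symm)

lemma map_zero_heq (X : C) : s.map (s.L X).zero ≍ lamZero (s.L X) := by
  have := zero_heq (lam_eq coassoc X)
  exact ((eqToHom_comp_heq _ _).symm.trans this.symm)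

include hpt

/-- The differential structure given by a coalgebra. -/
def str : GCDStr C where
  L := s.L
  L_obj := L_obj coassoc
  L_unit := congrArg Faa.V s.obj_unit
  L_prod X Y := congrArg Faa.V (s.obj_prod X Y)
  D f := s.D f
  cd1_add X := by
    have h := app_heq ((s.obj_prod _ _).trans (by rw [obj_L₀ coassoc])) (obj_L₀ coassoc X)
      (map_add_heq coassoc X) 1
    exact h
  cd1_zero X := by
    have h := app_heq s.obj_unit (obj_L₀ coassoc X)
      (map_zero_heq coassoc X) 1
    exact h
  cd2_add f a b c := (s.map f).app_one_add a b c
  cd2_zero f c := (s.map f).app_one_zero c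
  cd3_fst X Y := by
    have h : s.map (fst X Y) ≍ fst (⟨s.L X, X⟩ : Faa C) (⟨s.L Y, Y⟩ : Faa C) :=
      (heq_of_eq (s.map_fst X Y)).trans (eqToHom_comp_heq _ _)
    exact app_heq (s.obj_prod X Y) rfl h 1
  cd3_snd X Y := by
    have h : s.map (snd X Y) ≍ snd (⟨s.L X, X⟩ : Faa C) (⟨s.L Y, Y⟩ : Faa C) :=
      (heq_of_eq (s.map_snd X Y)).trans (eqToHom_comp_heq _ _)
    exact app_heq (s.obj_prod X Y) rfl h 1
  cd4 {X Y Z} f g := by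
    have h : s.map (lift f g) ≍ Faa.lift' (s.map f) (s.map g) :=
      (comp_eqToHom_heq _ _).symm.trans
        (heq_of_eq ((s.functor.map_lift f g).trans (faa_lift _ _)))
    exact app_heq rfl (s.obj_prod Y Z) h 1
  cd5 {X Y Z} f g := by
    have h : s.D (f ≫ g) = _ := (congrArg (fun k => FaaHom.app k 1) (s.map_comp f g)).trans
      (comp_app_one (s.map f) (s.map g))
    rw [hpt f] at h
    exact h
  cd6 {X Y Z} f a c d := by
    have h : eqToHom (congrArg (fun A => A.V.X ⊗ A.P) (obj_dom coassoc X).symm) ≫ s.D (s.D f) ≫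
        eqToHom (congrArg (fun A => A.V.X) (obj_L₀ coassoc Y)) =
        (FaaHom.deriv (s.map f)).app 1 := eq_of_heq ((eqToHom_comp_heq _ _).trans
          ((comp_eqToHom_heq _ _).trans (D_D_eq coassoc f)))
    exact (congrArg (fun k => lift (lift a 0) (lift c d) ≫ k) h).trans
      ((s.map f).deriv_app_one_left a c d)
  cd7 {X Y Z} f b c d := by
    have h : eqToHom (congrArg (fun A => A.V.X ⊗ A.P) (obj_dom coassoc X).symm) ≫ s.D (s.D f) ≫
        eqToHom (congrArg (fun A => A.V.X) (obj_L₀ coassoc Y)) =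
        (FaaHom.deriv (s.map f)).app 1 := eq_of_heq ((eqToHom_comp_heq _ _).trans
          ((comp_eqToHom_heq _ _).trans (D_D_eq coassoc f)))
    exact (congrArg (fun k => lift (lift 0 b) (lift c d) ≫ k) h).trans
      (((s.map f).deriv_app_one_symm b c d).trans
        (congrArg (fun k => lift (lift 0 c) (lift b d) ≫ k) h).symm)

/-- A coalgebra is the jet functor of its differential structure: by coassociativity, the components
of degree `n + 1` of the value at `f` are determined by those of degree `n` of the value at `D f`.
-/
lemma map_eval (n : ℕ) {X Y Z : C} (f : X ⟶ Y) (a : Fin (n + 1) → (Z ⟶ s.L₀ X)) (x : Z ⟶ X) :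
    FaaHom.eval (s.map f) a x = ((str hpt coassoc).jet f).eval a x := by
  induction n generalizing X Y with
  | zero =>
    have : Subsingleton (Fin (0 + 1)) := inferInstanceAs (Subsingleton (Fin 1))
    exact (eval_unique _ _ _ 0).trans ((str hpt coassoc).jet_eval_subsingleton f a x 0).symm
  | succ n ih =>
    let S := str hpt coassoc
    have h := eval_of_heq (obj_dom coassoc X) (obj_L₀ coassoc Y) (map_D_heq coassoc f)
      (fun i : Fin (n + 1) => S.tan 0 (a i.succ)) (lift (a 0) x)
    refine Eq.trans ?_ (S.jet_eval_succ f a x).symm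
    refine Eq.trans ?_ (congrArg (fun k => k ≫ S.flat Y) (ih (s.D f)
      (fun i => S.tan 0 (a i.succ)) (lift (a 0) x)))
    refine Eq.trans ?_ h.symm
    refine Eq.trans ?_ (FaaHom.deriv_eval (s.map f) _ _).symm
    refine (eval_fin_succ _ _ _).trans ((dval_zero _ _ _ _).symm.trans ?_)
    have ht : ∀ i : Fin (n + 1), S.tan 0 (a i.succ) ≫ eqToHom (S.L₀_dom X) =
      lift 0 (a i.succ) := fun i => S.tan_eqToHom _ _ _
    refine congr (congr (congr (congrArg (dval (s.map f)) (funext fun i => ?_))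
      (funext fun i => ?_)) ?_) ?_
    · exact ((congrArg (fun k => k ≫ fst _ _) (ht i)).trans (lift_fst _ _)).symm
    · exact ((congrArg (fun k => k ≫ snd _ _) (ht i)).trans (lift_snd _ _)).symm
    · exact ((congrArg (fun k => k ≫ fst _ _) (Category.comp_id _)).trans (lift_fst _ _)).symm
    · exact ((congrArg (fun k => k ≫ snd _ _) (Category.comp_id _)).trans (lift_snd _ _)).symm

lemma eq_jetFunctor : s.functor = (str hpt coassoc).jetFunctor := by
  refine StrictFunctor.ext' (Functor.hext (fun _ => rfl) fun X Y f => heq_of_eq ?_)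
  refine ext_eval (hpt f) fun n Z a x => ?_
  obtain ⟨n, hn⟩ := n
  obtain ⟨n, rfl⟩ : ∃ m, n = m + 1 := ⟨n - 1, by omega⟩
  exact map_eval hpt coassoc n f a x

end FaaSection

end

/-! ### Coalgebras are differential categories -/

section

open FaaHom

section

variable {C D : Type (max u v)} [Category.{v} C] [CartesianMonoidalCategory C]
  [Category.{v} D] [CartesianMonoidalCategory D]

/-- The functor sending a morphism of `Faa C` to its point component. -/
noncomputable abbrev counitFunctor (C : Type (max u v)) [Category.{v} C]
    [CartesianMonoidalCategory C] : StrictFunctor (Faa C) C :=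
  CartCat.functor (faaCounit.app { carrier := C })

lemma exists_eq_jetFunctor (a : StrictFunctor C (Faa C))
    (counit : a.comp (counitFunctor C) = StrictFunctor.id C)
    (coassoc : a.comp (faaStr C).jetFunctor = a.comp a.faa) :
    ∃ S : GCDStr C, a = S.jetFunctor := by
  have hP : ∀ X, (a.obj X).P = X := fun X =>
    Functor.congr_obj (congrArg StrictFunctor.toFunctor counit) X
  obtain ⟨s, rfl⟩ := FaaSection.exists_eq_functor a hP
  have hpt : ∀ {X Y : C} (f : X ⟶ Y), FaaHom.pt (s.map f) = f := fun f =>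
    eq_of_heq (Functor.hcongr_hom (congrArg StrictFunctor.toFunctor counit) f)
  exact ⟨_, FaaSection.eq_jetFunctor hpt coassoc⟩

lemma GCDStr.jetFunctor_injective {S T : GCDStr C} (h : S.jetFunctor = T.jetFunctor) : S = T := by
  have hL : S.L = T.L := funext fun X =>
    congrArg Faa.V (Functor.congr_obj (congrArg StrictFunctor.toFunctor h) X)
  have hD : ∀ {X Y : C} (f : X ⟶ Y), S.D f ≍ T.D f := fun {X Y} f =>
    app_heq (Functor.congr_obj (congrArg StrictFunctor.toFunctor h) X)
      (Functor.congr_obj (congrArg StrictFunctor.toFunctor h) Y)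
      (Functor.hcongr_hom (congrArg StrictFunctor.toFunctor h) f) 1
  cases S with
  | mk S _ _ _ _ _ _ _ _ _ _ =>
    cases T with
    | mk T _ _ _ _ _ _ _ _ _ _ =>
      cases S
      cases T
      dsimp only at hL
      subst hL
      congr 2
      funext X Y f
      exact eq_of_heq (hD f)

/-- Conversely to `StrictFunctor.jetFunctor_comp_faa`, a functor compatible with the jet functors
preserves the differential structure. -/
lemma GCDStr.preserves_of_comp_faa {S : GCDStr C} {T : GCDStr D} {F : StrictFunctor C D}
    (h : S.jetFunctor.comp F.faa = F.comp T.jetFunctor) : S.Preserves T F where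
  L_eq X := (congrArg Faa.V (Functor.congr_obj (congrArg StrictFunctor.toFunctor h) X)).symm
  D_heq {X Y} f := by
    have h' := app_heq (Functor.congr_obj (congrArg StrictFunctor.toFunctor h) X)
      (Functor.congr_obj (congrArg StrictFunctor.toFunctor h) Y)
      (Functor.hcongr_hom (congrArg StrictFunctor.toFunctor h) f) 1
    exact (((eqToHom_comp_heq _ _).symm.trans h').symm)

end

/-- The Faà di Bruno comonad. -/
noncomputable abbrev faaW : Comonad CartCat.{v, u} :=
  faaComonad faaComul faaComul_coassoc faaComul_left_counit faaComul_right_counit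

lemma coalgebra_exists_str (A : faaW.{v, u}.Coalgebra) :
    ∃ S : GCDStr A.A.carrier, A.a = S.jetFunctor :=
  exists_eq_jetFunctor (CartCat.functor A.a) A.counit A.coassoc

/-- The differential structure corresponding to a coalgebra. It is unique by
`GCDStr.jetFunctor_injective`. -/
noncomputable def coalgebraStr (A : faaW.{v, u}.Coalgebra) : GCDStr A.A.carrier :=
  (coalgebra_exists_str A).choose

lemma coalgebra_a_eq (A : faaW.{v, u}.Coalgebra) : A.a = (coalgebraStr A).jetFunctor :=
  (coalgebra_exists_str A).choose_spec

/-- The generalized cartesian differential category corresponding to a coalgebra. -/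
noncomputable def ofCoalgebra : faaW.{v, u}.Coalgebra ⥤ GCDCat.{v, u} where
  obj A := ⟨A.A, coalgebraStr A⟩
  map {A B} f := ⟨f.f, GCDStr.preserves_of_comp_faa (by
    have h := f.h
    rw [coalgebra_a_eq A, coalgebra_a_eq B] at h
    exact h)⟩

lemma jetFunctor_comp_counit {C : CartCat.{v, u}} (S : GCDStr C.carrier) :
    S.jetFunctor.comp (CartCat.functor (faaCounit.app C)) = StrictFunctor.id C.carrier :=
  StrictFunctor.ext' (Functor.hext (fun _ => rfl) fun _ _ _ => HEq.rfl)

/-- The coalgebra corresponding to a generalized cartesian differential category. -/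
noncomputable def toCoalgebra : GCDCat.{v, u} ⥤ faaW.{v, u}.Coalgebra where
  obj G :=
    { A := G.cart
      a := G.str.jetFunctor
      counit := jetFunctor_comp_counit G.str
      coassoc := (StrictFunctor.jetFunctor_comp_faa G.str.preserves_jetFunctor).symm }
  map F := { f := F.1, h := StrictFunctor.jetFunctor_comp_faa F.2 }

lemma coalgebra_ext {A B : faaW.{v, u}.Coalgebra} (h : A.A = B.A) (h' : A.a ≍ B.a) : A = B := by
  cases A
  cases B
  cases h
  cases h'
  rfl

lemma ofCoalgebra_toCoalgebra : ofCoalgebra ⋙ toCoalgebra = 𝟭 faaW.{v, u}.Coalgebra := by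
  have hobj : ∀ A : faaW.{v, u}.Coalgebra, toCoalgebra.obj (ofCoalgebra.obj A) = A := fun A =>
    coalgebra_ext rfl (heq_of_eq (coalgebra_a_eq A).symm)
  have key : ∀ {A A' B B' : faaW.{v, u}.Coalgebra} (hA : A = A') (hB : B = B') (f : A ⟶ B)
      (g : A' ⟶ B'), f.f ≍ g.f → f ≍ g := by
    rintro A _ B _ rfl rfl f g h
    exact heq_of_eq (Comonad.Coalgebra.Hom.ext (eq_of_heq h))
  exact Functor.hext hobj fun A B f => key (hobj A) (hobj B) _ _ HEq.rfl

lemma toCoalgebra_ofCoalgebra : toCoalgebra ⋙ ofCoalgebra = 𝟭 GCDCat.{v, u} := by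
  have hobj : ∀ G : GCDCat.{v, u}, ofCoalgebra.obj (toCoalgebra.obj G) = G := fun G =>
    congrArg (GCDCat.mk G.cart)
      (GCDStr.jetFunctor_injective (coalgebra_a_eq (toCoalgebra.obj G))).symm
  have key : ∀ {A A' B B' : GCDCat.{v, u}} (hA : A = A') (hB : B = B') (f : A ⟶ B)
      (g : A' ⟶ B'), f.1 ≍ g.1 → f ≍ g := by
    rintro A _ B _ rfl rfl f g h
    exact heq_of_eq (Subtype.ext (eq_of_heq h))
  exact Functor.hext hobj fun A B f => key (hobj A) (hobj B) _ _ HEq.rfl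

lemma corresponds_coalgebraStr (A : faaW.{v, u}.Coalgebra) : Corresponds A.a (coalgebraStr A) := by
  rw [coalgebra_a_eq A]
  exact ⟨fun _ => rfl, fun _ => HEq.rfl⟩

/-- The cofree generalized cartesian differential category on a cartesian category. -/
noncomputable def cofree : CartCat.{v, u} ⥤ GCDCat.{v, u} where
  obj C := ⟨faaFunctor.obj C, faaStr C.carrier⟩
  map F := ⟨faaFunctor.map F, StrictFunctor.preserves_faa (CartCat.functor F)⟩
  map_id C := Subtype.ext (faaFunctor.map_id C)
  map_comp F G := Subtype.ext (faaFunctor.map_comp F G)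

/-- The unit of the adjunction with the forgetful functor is given by the jet functors. -/
noncomputable def forgetAdj : GCDCat.forget.{v, u} ⊣ cofree where
  unit :=
    { app := fun G => ⟨G.str.jetFunctor, G.str.preserves_jetFunctor⟩
      naturality := fun _ _ F => Subtype.ext (StrictFunctor.jetFunctor_comp_faa F.2).symm }
  counit := faaCounit
  left_triangle_components _ := rfl
  right_triangle_components C := Subtype.ext (faaComul_right_counit C)

lemma toCoalgebra_isEquivalence : toCoalgebra.{v, u}.IsEquivalence :=
  (CategoryTheory.Equivalence.mk toCoalgebra ofCoalgebra (eqToIso toCoalgebra_ofCoalgebra.symm)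
    (eqToIso ofCoalgebra_toCoalgebra)).isEquivalence_functor

lemma forget_comonadic : Nonempty (ComonadicLeftAdjoint GCDCat.forget.{v, u}) :=
  ⟨{ R := cofree
     adj := forgetAdj
     -- The comparison functor of `forgetAdj` is `toCoalgebra` by definition.
     eqv := toCoalgebra_isEquivalence }⟩

end

end GenDiff

theorem mainTheorem1 :
    ∃ (δ : faaFunctor.{v, u} ⟶ faaFunctor ⋙ faaFunctor)
      (coassoc : ∀ C, δ.app C ≫ faaFunctor.map (δ.app C) = δ.app C ≫ δ.app (faaFunctor.obj C))
      (left_counit : ∀ C, δ.app C ≫ faaCounit.app (faaFunctor.obj C) = 𝟙 (faaFunctor.obj C))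
      (right_counit : ∀ C, δ.app C ≫ faaFunctor.map (faaCounit.app C) = 𝟙 (faaFunctor.obj C)),
      IsFaaComul δ ∧
      (let W : Comonad CartCat.{v, u} := faaComonad δ coassoc left_counit right_counit
       ∃ (Φ : W.Coalgebra ⥤ GCDCat.{v, u}) (Ψ : GCDCat.{v, u} ⥤ W.Coalgebra),
        Φ ⋙ Ψ = 𝟭 W.Coalgebra ∧ Ψ ⋙ Φ = 𝟭 GCDCat.{v, u} ∧
        Φ ⋙ GCDCat.forget = W.forget ∧
        ∀ A : W.Coalgebra, ∃ S : GCDStr A.A.carrier, Corresponds A.a S ∧ Φ.obj A = ⟨A.A, S⟩) ∧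
      Nonempty (ComonadicLeftAdjoint GCDCat.forget.{v, u}) := by
  exact ⟨faaComul, faaComul_coassoc, faaComul_left_counit, faaComul_right_counit,
    isFaaComul_faaComul, ⟨ofCoalgebra, toCoalgebra, ofCoalgebra_toCoalgebra,
      toCoalgebra_ofCoalgebra, rfl, fun A => ⟨_, corresponds_coalgebraStr A, rfl⟩⟩,
    forget_comonadic⟩
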